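/- **Setting.** Fix $d$, $\Theta\subseteq\mathbb R^d$ and constants $M,\delta,\rho,\kappa,\sigma_1,\dots,\sigma_5>0$, $r_1,r_2>2$, $\alpha\in(0,1/2]$. We consider a sequence of multitask problems; all of the following objects may change along the sequence, while the constants do not. There are $m$ tasks, partitioned into $K$ nonempty clusters $S_1,\dots,S_K$; put $m_k=|S_k|$, $N_k=\sum_{j\in S_k}n_j$, $N_{\min}=\min_kN_k$, $n_{\min}=\min_jn_j$, $n_{\max}=\max_jn_j$. Task $j$ has a law $P_j$, a seminormed nuisance space $\mathcal H_j$, a loss $\ell_j(\theta,\eta,z)$, a risk $R_j(\theta,\eta)=\mathbb E_{Z\sim P_j}\ell_j(\theta,\eta,Z)$, a true nuisance $\eta_j^*\in\mathcal H_j$ and a true target $\theta_j^*\in\arg\min_{\theta\in\Theta}R_j(\theta,\eta_j^*)$. There are centroids $\beta_k^*$ with $\|\beta_k^*-\beta_{k'}^*\|\ge\delta$ for $k\ne k'$ and $\|\theta_j^*-\beta_k^*\|\le\xi_k$ for $j\in S_k$; $\xi_{\max}=\max_k\xi_k$. One observes evaluation samples $Z_{j1},\dots,Z_{jn_j}\sim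 P_j$, all independent, and nuisance estimators $\hat\eta_j$ computed from auxiliary samples which are jointly independent of all evaluation samples; there are sets $\mathcal T_j\subseteq\mathcal H_j$ with $\mathbb P(\hat\eta_j\in\mathcal T_j\ \forall j)\to1$. Put $f_j(\theta,\eta)=\sum_{i\le n_j}\ell_j(\theta,\eta,Z_{ji})$; $\nabla,\nabla^2$ are derivatives in $\theta$ and $D_\eta$, $D_\eta^2$ are Gateaux derivatives in $\eta$. **Estimator.** Given pilot estimators $\hat\theta_j^{\rm init}$ and $c_w,\gamma>0$, $\tau$, $\varepsilon_n\ge0$, let $w_{jj'}=c_w\|\hat\theta^{\rm init}_j-\hat\theta^{\rm init}_{j'}\|^{-\gamma}$ ($=\infty$ if the pilots coincide), $\lambda_{jj'}=\varepsilon_n$ if $w_{jj'}\le\tau$ and $\lambda_{jj'}=w_{jj'}$ otherwise. Let $(\hat\theta_1,\dots,\hat\theta_m)$ be a measurable choice of a minimizer over $(\mathbb R^d)^m$ (whenever one exists) of $$\sum_jf_j(\theta_j,\hat\eta_j)+\sum_{j'<j}\lambda_{jj'}\|\theta_j-\theta_{j'}\|_2 .$$ **Assumptions.** (A1) For all $j$,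 with $\mathcal B_{\theta}$, $\mathcal B_\eta$ the closed balls of radius $M$ around $\theta_j^*,\eta_j^*$: $\ell_j(\cdot,\eta,z)$ is convex on $\mathbb R^d$ for $\eta\in\mathcal B_\eta$ and all $z$; for $\theta\in\mathcal B_\theta$, $\eta\in\mathcal B_\eta$ it is twice differentiable at $\theta$ and $R_j(\theta,\eta)$ is finite; and (1) $H_j(\theta)=\nabla^2R_j(\theta,\eta_j^*)$ satisfies $\rho I\preceq H_j(\theta)\preceq\kappa I$ on $\mathcal B_\theta$; (2) $\nabla R_j(\theta_j^*,\eta_j^*)=0$ and $\mathbb E\|\nabla\ell_j(\theta_j^*,\eta_j^*,Z)\|^{r_1}\le\sigma_1$; (3) $\mathbb E|\langle v,(\nabla^2\ell_j(\theta,\eta_j^*,Z)-H_j(\theta))v\rangle|^{r_2}\le\sigma_2$ for $\|v\|=1$, $\theta\in\mathcal B_\theta$; (4) $\mathbb E\sup\frac{\|\nabla^2\ell_j(\theta,\eta,Z)-\nabla^2\ell_j(\theta',\eta',Z)\|_2}{\|\theta-\theta'\|+\|\eta-\eta'\|}\le\sigma_3$, the supremum over distinct pairs in $\mathcal B_\theta\times\mathcal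 B_\eta$; and for all $\eta\in\mathcal T_j$, $h=\eta-\eta_j^*$, and all $\bar\eta$ on the segment from $\eta_j^*$ to $\eta$: (5) $D_\eta\nabla R_j(\theta_j^*,\eta_j^*)[h]=0$; (6) $\nabla\ell_j(\theta_j^*,\cdot,z)$ is twice Gateaux differentiable at $\bar\eta$ in the direction $h$ for all $z$, and $\mathbb E\|D_\eta\nabla\ell_j(\theta_j^*,\bar\eta,Z)[h]\|^2$ and $\mathbb E\|D^2_\eta\nabla\ell_j(\theta_j^*,\bar\eta,Z)[h,h]\|$ are at most $\sigma_5\|h\|^2$. (A2) $\mathbb E\|\hat\eta_j-\eta_j^*\|^2\le\sigma_4/s(n_j)^2$ for all $j$, where $s>0$, $n^{1/4}=o(s(n))$ and $s(n)=O(n^{1/2})$. (A3) For every $\epsilon>0$, $\mathbb P(\forall j:\ n_j^\alpha\|\hat\theta_j^{\rm init}-\theta_j^*\|<\epsilon)\ge1-p_\epsilon(n_{\min})$ with $p_\epsilon(n)\downarrow0$ as $n\to\infty$. (A4) For arbitrary constants $c_0,c_1,c_\xi>0$, $\zeta<1/2$ and $c_2\ge c_w(\delta/2)^{-\gamma}$: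 $n_{\min}^{\alpha\gamma}\ge c_0n_{\max}$, $\varepsilon_n\le c_1m^{-2}N_{\min}^{\zeta}$, $\tau\in\big(c_2,\,c_2\{n_{\min}^{-\alpha}+\xi_{\max}\}^{-\gamma}\big)$, and $\xi_k\le c_\xi\min_{j\in S_k}n_j^{-1/2}$. (A5) $m^{-1}\min\{n_{\min}^{r_2/(2(r_2+d))},\min_js(n_j)\}\to\infty$ along the sequence (in particular $n_{\min}\to\infty$). **Theorem.** Assume (A1)–(A5), $K=O(1)$, $\max_kb_{k,n}\to0$ where $b_{k,n}=Km_k^{1/2}\max_{j\in S_k}n_j^{1/2}s(n_j)^{-2}$, and $\max_k\sqrt{N_k}\,\xi_k\to0$. Let $$\tilde\Psi_k=\mathbb E\Big[N_k^{-1}\sum_{j\in S_k}\nabla^2f_j(\theta_j^*,\eta_j^*)\Big],\qquad \tilde\Omega_k=\mathbb E\Big[N_k^{-1}\Big\{\sum_{j\in S_k}\nabla f_j(\theta_j^*,\eta_j^*)\Big\}^{\otimes2}\Big].$$ Then for $j\in S_k$ (where the task $j$, and hence $k$, may depend on the index of the sequence) $$\sqrt{N_k}\,(\hat\theta_j-\theta_j^*)\Longrightarrow\mathcal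 N\big(0,\tilde\Psi_k^{-1}\tilde\Omega_k\tilde\Psi_k^{-1}\big),$$ in the sense that $\mathbb E\,\varphi\big(\sqrt{N_k}(\hat\theta_j-\theta_j^*)\big)-\int\varphi\,d\mathcal N\big(0,\tilde\Psi_k^{-1}\tilde\Omega_k\tilde\Psi_k^{-1}\big)\to0$ for every bounded continuous $\varphi:\mathbb R^d\to\mathbb R$ (the covariance may vary along the sequence; if it converges, this is convergence in distribution to the limiting normal law). -/

import Mathlib

open MeasureTheory ProbabilityTheory Filter Topology Set
open scoped ENNReal NNReal BoundedContinuousFunction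

noncomputable section

namespace Multitask

/-- The parameter space `ℝ^d` with its Euclidean norm. -/
abbrev Param (d : ℕ) : Type := EuclideanSpace ℝ (Fin d)

/-! ### Derivatives -/

/-- The Hessian of `g : ℝ^d → ℝ` at `θ`, as a linear map (the derivative of the gradient). -/
def hess {d : ℕ} (g : Param d → ℝ) (θ : Param d) : Param d →L[ℝ] Param d :=
  fderiv ℝ (gradient g) θ

/-- `g` is twice differentiable at `θ`. -/
def TwiceDiffAt {d : ℕ} (g : Param d → ℝ) (θ : Param d) : Prop :=
  DifferentiableAt ℝ g θ ∧ DifferentiableAt ℝ (gradient g) θ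

/-- The Hessian matrix of `g` at `θ`. -/
def hessMatrix {d : ℕ} (g : Param d → ℝ) (θ : Param d) : Matrix (Fin d) (Fin d) ℝ :=
  Matrix.of fun a b => hess g θ (EuclideanSpace.single b 1) a

/-- The Gateaux derivative `D_η g(η)[h]`. -/
def gateaux {d : ℕ} {H : Type*} [AddCommGroup H] [Module ℝ H]
    (g : H → Param d) (η h : H) : Param d :=
  deriv (fun t : ℝ => g (η + t • h)) 0

/-- The second Gateaux derivative `D_η² g(η)[h, h]`. -/
def gateaux₂ {d : ℕ} {H : Type*} [AddCommGroup H] [Module ℝ H]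
    (g : H → Param d) (η h : H) : Param d :=
  deriv (fun t : ℝ => gateaux g (η + t • h) h) 0

/-- `g` is twice Gateaux differentiable at `η` in the direction `h`. -/
def TwiceGateauxAt {d : ℕ} {H : Type*} [AddCommGroup H] [Module ℝ H]
    (g : H → Param d) (η h : H) : Prop :=
  DifferentiableAt ℝ (fun t : ℝ => g (η + t • h)) 0 ∧
    DifferentiableAt ℝ (fun t : ℝ => gateaux g (η + t • h) h) 0

/-! ### The multitask model -/

/-- The data of one multitask problem: tasks, clusters, losses, truth, samples and estimators.
The laws that these objects obey are stated in the predicates below. -/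
structure Model.{u₁, u₂, u₃, u₄} (d : ℕ) where
  /-- number of tasks -/
  m : ℕ
  /-- number of clusters -/
  K : ℕ
  /-- size of the evaluation sample of each task -/
  n : Fin m → ℕ
  /-- the cluster `k` with `j ∈ S_k` -/
  cluster : Fin m → Fin K
  /-- observation space of a task -/
  Obs : Fin m → Type u₁
  [obsMeas : ∀ j, MeasurableSpace (Obs j)]
  /-- nuisance space of a task -/
  Nuis : Fin m → Type u₂
  [nuisNorm : ∀ j, SeminormedAddCommGroup (Nuis j)]
  [nuisSpace : ∀ j, NormedSpace ℝ (Nuis j)]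
  /-- space of the auxiliary sample from which the nuisance of a task is estimated -/
  Train : Fin m → Type u₃
  [trainMeas : ∀ j, MeasurableSpace (Train j)]
  /-- law of one observation of a task -/
  P : ∀ j, Measure (Obs j)
  [probP : ∀ j, IsProbabilityMeasure (P j)]
  /-- orthogonal loss `ℓ_j(θ, η, z)` -/
  loss : ∀ j, Param d → Nuis j → Obs j → ℝ
  /-- true targets -/
  θs : Fin m → Param d
  /-- true nuisances -/
  ηs : ∀ j, Nuis j
  /-- cluster centroids -/
  βs : Fin K → Param d
  /-- within-cluster radii -/
  ξ : Fin K → ℝ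
  /-- nuisance realization sets -/
  T : ∀ j, Set (Nuis j)
  /-- the nuisance learning algorithm -/
  fit : ∀ j, Train j → Nuis j
  /-- the underlying probability space -/
  Ω : Type u₄
  [ΩMeas : MeasurableSpace Ω]
  μ : Measure Ω
  [probμ : IsProbabilityMeasure μ]
  /-- auxiliary samples (first split) -/
  Y : ∀ j, Ω → Train j
  /-- evaluation samples (second split) -/
  Z : ∀ j, Fin (n j) → Ω → Obs j
  /-- pilot estimators -/
  pilot : Fin m → Ω → Param d
  /-- the fused estimators -/
  θhat : Ω → Fin m → Param d
  /-- tuning parameter: the penalty between tasks with distant pilots -/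
  ε : ℝ
  /-- tuning parameter: the threshold of the adaptive weights -/
  τ : ℝ

attribute [instance] Model.obsMeas Model.nuisNorm Model.nuisSpace Model.trainMeas Model.probP
  Model.ΩMeas Model.probμ

namespace Model

variable {d : ℕ} (X : Model d)

/-! ### Sizes -/

/-- `n_min` -/
def nMin : ℕ := ⨅ j, X.n j

/-- `n_max` -/
def nMax : ℕ := ⨆ j, X.n j

/-- The cluster `S_k`. -/
def S (k : Fin X.K) : Finset (Fin X.m) := {j | X.cluster j = k}

/-- The pooled sample size `N_k`. -/
def N (k : Fin X.K) : ℕ := ∑ j ∈ X.S k, X.n j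

/-- `N_min` -/
def NMin : ℕ := ⨅ k, X.N k

/-- `ξ_max` -/
def ξMax : ℝ := ⨆ k, X.ξ k

/-- `b_k = K m_k^{1/2} max_{j ∈ S_k} n_j^{1/2} s(n_j)^{-2}` for the nuisance rate `s`. -/
def b (s : ℕ → ℝ) (k : Fin X.K) : ℝ :=
  X.K * Real.sqrt (X.S k).card * ⨆ j : X.S k, Real.sqrt (X.n j) / s (X.n j) ^ 2

/-- `a = m⁻¹ min {n_min^{r₂ / (2 (r₂ + d))}, min_j s(n_j)}`. For a nondecreasing rate `s` the
inner minimum is `s(n_min)`. -/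
def a (r₂ : ℝ) (s : ℕ → ℝ) : ℝ :=
  (X.m : ℝ)⁻¹ * min ((X.nMin : ℝ) ^ (r₂ / (2 * (r₂ + d)))) (⨅ j, s (X.n j))

/-! ### Losses and risks -/

/-- The population risk `R_j(θ, η)`. -/
def risk (j : Fin X.m) (θ : Param d) (η : X.Nuis j) : ℝ := ∫ z, X.loss j θ η z ∂(X.P j)

/-- The score `∇_θ ℓ_j(θ, η, z)`. -/
def score (j : Fin X.m) (θ : Param d) (η : X.Nuis j) (z : X.Obs j) : Param d :=
  gradient (fun θ' => X.loss j θ' η z) θ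

/-- The Hessian `∇²_θ ℓ_j(θ, η, z)`. -/
def lossHess (j : Fin X.m) (θ : Param d) (η : X.Nuis j) (z : X.Obs j) :
    Param d →L[ℝ] Param d :=
  hess (fun θ' => X.loss j θ' η z) θ

/-- The population Hessian `H_j(θ) = ∇²_θ R_j(θ, η_j*)`. -/
def riskHess (j : Fin X.m) (θ : Param d) : Param d →L[ℝ] Param d :=
  hess (fun θ' => X.risk j θ' (X.ηs j)) θ

/-- The empirical loss `f_j(θ, η) = ∑_i ℓ_j(θ, η, Z_{ji})` on the evaluation sample. -/
def f (j : Fin X.m) (ω : X.Ω) (θ : Param d) (η : X.Nuis j) : ℝ :=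
  ∑ i, X.loss j θ η (X.Z j i ω)

/-- The estimated nuisance. -/
def ηhat (j : Fin X.m) (ω : X.Ω) : X.Nuis j := X.fit j (X.Y j ω)

/-! ### The estimator -/

/-- `w_{jj'} = c_w ‖pilot_j - pilot_{j'}‖^{-γ}`, which is `∞` if the pilots coincide. -/
def w (c_w γ : ℝ) (ω : X.Ω) (j j' : Fin X.m) : ℝ≥0∞ :=
  ENNReal.ofReal c_w * ‖X.pilot j ω - X.pilot j' ω‖ₑ ^ (-γ)

open scoped Classical in
/-- The adaptive penalties `λ_{jj'}`. -/
def pen (c_w γ : ℝ) (ω : X.Ω) (j j' : Fin X.m) : ℝ≥0∞ :=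
  if X.w c_w γ ω j j' ≤ ENNReal.ofReal X.τ then ENNReal.ofReal X.ε else X.w c_w γ ω j j'

/-- The fusion objective
`∑_j f_j(θ_j, η̂_j) + ∑_{j' < j} λ_{jj'} ‖θ_j - θ_{j'}‖`, with the convention `∞ * 0 = 0`. -/
def objective (c_w γ : ℝ) (ω : X.Ω) (ϑ : Fin X.m → Param d) : EReal :=
  ((∑ j, X.f j ω (ϑ j) (X.ηhat j ω) : ℝ) : EReal) +
    ((∑ j, ∑ j' ∈ Finset.Iio j, X.pen c_w γ ω j j' * ‖ϑ j - ϑ j'‖ₑ : ℝ≥0∞) : EReal)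

/-- `θ̂` minimizes the fusion objective, on every sample for which a minimizer exists. -/
def IsFusionEstimator (c_w γ : ℝ) : Prop :=
  ∀ ω, (∃ ϑ, ∀ ϑ', X.objective c_w γ ω ϑ ≤ X.objective c_w γ ω ϑ') →
    ∀ ϑ', X.objective c_w γ ω (X.θhat ω) ≤ X.objective c_w γ ω ϑ'

/-! ### Standing assumptions -/

/-- The sampling scheme: the evaluation observations are independent with law `P_j` in task `j`,
and independent of the auxiliary samples; everything in sight is measurable. -/
structure Sampling : Prop where
  measurable_Z : ∀ j i, Measurable (X.Z j i)
  law_Z : ∀ j i, X.μ.map (X.Z j i) = X.P j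
  indep_Z : iIndepFun (fun p : (Σ j, Fin (X.n j)) => X.Z p.1 p.2) X.μ
  measurable_Y : ∀ j, Measurable (X.Y j)
  split : IndepFun (fun ω j => X.Y j ω) (fun ω j i => X.Z j i ω) X.μ
  measurable_pilot : ∀ j, Measurable (X.pilot j)
  measurable_θhat : ∀ j, Measurable fun ω => X.θhat ω j
  measurable_loss : ∀ j θ, ∀ t ∈ Icc (0 : ℝ) 1,
    Measurable fun p : X.Train j × X.Obs j =>
      X.loss j θ (X.ηs j + t • (X.fit j p.1 - X.ηs j)) p.2
  measurable_fit : ∀ j, Measurable fun y => ‖X.fit j y - X.ηs j‖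
  measurable_T : ∀ j, MeasurableSet {y | X.fit j y ∈ X.T j}

/-- Near-homogeneous clusters: a partition into nonempty clusters whose centroids are `δ`-separated,
the targets of cluster `k` being within `ξ_k` of its centroid. -/
structure NearHomogeneous (δ : ℝ) : Prop where
  nonempty : Function.Surjective X.cluster
  near : ∀ j, ‖X.θs j - X.βs (X.cluster j)‖ ≤ X.ξ (X.cluster j)
  separated : ∀ k k', k ≠ k' → δ ≤ ‖X.βs k - X.βs k'‖

/-- Each true target minimizes the population risk over `Θ`. -/
def IsTarget (Θ : Set (Param d)) : Prop :=
  ∀ j, X.θs j ∈ Θ ∧ ∀ θ ∈ Θ, Integrable (X.loss j θ (X.ηs j)) (X.P j) →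
    X.risk j (X.θs j) (X.ηs j) ≤ X.risk j θ (X.ηs j)

/-- Regularity of the losses, on the balls of radius `M` around the truth. -/
structure LossRegular (M ρ κ r₁ r₂ σ₁ σ₂ σ₃ σ₅ : ℝ) : Prop where
  /-- convexity in the target -/
  convex : ∀ j η, ‖η - X.ηs j‖ ≤ M → ∀ z, ConvexOn ℝ univ fun θ => X.loss j θ η z
  /-- the loss is twice differentiable in the target -/
  smooth : ∀ j θ η, ‖θ - X.θs j‖ ≤ M → ‖η - X.ηs j‖ ≤ M → ∀ z,
    TwiceDiffAt (fun θ' => X.loss j θ' η z) θ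
  /-- the risk is finite -/
  finite_risk : ∀ j θ η, ‖θ - X.θs j‖ ≤ M → ‖η - X.ηs j‖ ≤ M →
    Integrable (X.loss j θ η) (X.P j)
  /-- `ρ I ≼ H_j(θ) ≼ κ I` -/
  curvature : ∀ j θ, ‖θ - X.θs j‖ ≤ M → ∀ v,
    ρ * ‖v‖ ^ 2 ≤ inner ℝ v (X.riskHess j θ v) ∧ inner ℝ v (X.riskHess j θ v) ≤ κ * ‖v‖ ^ 2
  /-- the risk is stationary at the truth -/
  score_mean : ∀ j, HasGradientAt (fun θ => X.risk j θ (X.ηs j)) 0 (X.θs j)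
  /-- moment of the score -/
  score_moment : ∀ j, ∫⁻ z, ‖X.score j (X.θs j) (X.ηs j) z‖ₑ ^ r₁ ∂(X.P j) ≤ ENNReal.ofReal σ₁
  /-- moment of the Hessian -/
  hess_moment : ∀ j θ, ‖θ - X.θs j‖ ≤ M → ∀ v, ‖v‖ = 1 →
    ∫⁻ z, ‖(inner ℝ v ((X.lossHess j θ (X.ηs j) z - X.riskHess j θ) v) : ℝ)‖ₑ ^ r₂ ∂(X.P j)
      ≤ ENNReal.ofReal σ₂
  /-- the (smallest) Lipschitz constant of the Hessian has expectation at most `σ₃` -/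
  hess_lipschitz : ∀ j, ∃ L : X.Obs j → ℝ≥0∞, Measurable L ∧
    ∫⁻ z, L z ∂(X.P j) ≤ ENNReal.ofReal σ₃ ∧
    ∀ z θ θ' η η', ‖θ - X.θs j‖ ≤ M → ‖θ' - X.θs j‖ ≤ M →
      ‖η - X.ηs j‖ ≤ M → ‖η' - X.ηs j‖ ≤ M →
      ‖X.lossHess j θ η z - X.lossHess j θ' η' z‖ₑ ≤ L z * (‖θ - θ'‖ₑ + ‖η - η'‖ₑ)
  /-- Neyman orthogonality: `D_η ∇_θ R_j(θ_j*, η_j*)[η - η_j*]` exists and is zero -/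
  orthogonal : ∀ j, ∀ η ∈ X.T j,
    HasDerivAt (fun t : ℝ =>
      gradient (fun θ => X.risk j θ (X.ηs j + t • (η - X.ηs j))) (X.θs j)) 0 0
  /-- the score is twice Gateaux differentiable on the segment from `η_j*` to `η` -/
  gateaux_smooth : ∀ j, ∀ η ∈ X.T j, ∀ t ∈ Icc (0 : ℝ) 1, ∀ z,
    TwiceGateauxAt (fun η' => X.score j (X.θs j) η' z)
      (X.ηs j + t • (η - X.ηs j)) (η - X.ηs j)
  /-- moment of the first Gateaux derivative -/
  gateaux_moment : ∀ j, ∀ η ∈ X.T j, ∀ t ∈ Icc (0 : ℝ) 1,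
    ∫⁻ z, ‖gateaux (fun η' => X.score j (X.θs j) η' z)
      (X.ηs j + t • (η - X.ηs j)) (η - X.ηs j)‖ₑ ^ 2 ∂(X.P j)
      ≤ ENNReal.ofReal (σ₅ * ‖η - X.ηs j‖ ^ 2)
  /-- moment of the second Gateaux derivative -/
  gateaux₂_moment : ∀ j, ∀ η ∈ X.T j, ∀ t ∈ Icc (0 : ℝ) 1,
    ∫⁻ z, ‖gateaux₂ (fun η' => X.score j (X.θs j) η' z)
      (X.ηs j + t • (η - X.ηs j)) (η - X.ηs j)‖ₑ ∂(X.P j)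
      ≤ ENNReal.ofReal (σ₅ * ‖η - X.ηs j‖ ^ 2)

/-- Mean square rate of the nuisance estimators: `E ‖η̂_j - η_j*‖² ≤ σ₄ / s(n_j)²`. -/
def NuisanceRate (s : ℕ → ℝ) (σ₄ : ℝ) : Prop :=
  ∀ j, ∫⁻ ω, ‖X.ηhat j ω - X.ηs j‖ₑ ^ 2 ∂X.μ ≤ ENNReal.ofReal (σ₄ / s (X.n j) ^ 2)

/-- Consistency of the pilot estimators at the rate `n_j^{-α}`, with exceptional probabilities
`p e`. -/
def PilotRate (α : ℝ) (p : ℝ → ℕ → ℝ) : Prop :=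
  ∀ e > 0, 1 - p e X.nMin ≤
    X.μ.real {ω | ∀ j, (X.n j : ℝ) ^ α * ‖X.pilot j ω - X.θs j‖ < e}

/-- Conditions on the tuning parameters and the within-cluster radii. -/
structure Tuned (c_w γ α ζ c₀ c₁ c₂ c_ξ : ℝ) : Prop where
  size : c₀ * X.nMax ≤ (X.nMin : ℝ) ^ (α * γ)
  ε_nonneg : 0 ≤ X.ε
  ε_le : X.ε ≤ c₁ * ((X.m : ℝ) ^ 2)⁻¹ * (X.NMin : ℝ) ^ ζ
  lt_τ : c₂ < X.τ
  τ_lt : X.τ < c₂ * ((X.nMin : ℝ) ^ (-α) + X.ξMax) ^ (-γ)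
  ξ_le : ∀ j, X.ξ (X.cluster j) ≤ c_ξ * (X.n j : ℝ) ^ (-(1 / 2) : ℝ)

/-! ### The limiting covariance -/

/-- `Ψ̃_k = E[N_k⁻¹ ∑_{j ∈ S_k} ∇² f_j(θ_j*, η_j*)]` -/
def Ψ (k : Fin X.K) : Matrix (Fin d) (Fin d) ℝ :=
  Matrix.of fun a b => ∫ ω, (X.N k : ℝ)⁻¹ *
    (∑ j ∈ X.S k, hessMatrix (fun θ => X.f j ω θ (X.ηs j)) (X.θs j)) a b ∂X.μ

/-- `∑_{j ∈ S_k} ∇ f_j(θ_j*, η_j*)` -/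
def pooledScore (k : Fin X.K) (ω : X.Ω) : Param d :=
  ∑ j ∈ X.S k, gradient (fun θ => X.f j ω θ (X.ηs j)) (X.θs j)

/-- `Ω̃_k = E[N_k⁻¹ {∑_{j ∈ S_k} ∇ f_j(θ_j*, η_j*)}^{⊗2}]` -/
def scoreCov (k : Fin X.K) : Matrix (Fin d) (Fin d) ℝ :=
  Matrix.of fun a b => ∫ ω, (X.N k : ℝ)⁻¹ * (X.pooledScore k ω a * X.pooledScore k ω b) ∂X.μ

/-- `Ψ̃_k⁻¹ Ω̃_k Ψ̃_k⁻¹` -/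
def V (k : Fin X.K) : Matrix (Fin d) (Fin d) ℝ := (X.Ψ k)⁻¹ * X.scoreCov k * (X.Ψ k)⁻¹

end Model

end Multitask

end

namespace Multitask

/-! ### Sums of independent variables -/

/-! The estimator is shown to be asymptotically linear in the scores of its own cluster, and the
linear term is then normal by a Lyapunov argument on characteristic functions.

Adaptive fusion is an oracle. When the pilots are accurate, every pair inside a cluster carries a
weight exceeding a prescribed multiple of `nMax`, and every pair across clusters carries exactly `ε`
(`Model.pen_spec`). For a convex loss, replacing the parameters of a cluster by their mean costs at
most the gradient norms times the distances to the mean. The heavy within-cluster penalty saves more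
than that, so minimizers are exactly constant on clusters. Moving a whole cluster leaves its
internal penalties unchanged and changes the others by at most `ε m m_k` per unit, so the pooled
gradient of each cluster at the minimizer has norm at most `ε m m_k`, which is o(√N_k). This
deterministic part is `FusionRegular.extended_minimizer_spec`; localization comes from strict inward
pointing of the gradient at an intermediate radius together with convexity.

On a good sample the pooled gradient at β equals the score sum at the truth, plus the pooled risk
Hessian applied to the distance from the centroid, plus a small error. That error collects the
Lipschitz variation of the Hessians, their fluctuation, the offset between targets and centroid, and
the shift of the scores caused by the estimated nuisances. Conditionally on the training samples the
nuisance shift has variance and mean of the order of the squared nuisance error, the mean because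
Neyman orthogonality removes its first order part (`Model.scoreShift_moments`). Its bias is
negligible against √N_k since `b` tends to zero. Coercivity of the pooled Hessian then turns near
stationarity into √N_k (θ̂ - θ*) = `leading` + o_P(1) (`tendsto_measure_estimator_sub`). Bad samples
are excluded by Markov and Chebyshev inequalities; the union over tasks is paid for by the growth of
`a`, the union over clusters by boundedness of K.

The term `leading` is a sum of N_k independent centred vectors of size N_k^(-1/2) whose covariance
is the sandwich matrix `V`. Taylor expansion of each factor compares its characteristic function
with the Gaussian one, with error N_k^(1 - r/2) + N_k^(-1) for r = min(r₁, 3) > 2. Since `V` may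
vary along the sequence, convergence is obtained along subsequences on which the bounded matrices
`V` converge (`tendsto_integral_sub_multivariateGaussian`). -/

theorem norm_prod_sub_prod_le_sum {ι : Type*} (s : Finset ι) (a b : ι → ℂ)
    (ha : ∀ i ∈ s, ‖a i‖ ≤ 1) (hb : ∀ i ∈ s, ‖b i‖ ≤ 1) :
    ‖∏ i ∈ s, a i - ∏ i ∈ s, b i‖ ≤ ∑ i ∈ s, ‖a i - b i‖ := by
  classical
  induction s using Finset.induction_on with
  | empty => simp
  | insert i s hi ih =>
    rw [Finset.prod_insert hi, Finset.prod_insert hi, Finset.sum_insert hi]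
    have ih' := ih (fun j hj => ha j (Finset.mem_insert_of_mem hj))
      (fun j hj => hb j (Finset.mem_insert_of_mem hj))
    have hbi := hb i (Finset.mem_insert_self i s)
    have hP : ‖∏ j ∈ s, a j‖ ≤ 1 := by
      rw [norm_prod]
      exact Finset.prod_le_one (fun j _ => norm_nonneg _)
        (fun j hj => ha j (Finset.mem_insert_of_mem hj))
    calc ‖a i * ∏ j ∈ s, a j - b i * ∏ j ∈ s, b j‖
        = ‖(a i - b i) * ∏ j ∈ s, a j + b i * (∏ j ∈ s, a j - ∏ j ∈ s, b j)‖ := by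
          congr 1; ring
      _ ≤ ‖a i - b i‖ * ‖∏ j ∈ s, a j‖ + ‖b i‖ * ‖∏ j ∈ s, a j - ∏ j ∈ s, b j‖ := by
          refine (norm_add_le _ _).trans ?_
          rw [norm_mul, norm_mul]
      _ ≤ ‖a i - b i‖ * 1 + 1 * ∑ j ∈ s, ‖a j - b j‖ := by
          gcongr
      _ = _ := by ring

/-- For |x| ≤ 1 the cubic Taylor remainder is below |x|^r because r ≤ 3; for |x| ≥ 1 each term
separately is below a multiple of x² ≤ |x|^r. Thus moments of order slightly above two suffice and
no truncation is needed. -/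
theorem norm_exp_I_mul_sub_le {r : ℝ} (hr : 2 < r) (hr' : r ≤ 3) (x : ℝ) :
    ‖Complex.exp (x * Complex.I) - (1 + x * Complex.I - (x : ℂ) ^ 2 / 2)‖ ≤ 4 * |x| ^ r := by
  have hn : ‖(x : ℂ) * Complex.I‖ = |x| := by simp
  rcases le_total |x| 1 with hx | hx
  · have h := Complex.exp_bound (x := x * Complex.I) (by rw [hn]; exact hx) (n := 3) (by norm_num)
    have e : ∑ m ∈ Finset.range 3, ((x : ℂ) * Complex.I) ^ m / (m.factorial : ℂ)
        = 1 + x * Complex.I - (x : ℂ) ^ 2 / 2 := by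
      simp [Finset.sum_range_succ, mul_pow]
      ring
    rw [e, hn] at h
    refine h.trans ?_
    have h3 : |x| ^ 3 ≤ |x| ^ r := by
      rcases (abs_nonneg x).eq_or_lt with h0 | h0
      · rw [← h0, Real.zero_rpow (by linarith)]; norm_num
      · rw [← Real.rpow_natCast]
        exact Real.rpow_le_rpow_of_exponent_ge h0 hx (by exact_mod_cast hr')
    have : (0:ℝ) ≤ |x| ^ r := by positivity
    have h4 : (0:ℝ) ≤ |x| ^ 3 := by positivity
    norm_num [Nat.factorial]
    nlinarith
  · have h1 : ‖Complex.exp (x * Complex.I)‖ = 1 := Complex.norm_exp_ofReal_mul_I x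
    have h2 : |x| ^ 2 ≤ |x| ^ r := by
      rw [← Real.rpow_natCast]
      exact Real.rpow_le_rpow_of_exponent_le hx (by exact_mod_cast hr.le)
    have h5 : ‖(x:ℂ) ^ 2 / 2‖ = |x| ^ 2 / 2 := by simp
    calc _ ≤ ‖Complex.exp (x * Complex.I)‖ + (‖(1:ℂ)‖ + ‖(x : ℂ) * Complex.I‖ + ‖(x:ℂ) ^ 2 / 2‖) :=
          (norm_sub_le _ _).trans (add_le_add le_rfl ((norm_sub_le _ _).trans
            (add_le_add (norm_add_le _ _) le_rfl)))
      _ = 1 + (1 + |x| + |x| ^ 2 / 2) := by rw [h1, hn, h5, norm_one]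
      _ ≤ 4 * |x| ^ 2 := by nlinarith
      _ ≤ _ := by linarith

variable {Ω : Type*} [MeasurableSpace Ω] {μ : Measure Ω}

theorem sq_le_one_add_rpow {r : ℝ} (hr : 2 ≤ r) {x : ℝ} (hx : 0 ≤ x) : x ^ 2 ≤ 1 + x ^ r := by
  rcases le_total x 1 with h | h
  · have : (0:ℝ) ≤ x ^ r := by positivity
    nlinarith
  · have : x ^ 2 ≤ x ^ r := by
      rw [← Real.rpow_natCast]
      exact Real.rpow_le_rpow_of_exponent_le h (by exact_mod_cast hr)
    linarith

theorem integrable_sq_of_rpow [IsFiniteMeasure μ] {r : ℝ} (hr : 2 ≤ r) {Y : Ω → ℝ}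
    (hm : AEStronglyMeasurable Y μ)
    (hY : Integrable (fun ω => |Y ω| ^ r) μ) : Integrable (fun ω => Y ω ^ 2) μ := by
  refine ((integrable_const (1:ℝ)).add hY).mono' (hm.pow 2) (Eventually.of_forall fun ω => ?_)
  have := sq_le_one_add_rpow hr (abs_nonneg (Y ω))
  simpa using this

/-- With v the variance, both the characteristic function and the Gaussian factor are compared with
the common quadratic approximation 1 - v/2. The first comparison costs the r-th moment, the second
v², without any smallness of v. -/
theorem norm_integral_exp_sub_le [IsProbabilityMeasure μ] {r : ℝ} (hr : 2 < r) (hr' : r ≤ 3)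
    {Y : Ω → ℝ} (hm : Measurable Y) (hY : Integrable (fun ω => |Y ω| ^ r) μ)
    (h0 : ∫ ω, Y ω ∂μ = 0) :
    ‖∫ ω, Complex.exp (Y ω * Complex.I) ∂μ - Real.exp (-(∫ ω, Y ω ^ 2 ∂μ) / 2)‖
      ≤ 4 * (∫ ω, |Y ω| ^ r ∂μ) + (∫ ω, Y ω ^ 2 ∂μ) ^ 2 := by
  have h2 := integrable_sq_of_rpow hr.le hm.aestronglyMeasurable hY
  have h1 : Integrable Y μ :=
    ((memLp_two_iff_integrable_sq hm.aestronglyMeasurable).2 h2).integrable (by norm_num)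
  have he : Integrable (fun ω => Complex.exp (Y ω * Complex.I)) μ := by
    refine (integrable_const (1:ℝ)).mono' (by fun_prop) (Eventually.of_forall fun ω => ?_)
    rw [Complex.norm_exp_ofReal_mul_I]
  have hq : Integrable (fun ω => (1 + (Y ω : ℂ) * Complex.I - (Y ω : ℂ) ^ 2 / 2)) μ := by
    refine ((integrable_const _).add (h1.ofReal.mul_const _)).sub ?_
    have := (h2.ofReal (𝕜 := ℂ)).div_const 2
    simpa using this
  set v := ∫ ω, Y ω ^ 2 ∂μ with hv
  have hv0 : 0 ≤ v := integral_nonneg fun ω => sq_nonneg _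
  have hqi : ∫ ω, (1 + (Y ω : ℂ) * Complex.I - (Y ω : ℂ) ^ 2 / 2) ∂μ = (1 - v / 2 : ℂ) := by
    have e2 : ∫ ω, (Y ω : ℂ) ^ 2 / 2 ∂μ = (v / 2 : ℂ) := by
      rw [integral_div, hv, ← integral_complex_ofReal]
      simp
    have e1 : ∫ ω, (1 + (Y ω : ℂ) * Complex.I) ∂μ = 1 := by
      rw [integral_add (integrable_const _) (h1.ofReal.mul_const _), integral_mul_const]
      have : ∫ ω, (Y ω : ℂ) ∂μ = 0 := by rw [integral_complex_ofReal, h0]; simp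
      simp [this]
    rw [integral_sub ((integrable_const _).add (h1.ofReal.mul_const _)), e1, e2]
    simpa using (h2.ofReal (𝕜 := ℂ)).div_const 2
  have hA : ‖∫ ω, Complex.exp (Y ω * Complex.I) ∂μ - (1 - v / 2 : ℂ)‖
      ≤ 4 * (∫ ω, |Y ω| ^ r ∂μ) := by
    rw [← hqi, ← integral_sub he hq, ← integral_const_mul]
    exact norm_integral_le_of_norm_le (hY.const_mul 4)
      (Eventually.of_forall fun ω => norm_exp_I_mul_sub_le hr hr' (Y ω))
  have hB : ‖(1 - v / 2 : ℂ) - Real.exp (-v / 2)‖ ≤ v ^ 2 := by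
    have : (1 - v / 2 : ℂ) - Real.exp (-v / 2) = ((1 - v / 2 - Real.exp (-v / 2) : ℝ) : ℂ) := by
      push_cast; ring
    rw [this, Complex.norm_real, Real.norm_eq_abs, abs_le]
    have l1 : 1 - v / 2 ≤ Real.exp (-v / 2) := by
      have := Real.add_one_le_exp (-v / 2); linarith
    have l2 : Real.exp (-v / 2) ≤ 1 - v / 2 + v ^ 2 := by
      -- The quadratic bound on the exponential needs v/2 ≤ 1; beyond that the crude bound 1 is
      -- enough because v² exceeds v/2.
      rcases le_total v 2 with hv2 | hv2
      · have := Real.abs_exp_sub_one_sub_id_le (x := -v / 2) (by rw [abs_le]; constructor <;> linarith)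
        have := (abs_le.1 this).2
        nlinarith
      · have : Real.exp (-v / 2) ≤ 1 := Real.exp_le_one_iff.2 (by linarith)
        nlinarith
    constructor <;> nlinarith
  calc _ = ‖(∫ ω, Complex.exp (Y ω * Complex.I) ∂μ - (1 - v / 2 : ℂ))
        + ((1 - v / 2 : ℂ) - Real.exp (-v / 2))‖ := by congr 1; ring
    _ ≤ _ := (norm_add_le _ _).trans (add_le_add hA hB)

/-- Independence factors the characteristic function, and the Gaussian term factors as well; all
factors lie in the unit disc, so the errors of the single factors add up. Evaluation at frequency 1
loses nothing, since direction and scale are absorbed into the summands. -/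
theorem norm_integral_exp_sum_sub_le [IsProbabilityMeasure μ] {r : ℝ} (hr : 2 < r) (hr' : r ≤ 3)
    {ι : Type*} (s : Finset ι) {Y : ι → Ω → ℝ} (hm : ∀ i, Measurable (Y i))
    (hind : iIndepFun Y μ)
    (hY : ∀ i ∈ s, Integrable (fun ω => |Y i ω| ^ r) μ)
    (h0 : ∀ i ∈ s, ∫ ω, Y i ω ∂μ = 0) :
    ‖∫ ω, Complex.exp ((∑ i ∈ s, Y i ω : ℝ) * Complex.I) ∂μ
        - Real.exp (-(∑ i ∈ s, ∫ ω, Y i ω ^ 2 ∂μ) / 2)‖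
      ≤ ∑ i ∈ s, (4 * (∫ ω, |Y i ω| ^ r ∂μ) + (∫ ω, Y i ω ^ 2 ∂μ) ^ 2) := by
  have hprod := congrFun ((hind.restrict s).charFun_map_fun_finsetSum_eq_prod
    (fun i _ => (hm i).aemeasurable)) 1
  have hs : Measurable fun ω => ∑ i ∈ s, Y i ω := Finset.measurable_sum s fun i _ => hm i
  rw [Finset.prod_apply, charFun_apply_real, integral_map hs.aemeasurable (by fun_prop)] at hprod
  simp_rw [charFun_apply_real] at hprod
  have e2 : ∀ i, ∫ x : ℝ, Complex.exp ((1:ℝ) * x * Complex.I) ∂(μ.map (Y i))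
      = ∫ ω, Complex.exp (Y i ω * Complex.I) ∂μ := fun i => by
    rw [integral_map (hm i).aemeasurable (by fun_prop)]; simp
  simp_rw [e2] at hprod
  have e3 : ∫ ω, Complex.exp ((∑ i ∈ s, Y i ω : ℝ) * Complex.I) ∂μ
      = ∏ i ∈ s, ∫ ω, Complex.exp (Y i ω * Complex.I) ∂μ := by
    rw [← hprod]; simp
  have e4 : ((Real.exp (-(∑ i ∈ s, ∫ ω, Y i ω ^ 2 ∂μ) / 2) : ℝ) : ℂ)
      = ∏ i ∈ s, ((Real.exp (-(∫ ω, Y i ω ^ 2 ∂μ) / 2) : ℝ) : ℂ) := by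
    rw [← Complex.ofReal_prod, ← Real.exp_sum]
    congr 2
    rw [← Finset.sum_div, Finset.sum_neg_distrib]
  rw [e3, e4]
  refine (norm_prod_sub_prod_le_sum s _ _ (fun i _ => ?_) (fun i _ => ?_)).trans
    (Finset.sum_le_sum fun i hi => norm_integral_exp_sub_le hr hr' (hm i) (hY i hi) (h0 i hi))
  · refine (norm_integral_le_of_norm_le (integrable_const (1:ℝ)) (Eventually.of_forall fun ω => ?_)).trans
      (by simp)
    rw [Complex.norm_exp_ofReal_mul_I]
  · rw [Complex.norm_real, Real.norm_eq_abs, abs_of_pos (Real.exp_pos _), Real.exp_le_one_iff]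
    have : 0 ≤ ∫ ω, Y i ω ^ 2 ∂μ := integral_nonneg fun ω => sq_nonneg _
    linarith

theorem integral_sq_sum_eq [IsProbabilityMeasure μ] {ι : Type*} (s : Finset ι) {Y : ι → Ω → ℝ}
    (hind : iIndepFun Y μ) (hY : ∀ i ∈ s, MemLp (Y i) 2 μ) (h0 : ∀ i ∈ s, ∫ ω, Y i ω ∂μ = 0) :
    ∫ ω, (∑ i ∈ s, Y i ω) ^ 2 ∂μ = ∑ i ∈ s, ∫ ω, Y i ω ^ 2 ∂μ := by
  have hv := IndepFun.variance_sum (s := s) hY (fun i _ j _ hij => hind.indepFun hij)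
  have hsum : MemLp (∑ i ∈ s, Y i) 2 μ := memLp_finsetSum' s hY
  have hz : ∫ ω, (∑ i ∈ s, Y i) ω ∂μ = 0 := by
    simp_rw [Finset.sum_apply]
    rw [integral_finsetSum _ fun i hi => (hY i hi).integrable (by norm_num)]
    exact Finset.sum_eq_zero h0
  rw [variance_of_integral_eq_zero hsum.1.aemeasurable hz] at hv
  simp only [Finset.sum_apply] at hv
  rw [hv]
  exact Finset.sum_congr rfl fun i hi =>
    variance_of_integral_eq_zero (hY i hi).1.aemeasurable (h0 i hi)

theorem integral_norm_sq_sum_eq [IsProbabilityMeasure μ] {ι : Type*} {d : ℕ} (s : Finset ι)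
    {X : ι → Ω → Param d} (hind : iIndepFun X μ) (hX : ∀ i ∈ s, MemLp (X i) 2 μ)
    (h0 : ∀ i ∈ s, ∫ ω, X i ω ∂μ = 0) :
    ∫ ω, ‖∑ i ∈ s, X i ω‖ ^ 2 ∂μ = ∑ i ∈ s, ∫ ω, ‖X i ω‖ ^ 2 ∂μ := by
  have hc : ∀ a : Fin d, ∀ i ∈ s, MemLp (fun ω => X i ω a) 2 μ := fun a i hi =>
    (EuclideanSpace.proj (𝕜 := ℝ) a : Param d →L[ℝ] ℝ).comp_memLp' (hX i hi)
  have hcs : ∀ a : Fin d, ∀ i ∈ s, Integrable (fun ω => (X i ω a) ^ 2) μ := fun a i hi =>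
    (hc a i hi).integrable_sq
  have key : ∀ a : Fin d, ∫ ω, (∑ i ∈ s, X i ω a) ^ 2 ∂μ = ∑ i ∈ s, ∫ ω, (X i ω a) ^ 2 ∂μ := by
    intro a
    refine integral_sq_sum_eq s (hind.comp (fun _ x => x a) fun _ => by fun_prop) (hc a)
      fun i hi => ?_
    have := (EuclideanSpace.proj (𝕜 := ℝ) a : Param d →L[ℝ] ℝ).integral_comp_comm
      ((hX i hi).integrable (by norm_num))
    rw [h0 i hi] at this
    simpa using this
  simp_rw [EuclideanSpace.real_norm_sq_eq, WithLp.ofLp_sum, Finset.sum_apply]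
  rw [integral_finsetSum]
  · simp_rw [key]
    rw [Finset.sum_comm]
    refine Finset.sum_congr rfl fun i hi => ?_
    rw [integral_finsetSum _ fun a _ => hcs a i hi]
  · intro a _
    have : MemLp (fun ω => ∑ i ∈ s, X i ω a) 2 μ := memLp_finsetSum s (hc a)
    exact this.integrable_sq

end Multitask

namespace Multitask

/-! ### Weak approximation by Gaussian laws with varying covariance -/

open Matrix in
theorem posSemidef_of_tendsto {d : ℕ} {V : ℕ → Matrix (Fin d) (Fin d) ℝ}
    {V₀ : Matrix (Fin d) (Fin d) ℝ} (hV : ∀ᶠ n in atTop, (V n).PosSemidef)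
    (h : ∀ a b, Tendsto (fun n => V n a b) atTop (𝓝 (V₀ a b))) : V₀.PosSemidef := by
  refine PosSemidef.of_dotProduct_mulVec_nonneg ?_ fun x => ?_
  · ext a b
    rw [conjTranspose_apply, star_trivial]
    refine tendsto_nhds_unique (h b a) ((h a b).congr' ?_)
    filter_upwards [hV] with n hn
    have := congrFun (congrFun hn.isHermitian b) a
    rw [conjTranspose_apply, star_trivial] at this
    exact this
  · have : Tendsto (fun n => star x ⬝ᵥ V n *ᵥ x) atTop (𝓝 (star x ⬝ᵥ V₀ *ᵥ x)) := by
      simp only [dotProduct, mulVec]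
      exact tendsto_finsetSum _ fun a _ => Tendsto.const_mul _ <|
        tendsto_finsetSum _ fun b _ => (h a b).mul_const _
    refine ge_of_tendsto this ?_
    filter_upwards [hV] with n hn using hn.dotProduct_mulVec_nonneg x

open Matrix in
-- The covariances need not converge, so the two integrals are compared along subsequences: bounded
-- matrices have convergent sub-subsequences, and along these both laws converge, by Lévy's
-- continuity theorem, to the same Gaussian law.
theorem tendsto_integral_sub_multivariateGaussian {d : ℕ} {P : ℕ → Measure (Param d)}
    [∀ n, IsProbabilityMeasure (P n)] {V : ℕ → Matrix (Fin d) (Fin d) ℝ} {C : ℝ}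
    (hV : ∀ᶠ n in atTop, (V n).PosSemidef) (hC : ∀ᶠ n in atTop, ∀ a b, |V n a b| ≤ C)
    (hchar : ∀ t : Param d, Tendsto
      (fun n => charFun (P n) t - (Real.exp (-(t ⬝ᵥ V n *ᵥ t) / 2) : ℝ)) atTop (𝓝 0))
    (φ : Param d →ᵇ ℝ) :
    Tendsto (fun n => ∫ x, φ x ∂(P n) - ∫ x, φ x ∂(multivariateGaussian 0 (V n)))
      atTop (𝓝 0) := by
  refine tendsto_of_subseq_tendsto fun ns hns => ?_
  have hcomp : IsCompact (Set.pi univ fun _ : Fin d => Set.pi univ fun _ : Fin d => Icc (-C) C) :=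
    isCompact_univ_pi fun _ => isCompact_univ_pi fun _ => isCompact_Icc
  have hmem : ∀ᶠ n in atTop, (fun a b => V (ns n) a b) ∈
      (Set.pi univ fun _ : Fin d => Set.pi univ fun _ : Fin d => Icc (-C) C) := by
    filter_upwards [hns.eventually hC] with n hn a _ b _
    exact abs_le.1 (hn a b)
  obtain ⟨V₀, -, ms, hms, hlim⟩ := hcomp.tendsto_subseq' hmem.frequently
  refine ⟨ms, ?_⟩
  have hsub : Tendsto (fun n => ns (ms n)) atTop atTop := hns.comp hms.tendsto_atTop
  have hent : ∀ a b, Tendsto (fun n => V (ns (ms n)) a b) atTop (𝓝 (V₀ a b)) := fun a b =>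
    (tendsto_pi_nhds.1 ((tendsto_pi_nhds.1 hlim) a)) b
  have hV₀ : (Matrix.of V₀).PosSemidef := posSemidef_of_tendsto (hsub.eventually hV) hent
  have hquad : ∀ t : Param d, Tendsto (fun n => t ⬝ᵥ V (ns (ms n)) *ᵥ t) atTop
      (𝓝 (t ⬝ᵥ (Matrix.of V₀) *ᵥ t)) := fun t => by
    simp only [dotProduct, mulVec]
    exact tendsto_finsetSum _ fun a _ => Tendsto.const_mul _ <|
      tendsto_finsetSum _ fun b _ => (hent a b).mul_const _
  have hexp : ∀ t : Param d, Tendsto (fun n =>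
      ((Real.exp (-(t ⬝ᵥ V (ns (ms n)) *ᵥ t) / 2) : ℝ) : ℂ)) atTop
      (𝓝 ((Real.exp (-(t ⬝ᵥ (Matrix.of V₀) *ᵥ t) / 2) : ℝ) : ℂ)) := fun t => by
    have hc : Continuous fun x : ℝ => ((Real.exp (-x / 2) : ℝ) : ℂ) := by fun_prop
    exact (hc.tendsto _).comp (hquad t)
  -- The Gaussian characteristic function has this form only for positive semidefinite matrices,
  -- which is why semidefiniteness of the limit matrix was established first.
  have hg : ∀ {W : Matrix (Fin d) (Fin d) ℝ}, W.PosSemidef → ∀ t : Param d,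
      charFun (multivariateGaussian 0 W) t = ((Real.exp (-(t ⬝ᵥ W *ᵥ t) / 2) : ℝ) : ℂ) := by
    intro W hW t
    rw [charFun_multivariateGaussian hW]
    push_cast
    congr 1
    simp
    ring
  let G₀ : ProbabilityMeasure (Param d) := ⟨multivariateGaussian 0 (Matrix.of V₀), inferInstance⟩
  let Q : ℕ → ProbabilityMeasure (Param d) := fun n => ⟨P (ns (ms n)), inferInstance⟩
  let G : ℕ → ProbabilityMeasure (Param d) :=
    fun n => ⟨multivariateGaussian 0 (V (ns (ms n))), inferInstance⟩
  have h1 : Tendsto Q atTop (𝓝 G₀) := by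
    rw [ProbabilityMeasure.tendsto_iff_tendsto_charFun]
    intro t
    have := ((hchar t).comp hsub).add (hexp t)
    simp only [zero_add, Function.comp_def, sub_add_cancel] at this
    simpa only [G₀, Q, ProbabilityMeasure.coe_mk, hg hV₀] using this
  have h2 : Tendsto G atTop (𝓝 G₀) := by
    rw [ProbabilityMeasure.tendsto_iff_tendsto_charFun]
    intro t
    simp only [G₀, G, ProbabilityMeasure.coe_mk, hg hV₀]
    refine (hexp t).congr' ?_
    filter_upwards [hsub.eventually hV] with n hn using (hg hn t).symm
  have h := ((ProbabilityMeasure.tendsto_iff_forall_integral_tendsto.1 h1) φ).sub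
    ((ProbabilityMeasure.tendsto_iff_forall_integral_tendsto.1 h2) φ)
  simpa [Q, G] using h

/-- A quantitative Slutsky lemma: where A and B are within e, the unit complex numbers differ by at
most |⟨A - B, t⟩|; elsewhere they differ by at most 2. -/
theorem norm_charFun_map_sub_le {Ω : Type*} [MeasurableSpace Ω] {μ : Measure Ω}
    [IsProbabilityMeasure μ] {d : ℕ} {A B : Ω → Param d} (hA : Measurable A) (hB : Measurable B)
    (t : Param d) {e : ℝ} (he : 0 ≤ e) :
    ‖charFun (μ.map A) t - charFun (μ.map B) t‖ ≤ e * ‖t‖ + 2 * μ.real {ω | e < ‖A ω - B ω‖} := by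
  have hS : MeasurableSet {ω | e < ‖A ω - B ω‖} :=
    measurableSet_lt measurable_const (hA.sub hB).norm
  have hmeas : ∀ {F : Ω → Param d}, Measurable F → Integrable
      (fun ω => Complex.exp (inner ℝ (F ω) t * Complex.I)) μ := fun {F} hF => by
    refine (integrable_const (1:ℝ)).mono' ?_ (Eventually.of_forall fun ω => ?_)
    · have : Measurable fun ω => (inner ℝ (F ω) t : ℝ) := hF.inner_const
      fun_prop
    · rw [Complex.norm_exp_ofReal_mul_I]
  have hcf : ∀ {F : Ω → Param d}, Measurable F → charFun (μ.map F) t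
      = ∫ ω, Complex.exp (inner ℝ (F ω) t * Complex.I) ∂μ := fun {F} hF => by
    rw [charFun_apply, integral_map hF.aemeasurable (by fun_prop)]
  rw [hcf hA, hcf hB, ← integral_sub (hmeas hA) (hmeas hB)]
  have hind : Integrable ({ω | e < ‖A ω - B ω‖}.indicator fun _ => (2:ℝ)) μ :=
    (integrable_const _).indicator hS
  calc _ ≤ ∫ ω, (e * ‖t‖ + {ω | e < ‖A ω - B ω‖}.indicator (fun _ => (2:ℝ)) ω) ∂μ := by
        refine norm_integral_le_of_norm_le ((integrable_const _).add hind)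
          (Eventually.of_forall fun ω => ?_)
        by_cases h : e < ‖A ω - B ω‖
        · rw [indicator_of_mem (by exact h)]
          have := norm_sub_le (Complex.exp (inner ℝ (A ω) t * Complex.I))
            (Complex.exp (inner ℝ (B ω) t * Complex.I))
          rw [Complex.norm_exp_ofReal_mul_I, Complex.norm_exp_ofReal_mul_I] at this
          have : 0 ≤ e * ‖t‖ := by positivity
          linarith
        · rw [indicator_of_notMem (by exact h), add_zero]
          have e1 : Complex.exp (inner ℝ (A ω) t * Complex.I)
              - Complex.exp (inner ℝ (B ω) t * Complex.I)
              = Complex.exp (inner ℝ (B ω) t * Complex.I)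
                * (Complex.exp (Complex.I * (inner ℝ (A ω - B ω) t : ℝ)) - 1) := by
            rw [mul_sub, ← Complex.exp_add, mul_one, inner_sub_left]
            congr 2
            push_cast
            ring
          rw [e1, norm_mul, Complex.norm_exp_ofReal_mul_I, one_mul]
          calc _ ≤ ‖(inner ℝ (A ω - B ω) t : ℝ)‖ := Real.norm_exp_I_mul_ofReal_sub_one_le
            _ ≤ ‖A ω - B ω‖ * ‖t‖ := norm_inner_le_norm _ _
            _ ≤ e * ‖t‖ := by gcongr; exact not_lt.1 h
    _ = _ := by
        rw [integral_add (integrable_const _) hind, integral_indicator hS]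
        simp [mul_comm]

end Multitask

namespace Multitask

/-! ### Fused minimizers of a convex objective -/

theorem convexOn_finset_sum {ι E : Type*} [AddCommGroup E] [Module ℝ E] {S : Set E}
    (hS : Convex ℝ S) (s : Finset ι) {f : ι → E → ℝ} (hf : ∀ i ∈ s, ConvexOn ℝ S (f i)) :
    ConvexOn ℝ S (fun x => ∑ i ∈ s, f i x) := by
  classical
  induction s using Finset.induction_on with
  | empty => simpa using convexOn_const 0 hS
  | insert i s hi ih =>
    simp_rw [Finset.sum_insert hi]
    exact (hf i (Finset.mem_insert_self i s)).add
      (ih fun j hj => hf j (Finset.mem_insert_of_mem hj))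

section Gradient

variable {E : Type*} [NormedAddCommGroup E] [InnerProductSpace ℝ E] [CompleteSpace E]

theorem _root_.HasGradientAt.hasDerivAt_line {f : E → ℝ} {g x : E} (h : HasGradientAt f g x) (v : E) :
    HasDerivAt (fun t : ℝ => f (x + t • v)) (inner ℝ g v) 0 := by
  have h1 : HasDerivAt (fun t : ℝ => x + t • v) v 0 := by
    simpa using ((hasDerivAt_id (0:ℝ)).smul_const v).const_add x
  have h2 : HasFDerivAt f ((InnerProductSpace.toDual ℝ E) g) (x + (0:ℝ) • v) := by
    simpa using h.hasFDerivAt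
  simpa [Function.comp_def] using! h2.comp_hasDerivAt (0:ℝ) h1

theorem _root_.ConvexOn.add_inner_le {f : E → ℝ} (hf : ConvexOn ℝ univ f) {g x : E}
    (h : HasGradientAt f g x) (y : E) : f x + inner ℝ g (y - x) ≤ f y := by
  have hd := h.hasDerivAt_line (y - x)
  have hc : ConvexOn ℝ univ (fun t : ℝ => f (x + t • (y - x))) := by
    have := hf.comp_affineMap (AffineMap.lineMap x y)
    refine (by simpa using this : ConvexOn ℝ univ (f ∘ AffineMap.lineMap x y)).congr fun t _ => ?_
    simp [AffineMap.lineMap_apply, add_comm]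
  have := hc.le_slope_of_hasDerivAt (mem_univ 0) (mem_univ 1) one_pos hd
  rw [slope_def_field] at this
  simp only [one_smul, zero_smul, add_zero, sub_zero, div_one, add_sub_cancel] at this
  linarith

/-- One-sided first order condition. -/
theorem nonneg_of_hasDerivAt_of_le {φ : ℝ → ℝ} {a b t₀ : ℝ} (h : HasDerivAt φ a 0) (ht₀ : 0 < t₀)
    (hle : ∀ t ∈ Ioc 0 t₀, φ 0 ≤ φ t + t * b) : 0 ≤ a + b := by
  have h1 : HasDerivAt (fun t => φ t + t * b) (a + b) 0 := by
    simpa using! h.add ((hasDerivAt_id (0:ℝ)).mul_const b)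
  have h2 := (hasDerivAt_iff_tendsto_slope.1 h1).mono_left
    (nhdsWithin_mono 0 (fun t (ht : t ∈ Ioi (0:ℝ)) => (ne_of_gt ht : t ≠ 0)))
  refine ge_of_tendsto h2 ?_
  filter_upwards [Ioc_mem_nhdsGT ht₀] with t ht
  rw [slope_def_field]
  have := hle t ht
  refine div_nonneg ?_ (by linarith [ht.1])
  simp only [zero_mul, add_zero]
  linarith

end Gradient

section Fusion

variable {d m K : ℕ}

/-- The indices with label `k`. -/
def fiber (c : Fin m → Fin K) (k : Fin K) : Finset (Fin m) := {j | c j = k}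

theorem mem_fiber {c : Fin m → Fin K} {k : Fin K} {j : Fin m} : j ∈ fiber c k ↔ c j = k := by
  simp [fiber]

theorem card_fiber_pos (c : Fin m → Fin K) (j : Fin m) : 0 < ((fiber c (c j)).card : ℝ) := by
  exact_mod_cast Finset.card_pos.2 ⟨j, mem_fiber.2 rfl⟩

/-- The weight of a pair, which depends on whether the labels agree. -/
noncomputable def pairWeight (c : Fin m → Fin K) (Λ ε : ℝ) (j i : Fin m) : ℝ := if c j = c i then Λ else ε

/-- The objective with pair weights `Λ` within and `ε` between the fibers of `c`. -/
noncomputable def fusionObj (c : Fin m → Fin K) (Λ ε : ℝ) (f : Fin m → Param d → ℝ) (ϑ : Fin m → Param d) : ℝ :=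
  ∑ j, f j (ϑ j) + ∑ j, ∑ i ∈ Finset.Iio j, pairWeight c Λ ε j i * ‖ϑ j - ϑ i‖

theorem sum_Iio_eq_half {g : Fin m → Fin m → ℝ} (hs : ∀ i j, g i j = g j i) (h0 : ∀ i, g i i = 0) :
    ∑ j, ∑ i ∈ Finset.Iio j, g j i = (1 / 2) * ∑ j, ∑ i, g j i := by
  have e1 : ∀ j : Fin m, ∑ i ∈ Finset.Iio j, g j i = ∑ i, if i < j then g j i else 0 := fun j => by
    rw [← Finset.sum_filter]; congr 1; ext i; simp
  have e2 : ∑ j, ∑ i, (if i < j then g j i else 0) = ∑ j, ∑ i, if j < i then g j i else 0 := by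
    rw [Finset.sum_comm]
    exact Finset.sum_congr rfl fun j _ => Finset.sum_congr rfl fun i _ => by rw [hs]
  have e3 : ∑ j, ∑ i, g j i
      = ∑ j, ∑ i, (if i < j then g j i else 0) + ∑ j, ∑ i, (if j < i then g j i else 0) := by
    rw [← Finset.sum_add_distrib]
    refine Finset.sum_congr rfl fun j _ => ?_
    rw [← Finset.sum_add_distrib]
    refine Finset.sum_congr rfl fun i _ => ?_
    rcases lt_trichotomy i j with h | h | h
    · simp [h, h.not_gt]
    · subst h; simp [h0]
    · simp [h, h.not_gt]
  simp_rw [e1]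
  rw [e3, ← e2]
  ring

theorem fusionObj_eq (c : Fin m → Fin K) (Λ ε : ℝ) (f : Fin m → Param d → ℝ)
    (ϑ : Fin m → Param d) : fusionObj c Λ ε f ϑ
      = ∑ j, f j (ϑ j) + (1 / 2) * ∑ j, ∑ i, pairWeight c Λ ε j i * ‖ϑ j - ϑ i‖ := by
  rw [fusionObj, sum_Iio_eq_half]
  · intro i j
    rw [norm_sub_rev, pairWeight, pairWeight]
    simp only [eq_comm]
  · simp

theorem convexOn_fusionObj {c : Fin m → Fin K} {Λ ε : ℝ} (hΛ : 0 ≤ Λ) (hε : 0 ≤ ε)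
    {f : Fin m → Param d → ℝ} (hf : ∀ j, ConvexOn ℝ univ (f j)) :
    ConvexOn ℝ univ (fusionObj c Λ ε f) := by
  refine ConvexOn.add (convexOn_finset_sum convex_univ _ fun j _ => ?_)
    (convexOn_finset_sum convex_univ _ fun j _ => convexOn_finset_sum convex_univ _ fun i _ => ?_)
  · exact (hf j).comp_linearMap (LinearMap.proj j : (Fin m → Param d) →ₗ[ℝ] Param d)
  · have := (convexOn_univ_norm (E := Param d)).comp_linearMap
      ((LinearMap.proj j : (Fin m → Param d) →ₗ[ℝ] Param d) - LinearMap.proj i)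
    refine ConvexOn.smul (c := pairWeight c Λ ε j i) ?_ this
    rw [pairWeight]; split_ifs <;> assumption

/-- The means over the fibers. -/
noncomputable def fiberMean (c : Fin m → Fin K) (ϑ : Fin m → Param d) (k : Fin K) : Param d :=
  ((fiber c k).card : ℝ)⁻¹ • ∑ i ∈ fiber c k, ϑ i

/-- Each index i is counted once for every j in its fiber, with weight one over the size of that
fiber. -/
theorem sum_fiber_average (c : Fin m → Fin K) (a : Fin m → ℝ) :
    ∑ j, ((fiber c (c j)).card : ℝ)⁻¹ * ∑ i ∈ fiber c (c j), a i = ∑ i, a i := by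
  have e : ∀ j, ((fiber c (c j)).card : ℝ)⁻¹ * ∑ i ∈ fiber c (c j), a i
      = ∑ i, if c i = c j then ((fiber c (c i)).card : ℝ)⁻¹ * a i else 0 := fun j => by
    rw [fiber, Finset.sum_filter, Finset.mul_sum]
    refine Finset.sum_congr rfl fun i _ => ?_
    split_ifs with h
    · rw [h]; rfl
    · simp
  simp_rw [e]
  rw [Finset.sum_comm]
  refine Finset.sum_congr rfl fun i _ => ?_
  rw [← Finset.sum_filter, Finset.sum_const, nsmul_eq_mul]
  have : (Finset.univ.filter fun j => c i = c j) = fiber c (c i) := by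
    ext j; simp [fiber, eq_comm]
  rw [this, ← mul_assoc, mul_inv_cancel₀ (card_fiber_pos c i).ne', one_mul]

theorem fiberMean_sub (c : Fin m → Fin K) (ϑ : Fin m → Param d) (j : Fin m) (x : Param d) :
    fiberMean c ϑ (c j) - x
      = ((fiber c (c j)).card : ℝ)⁻¹ • ∑ i ∈ fiber c (c j), (ϑ i - x) := by
  rw [Finset.sum_sub_distrib, smul_sub, Finset.sum_const, ← Nat.cast_smul_eq_nsmul ℝ, smul_smul,
    inv_mul_cancel₀ (card_fiber_pos c j).ne', one_smul, fiberMean]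

theorem norm_fiberMean_sub_le (c : Fin m → Fin K) (ϑ : Fin m → Param d) (j : Fin m) (x : Param d) :
    ‖fiberMean c ϑ (c j) - x‖
      ≤ ((fiber c (c j)).card : ℝ)⁻¹ * ∑ i ∈ fiber c (c j), ‖ϑ i - x‖ := by
  rw [fiberMean_sub, norm_smul, Real.norm_eq_abs, abs_of_nonneg (by positivity)]
  gcongr
  exact norm_sum_le _ _

/-- Jensen's inequality for the norm, applied to one argument at a time: the distance from a fiber
mean to a fixed point is at most the average distance. The second argument is averaged in the same
way after exchanging the roles of the indices. -/
theorem sum_cross_fiberMean_le (c : Fin m → Fin K) (ϑ : Fin m → Param d) :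
    ∑ j, ∑ i, (if c j = c i then 0 else ‖fiberMean c ϑ (c j) - fiberMean c ϑ (c i)‖)
      ≤ ∑ j, ∑ i, (if c j = c i then 0 else ‖ϑ j - ϑ i‖) := by
  have step : ∀ (x : Fin K → Param d) (k : Fin K),
      ∑ j, (if c j = k then 0 else ‖fiberMean c ϑ (c j) - x k‖)
        ≤ ∑ j, (if c j = k then 0 else ‖ϑ j - x k‖) := by
    intro x k
    rw [← sum_fiber_average c fun j => if c j = k then 0 else ‖ϑ j - x k‖]
    refine Finset.sum_le_sum fun j _ => ?_
    split_ifs with h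
    · refine mul_nonneg (by positivity) (Finset.sum_nonneg fun i _ => ?_)
      split_ifs <;> positivity
    · refine (norm_fiberMean_sub_le c ϑ j _).trans (le_of_eq ?_)
      congr 1
      refine Finset.sum_congr rfl fun i hi => ?_
      rw [if_neg (by rw [mem_fiber.1 hi]; exact h)]
  have step' : ∀ (x : Param d) (k : Fin K),
      ∑ j, (if c j = k then 0 else ‖fiberMean c ϑ (c j) - x‖)
        ≤ ∑ j, (if c j = k then 0 else ‖ϑ j - x‖) := fun x k => step (fun _ => x) k
  calc _ = ∑ i, ∑ j, (if c j = c i then 0 else ‖fiberMean c ϑ (c j) - fiberMean c ϑ (c i)‖) :=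
        Finset.sum_comm
    _ ≤ ∑ i, ∑ j, (if c j = c i then 0 else ‖ϑ j - fiberMean c ϑ (c i)‖) :=
        Finset.sum_le_sum fun i _ => step' _ _
    _ = ∑ j, ∑ i, (if c i = c j then 0 else ‖fiberMean c ϑ (c i) - ϑ j‖) := by
        rw [Finset.sum_comm]
        exact Finset.sum_congr rfl fun j _ => Finset.sum_congr rfl fun i _ => by
          rw [norm_sub_rev]; simp only [eq_comm]
    _ ≤ ∑ j, ∑ i, (if c i = c j then 0 else ‖ϑ i - ϑ j‖) :=
        Finset.sum_le_sum fun j _ => step' _ _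
    _ = _ := Finset.sum_comm

/-- Averaging over the fibers decreases the objective, unless nothing changes. -/
theorem fused_of_fusionObj_le_fiberMean {c : Fin m → Fin K} {Λ ε g : ℝ} (hε : 0 ≤ ε) (hg : g < Λ)
    {f : Fin m → Param d → ℝ} (hf : ∀ j, ConvexOn ℝ univ (f j)) (ϑ : Fin m → Param d)
    (G : Fin m → Param d) (hG : ∀ j, HasGradientAt (f j) (G j) (fiberMean c ϑ (c j)))
    (hGb : ∀ j, ‖G j‖ ≤ g * (fiber c (c j)).card / 2)
    (hle : fusionObj c Λ ε f ϑ ≤ fusionObj c Λ ε f fun j => fiberMean c ϑ (c j))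
    {j i : Fin m} (hji : c j = c i) : ϑ j = ϑ i := by
  rw [fusionObj_eq, fusionObj_eq] at hle
  set W := ∑ j, ∑ i, if c j = c i then ‖ϑ j - ϑ i‖ else 0 with hW
  set U := ∑ j, ∑ i, if c j = c i then 0 else ‖ϑ j - ϑ i‖ with hU
  have e1 : ∑ j, ∑ i, pairWeight c Λ ε j i * ‖ϑ j - ϑ i‖ = Λ * W + ε * U := by
    rw [hW, hU, Finset.mul_sum, Finset.mul_sum, ← Finset.sum_add_distrib]
    refine Finset.sum_congr rfl fun j _ => ?_
    rw [Finset.mul_sum, Finset.mul_sum, ← Finset.sum_add_distrib]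
    refine Finset.sum_congr rfl fun i _ => ?_
    rw [pairWeight]; split_ifs <;> simp
  have e2 : ∑ j, ∑ i, pairWeight c Λ ε j i * ‖fiberMean c ϑ (c j) - fiberMean c ϑ (c i)‖
      ≤ ε * U := by
    refine le_trans (le_of_eq ?_) (mul_le_mul_of_nonneg_left (sum_cross_fiberMean_le c ϑ) hε)
    rw [Finset.mul_sum]
    refine Finset.sum_congr rfl fun j _ => ?_
    rw [Finset.mul_sum]
    refine Finset.sum_congr rfl fun i _ => ?_
    rw [pairWeight]; split_ifs with h
    · simp [h]
    · rfl
  -- The gradient inequality at the mean bounds the loss of averaging by ‖G_j‖ times the distance to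
  -- the mean. That distance is at most an average over the fiber, and its cardinality cancels the
  -- one in the gradient bound.
  have e3 : ∑ j, f j (fiberMean c ϑ (c j)) ≤ ∑ j, f j (ϑ j) + g / 2 * W := by
    rw [hW, Finset.mul_sum, ← Finset.sum_add_distrib]
    refine Finset.sum_le_sum fun j _ => ?_
    have h1 := (hf j).add_inner_le (hG j) (ϑ j)
    have h2 : -(inner ℝ (G j) (ϑ j - fiberMean c ϑ (c j)) : ℝ)
        ≤ ‖G j‖ * ‖fiberMean c ϑ (c j) - ϑ j‖ := by
      rw [norm_sub_rev]
      exact (neg_le_abs _).trans (abs_real_inner_le_norm _ _)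
    have hcard := card_fiber_pos c j
    have h3 : ‖G j‖ * ‖fiberMean c ϑ (c j) - ϑ j‖ ≤ g / 2 * ∑ i ∈ fiber c (c j), ‖ϑ i - ϑ j‖ := by
      calc _ ≤ (g * (fiber c (c j)).card / 2)
            * (((fiber c (c j)).card : ℝ)⁻¹ * ∑ i ∈ fiber c (c j), ‖ϑ i - ϑ j‖) :=
            mul_le_mul (hGb j) (norm_fiberMean_sub_le c ϑ j _) (norm_nonneg _)
              ((norm_nonneg _).trans (hGb j))
        _ = _ := by field_simp
    have h4 : ∑ i ∈ fiber c (c j), ‖ϑ i - ϑ j‖ = ∑ i, if c j = c i then ‖ϑ j - ϑ i‖ else 0 := by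
      rw [fiber, Finset.sum_filter]
      refine Finset.sum_congr rfl fun i _ => ?_
      rw [norm_sub_rev]; simp only [eq_comm]
    rw [← h4]
    linarith
  -- Averaging removes the within-fiber penalty Λ/2 · W, does not increase the cross penalty, and
  -- costs at most g/2 · W; since g < Λ, the spread W must vanish.
  have hW0 : W ≤ 0 := by
    rw [e1] at hle
    have : (Λ - g) * W ≤ 0 := by linarith
    by_contra hc
    exact absurd this (not_le.2 (mul_pos (sub_pos.2 hg) (not_le.1 hc)))
  have hnn : ∀ j i, 0 ≤ if c j = c i then ‖ϑ j - ϑ i‖ else 0 := fun j i => by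
    split_ifs <;> positivity
  have h1 := (Finset.sum_eq_zero_iff_of_nonneg fun j _ => Finset.sum_nonneg fun i _ => hnn j i).1
    (le_antisymm hW0 (Finset.sum_nonneg fun j _ => Finset.sum_nonneg fun i _ => hnn j i)) j
    (Finset.mem_univ j)
  have h2 := (Finset.sum_eq_zero_iff_of_nonneg fun i _ => hnn j i).1 h1 i (Finset.mem_univ i)
  rw [if_pos hji, norm_eq_zero, sub_eq_zero] at h2
  exact h2

/-- First order condition along a common shift of one fiber. -/
theorem nonneg_of_shift_fiber {c : Fin m → Fin K} {Λ ε : ℝ} (hε : 0 ≤ ε)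
    {f : Fin m → Param d → ℝ} {ϑ : Fin m → Param d} {G : Fin m → Param d}
    (k : Fin K) (hG : ∀ j ∈ fiber c k, HasGradientAt (f j) (G j) (ϑ j)) (v : Param d) {t₀ : ℝ}
    (ht₀ : 0 < t₀)
    (hmin : ∀ t ∈ Ioc 0 t₀, fusionObj c Λ ε f ϑ
      ≤ fusionObj c Λ ε f fun j => ϑ j + t • if c j = k then v else 0) :
    0 ≤ inner ℝ (∑ j ∈ fiber c k, G j) v + ε * m * (fiber c k).card * ‖v‖ := by
  have hd : HasDerivAt (fun t : ℝ => ∑ j ∈ fiber c k, f j (ϑ j + t • v))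
      (inner ℝ (∑ j ∈ fiber c k, G j) v) 0 := by
    rw [sum_inner]
    exact HasDerivAt.fun_sum fun j hj => (hG j hj).hasDerivAt_line v
  refine nonneg_of_hasDerivAt_of_le hd ht₀ fun t ht => ?_
  have h := hmin t ht
  rw [fusionObj_eq, fusionObj_eq] at h
  have e1 : ∀ x : ℝ, ∑ j, f j (ϑ j + x • if c j = k then v else 0)
      = ∑ j ∈ fiber c k, f j (ϑ j + x • v) + ∑ j ∈ Finset.univ.filter (fun j => ¬ c j = k), f j (ϑ j) := by
    intro x
    rw [← Finset.sum_filter_add_sum_filter_not Finset.univ (fun j => c j = k), fiber]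
    congr 1
    · refine Finset.sum_congr rfl fun j hj => ?_
      rw [if_pos (Finset.mem_filter.1 hj).2]
    · refine Finset.sum_congr rfl fun j hj => ?_
      rw [if_neg (Finset.mem_filter.1 hj).2]; simp
  have e1' := e1 t
  have e0' := e1 0
  simp only [zero_smul, add_zero] at e0'
  -- A common shift does not change differences inside fibers, so the large weight Λ plays no role.
  -- A cross pair changes by at most t‖v‖ for each of its endpoints lying in fiber k. Over ordered
  -- pairs this sums to 2m times the size of the fiber, and the 2 cancels the factor 1/2 of
  -- `fusionObj_eq`.
  have e2 : ∑ j, ∑ i, pairWeight c Λ ε j i * ‖(ϑ j + t • if c j = k then v else 0)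
        - (ϑ i + t • if c i = k then v else 0)‖
      ≤ ∑ j, ∑ i, pairWeight c Λ ε j i * ‖ϑ j - ϑ i‖
        + ∑ j, ∑ i, ε * (t * ‖v‖) * ((if c j = k then 1 else 0) + (if c i = k then 1 else 0)) := by
    rw [← Finset.sum_add_distrib]
    refine Finset.sum_le_sum fun j _ => ?_
    rw [← Finset.sum_add_distrib]
    refine Finset.sum_le_sum fun i _ => ?_
    have hv : (0:ℝ) ≤ t * ‖v‖ := mul_nonneg ht.1.le (norm_nonneg _)
    by_cases hji : c j = c i
    · rw [hji, add_sub_add_right_eq_sub]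
      have : 0 ≤ ε * (t * ‖v‖) *
        ((if c i = k then 1 else 0) + (if c i = k then 1 else 0)) := by
        refine mul_nonneg (mul_nonneg hε hv) ?_
        split_ifs <;> norm_num
      linarith
    · rw [pairWeight, if_neg hji, mul_assoc ε (t * ‖v‖), ← mul_add]
      refine mul_le_mul_of_nonneg_left ?_ hε
      rw [add_sub_add_comm, ← smul_sub]
      refine (norm_add_le _ _).trans (add_le_add le_rfl ?_)
      rw [norm_smul, Real.norm_eq_abs, abs_of_pos ht.1, mul_assoc]
      refine mul_le_mul_of_nonneg_left ?_ ht.1.le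
      split_ifs <;> simp
  have e3 : ∑ j : Fin m, ∑ i : Fin m,
      ε * (t * ‖v‖) * (((if c j = k then 1 else 0) + (if c i = k then 1 else 0) : ℝ))
      = 2 * (t * (ε * m * (fiber c k).card * ‖v‖)) := by
    have hc : ∑ i : Fin m, (if c i = k then (1:ℝ) else 0) = (fiber c k).card := by
      rw [Finset.sum_boole]; rfl
    simp_rw [← Finset.mul_sum, Finset.sum_add_distrib, hc]
    simp only [Finset.sum_const, Finset.card_univ, Fintype.card_fin, nsmul_eq_mul]
    rw [← Finset.mul_sum, hc]
    ring
  simp only [zero_smul, add_zero]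
  rw [e1'] at h
  rw [e0'] at h
  linarith

end Fusion

end Multitask

namespace Multitask

/-! ### Localization and near stationarity of fused minimizers -/

section Fusion

variable {d m K : ℕ}

/-- Conditions under which the minimizers of the fusion objective are constant on the fibers of `c`
and close to the centers `b`. -/
structure FusionRegular (c : Fin m → Fin K) (Λ ε : ℝ) (f : Fin m → Param d → ℝ)
    (G : Fin m → Param d → Param d) (b : Fin K → Param d) (r R g : ℝ) : Prop where
  eps_nonneg : 0 ≤ ε
  bound_lt : g < Λ
  bound_nonneg : 0 ≤ g
  radius_nonneg : 0 ≤ R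
  radius_lt : R < r
  convex : ∀ j, ConvexOn ℝ univ (f j)
  grad : ∀ j, ∀ x, ‖x - b (c j)‖ ≤ r → HasGradientAt (f j) (G j x) x
  grad_le : ∀ j, ∀ x, ‖x - b (c j)‖ ≤ r → ‖G j x‖ ≤ g * (fiber c (c j)).card / 2
  curved : ∀ k, ∀ x, ‖x - b k‖ ≤ r → R < ‖x - b k‖ →
    ε * m * (fiber c k).card * ‖x - b k‖ < inner ℝ (∑ j ∈ fiber c k, G j x) (x - b k)

namespace FusionRegular

variable {c : Fin m → Fin K} {Λ ε : ℝ} {f : Fin m → Param d → ℝ} {G : Fin m → Param d → Param d}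
  {b : Fin K → Param d} {r R g : ℝ}

theorem weight_nonneg (h : FusionRegular c Λ ε f G b r R g) : 0 ≤ Λ := h.bound_nonneg.trans h.bound_lt.le

theorem r_nonneg (h : FusionRegular c Λ ε f G b r R g) : 0 ≤ r := h.radius_nonneg.trans h.radius_lt.le

theorem mem_ball_iff (h : FusionRegular c Λ ε f G b r R g) {ϑ : Fin m → Param d} :
    ϑ ∈ Metric.closedBall (fun j => b (c j)) r ↔ ∀ j, ‖ϑ j - b (c j)‖ ≤ r := by
  rw [mem_closedBall_iff_norm, pi_norm_le_iff_of_nonneg h.r_nonneg]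
  rfl

/-- The fiber means stay in the ball by convexity, so minimality on the ball alone allows the
comparison with the averaged configuration. -/
theorem fused_of_isMinOn (h : FusionRegular c Λ ε f G b r R g) {ϑ : Fin m → Param d}
    (hϑ : ϑ ∈ Metric.closedBall (fun j => b (c j)) r)
    (hmin : IsMinOn (fusionObj c Λ ε f) (Metric.closedBall (fun j => b (c j)) r) ϑ)
    {j i : Fin m} (hji : c j = c i) : ϑ j = ϑ i := by
  have hb := h.mem_ball_iff.1 hϑ
  have hmean : ∀ j, ‖fiberMean c ϑ (c j) - b (c j)‖ ≤ r := fun j => by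
    refine (norm_fiberMean_sub_le c ϑ j _).trans ?_
    rw [inv_mul_le_iff₀ (card_fiber_pos c j)]
    refine (Finset.sum_le_card_nsmul _ _ r fun i hi => ?_).trans (by rw [nsmul_eq_mul])
    rw [← mem_fiber.1 hi]
    exact hb i
  exact fused_of_fusionObj_le_fiberMean h.eps_nonneg h.bound_lt h.convex ϑ
    (fun j => G j (fiberMean c ϑ (c j))) (fun j => h.grad j _ (hmean j))
    (fun j => h.grad_le j _ (hmean j))
    (hmin (h.mem_ball_iff.2 hmean)) hji

/-- Otherwise the whole fiber, already fused, could be moved straight towards its center. This stays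
in the ball, and by `curved` the loss decreases faster than the cross penalties can increase. -/
theorem norm_sub_le_of_isMinOn (h : FusionRegular c Λ ε f G b r R g) {ϑ : Fin m → Param d}
    (hϑ : ϑ ∈ Metric.closedBall (fun j => b (c j)) r)
    (hmin : IsMinOn (fusionObj c Λ ε f) (Metric.closedBall (fun j => b (c j)) r) ϑ)
    (j : Fin m) : ‖ϑ j - b (c j)‖ ≤ R := by
  by_contra hR
  rw [not_le] at hR
  have hb := h.mem_ball_iff.1 hϑ
  have hfused : ∀ i ∈ fiber c (c j), ϑ i = ϑ j := fun i hi =>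
    h.fused_of_isMinOn hϑ hmin (mem_fiber.1 hi)
  have h1 := nonneg_of_shift_fiber h.eps_nonneg (Λ := Λ) (f := f) (ϑ := ϑ) (G := fun i => G i (ϑ j)) (c j)
    (fun i hi => by
      rw [hfused i hi]
      exact h.grad i _ (by rw [mem_fiber.1 hi]; exact hb j))
    (-(ϑ j - b (c j))) one_pos (fun t ht => by
      refine hmin (h.mem_ball_iff.2 fun i => ?_)
      by_cases hi : c i = c j
      · rw [if_pos hi, hi, hfused i (mem_fiber.2 hi)]
        have : ϑ j + t • -(ϑ j - b (c j)) - b (c j) = (1 - t) • (ϑ j - b (c j)) := by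
          rw [sub_smul, one_smul, smul_neg]; abel
        rw [this, norm_smul, Real.norm_eq_abs, abs_of_nonneg (by linarith [ht.2])]
        nlinarith [hb j, norm_nonneg (ϑ j - b (c j)), ht.1, ht.2]
      · rw [if_neg hi]; simpa using hb i)
  have h2 := h.curved (c j) (ϑ j) (hb j) hR
  rw [inner_neg_right, norm_neg] at h1
  linarith

theorem exists_isMinOn (h : FusionRegular c Λ ε f G b r R g) :
    ∃ ϑ ∈ Metric.closedBall (fun j => b (c j)) r,
      IsMinOn (fusionObj c Λ ε f) (Metric.closedBall (fun j => b (c j)) r) ϑ := by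
  refine (isCompact_closedBall _ _).exists_isMinOn
    ⟨_, Metric.mem_closedBall_self h.r_nonneg⟩ ?_
  refine ContinuousOn.add (continuousOn_finsetSum _ fun j _ => ?_) (by fun_prop)
  have hc : ContinuousOn (f j) {x | ‖x - b (c j)‖ ≤ r} := fun x hx =>
    (h.grad j x hx).hasFDerivAt.continuousAt.continuousWithinAt
  exact hc.comp (by fun_prop) fun ϑ hϑ => h.mem_ball_iff.1 hϑ j

/-- A minimizer on the compact ball lies within R < r of the centers, hence in the interior; a local
minimizer of a convex function is global. -/
theorem exists_minimizer (h : FusionRegular c Λ ε f G b r R g) :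
    ∃ ϑ, (∀ j, ‖ϑ j - b (c j)‖ ≤ R) ∧ ∀ ϑ', fusionObj c Λ ε f ϑ ≤ fusionObj c Λ ε f ϑ' := by
  obtain ⟨ϑ, hϑ, hmin⟩ := h.exists_isMinOn
  have hR := h.norm_sub_le_of_isMinOn hϑ hmin
  refine ⟨ϑ, hR, ?_⟩
  refine IsMinOn.of_isLocalMin_of_convex_univ ?_
    (convexOn_fusionObj h.weight_nonneg h.eps_nonneg h.convex)
  refine hmin.isLocalMin (Filter.mem_of_superset (Metric.isOpen_ball.mem_nhds ?_)
    Metric.ball_subset_closedBall)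
  rw [mem_ball_iff_norm]
  exact ((pi_norm_le_iff_of_nonneg h.radius_nonneg).2 hR).trans_lt h.radius_lt

/-- If another minimizer were outside, the segment joining it to the known one would consist of
minimizers by convexity and would cross the radius (R + r)/2. That point minimizes on the ball but
is farther than R, which is excluded. -/
theorem mem_ball_of_minimizer (h : FusionRegular c Λ ε f G b r R g) {ϑ₁ : Fin m → Param d}
    (hmin₁ : ∀ ϑ', fusionObj c Λ ε f ϑ₁ ≤ fusionObj c Λ ε f ϑ') :
    ϑ₁ ∈ Metric.closedBall (fun j => b (c j)) r := by
  obtain ⟨ϑ, hR, hmin⟩ := h.exists_minimizer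
  set B : Fin m → Param d := fun j => b (c j) with hB
  by_contra hout
  rw [mem_closedBall_iff_norm, not_le] at hout
  have hcont : ContinuousOn (fun t : ℝ => ‖ϑ + t • (ϑ₁ - ϑ) - B‖) (Icc 0 1) := by fun_prop
  have h0 : ‖ϑ - B‖ ≤ R := (pi_norm_le_iff_of_nonneg h.radius_nonneg).2 hR
  obtain ⟨t, ht, hval⟩ := intermediate_value_Icc zero_le_one hcont
    (show (R + r) / 2 ∈ Icc _ _ by
      have := h.radius_lt
      constructor
      · simp only [zero_smul, add_zero]; linarith
      · simp only [one_smul, add_sub_cancel]; linarith)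
  simp only at hval
  have hconv := (convexOn_fusionObj (c := c) h.weight_nonneg h.eps_nonneg h.convex).2 (mem_univ ϑ)
    (mem_univ ϑ₁) (sub_nonneg.2 ht.2) ht.1 (by ring)
  have hpt : (1 - t) • ϑ + t • ϑ₁ = ϑ + t • (ϑ₁ - ϑ) := by
    rw [sub_smul, one_smul, smul_sub]; abel
  rw [hpt, le_antisymm (hmin₁ ϑ) (hmin ϑ₁), smul_eq_mul, smul_eq_mul] at hconv
  have hconv' : fusionObj c Λ ε f (ϑ + t • (ϑ₁ - ϑ)) ≤ fusionObj c Λ ε f ϑ := by linarith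
  have hball : ϑ + t • (ϑ₁ - ϑ) ∈ Metric.closedBall B r := by
    rw [mem_closedBall_iff_norm, hval]; linarith [h.radius_lt]
  have := h.norm_sub_le_of_isMinOn hball fun ϑ' _ => hconv'.trans (hmin ϑ')
  have h3 := (pi_norm_le_iff_of_nonneg (x := ϑ + t • (ϑ₁ - ϑ) - B) h.radius_nonneg).2 this
  rw [hval] at h3
  linarith [h.radius_lt]

/-- Shifting the fiber against its pooled gradient S yields ‖S‖² ≤ ε m |fiber| ‖S‖, since only the
cross penalties oppose the move. -/
theorem minimizer_spec (h : FusionRegular c Λ ε f G b r R g) {ϑ : Fin m → Param d}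
    (hmin : ∀ ϑ', fusionObj c Λ ε f ϑ ≤ fusionObj c Λ ε f ϑ') (j : Fin m) :
    ‖ϑ j - b (c j)‖ ≤ R ∧
      ‖∑ i ∈ fiber c (c j), G i (ϑ j)‖ ≤ ε * m * (fiber c (c j)).card := by
  have hϑ := h.mem_ball_of_minimizer hmin
  have hmin' : IsMinOn (fusionObj c Λ ε f) (Metric.closedBall (fun j => b (c j)) r) ϑ :=
    fun ϑ' _ => hmin ϑ'
  have hb := h.mem_ball_iff.1 hϑ
  refine ⟨h.norm_sub_le_of_isMinOn hϑ hmin' j, ?_⟩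
  set S := ∑ i ∈ fiber c (c j), G i (ϑ j) with hS
  have h1 := nonneg_of_shift_fiber h.eps_nonneg (Λ := Λ) (f := f) (ϑ := ϑ) (G := fun i => G i (ϑ j)) (c j)
    (fun i hi => by
      rw [h.fused_of_isMinOn hϑ hmin' (mem_fiber.1 hi)]
      exact h.grad i _ (by rw [mem_fiber.1 hi]; exact hb j))
    (-S) one_pos (fun t _ => hmin _)
  rw [← hS, inner_neg_right, real_inner_self_eq_norm_sq, norm_neg] at h1
  rcases (norm_nonneg S).eq_or_lt with h0 | h0
  · rw [← h0]
    exact mul_nonneg (mul_nonneg h.eps_nonneg (by positivity)) (by positivity)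
  · nlinarith

/-- The fusion objective with extended real weights has a minimizer, and its minimizers are fused,
close to the centers and nearly stationary. -/
theorem extended_minimizer_spec (h : FusionRegular c Λ ε f G b r R g)
    {pen : Fin m → Fin m → ℝ≥0∞}
    (hpen : ∀ j i, c j = c i → ENNReal.ofReal Λ ≤ pen j i)
    (hpen' : ∀ j i, c j ≠ c i → pen j i = ENNReal.ofReal ε)
    {obj : (Fin m → Param d) → EReal}
    (hobj : ∀ ϑ, obj ϑ = ((∑ j, f j (ϑ j) : ℝ) : EReal) +
      ((∑ j, ∑ i ∈ Finset.Iio j, pen j i * ‖ϑ j - ϑ i‖ₑ : ℝ≥0∞) : EReal))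
    {ϑ : Fin m → Param d}
    (hest : (∃ ϑ₀, ∀ ϑ', obj ϑ₀ ≤ obj ϑ') → ∀ ϑ', obj ϑ ≤ obj ϑ') (j : Fin m) :
    ‖ϑ j - b (c j)‖ ≤ R ∧
      ‖∑ i ∈ fiber c (c j), G i (ϑ j)‖ ≤ ε * m * (fiber c (c j)).card := by
  have hwnn : ∀ j i, 0 ≤ pairWeight c Λ ε j i := fun j i => by
    rw [pairWeight]; split_ifs; exacts [h.weight_nonneg, h.eps_nonneg]
  have hreal : ∀ ϑ, ((fusionObj c Λ ε f ϑ : ℝ) : EReal) = ((∑ j, f j (ϑ j) : ℝ) : EReal) +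
      ((∑ j, ∑ i ∈ Finset.Iio j, ENNReal.ofReal (pairWeight c Λ ε j i) * ‖ϑ j - ϑ i‖ₑ : ℝ≥0∞)
        : EReal) := by
    intro ϑ
    have hnn : ∀ j i, 0 ≤ pairWeight c Λ ε j i * ‖ϑ j - ϑ i‖ := fun j i =>
      mul_nonneg (hwnn j i) (norm_nonneg _)
    have : (∑ j, ∑ i ∈ Finset.Iio j, ENNReal.ofReal (pairWeight c Λ ε j i) * ‖ϑ j - ϑ i‖ₑ : ℝ≥0∞)
        = ENNReal.ofReal (∑ j, ∑ i ∈ Finset.Iio j, pairWeight c Λ ε j i * ‖ϑ j - ϑ i‖) := by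
      rw [ENNReal.ofReal_sum_of_nonneg fun j _ => Finset.sum_nonneg fun i _ => hnn j i]
      refine Finset.sum_congr rfl fun j _ => ?_
      rw [ENNReal.ofReal_sum_of_nonneg fun i _ => hnn j i]
      refine Finset.sum_congr rfl fun i _ => ?_
      rw [ENNReal.ofReal_mul (hwnn j i), ofReal_norm]
    rw [this, EReal.coe_ennreal_ofReal, max_eq_left
      (Finset.sum_nonneg fun j _ => Finset.sum_nonneg fun i _ => hnn j i), ← EReal.coe_add]
    rfl
  -- The finite objective with weight Λ bounds the extended one from below and agrees with it on
  -- fused configurations. Its minimizers are fused, so the two problems have the same minimal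
  -- value, and every minimizer of the extended problem also minimizes the finite one.
  have hle : ∀ ϑ, ((fusionObj c Λ ε f ϑ : ℝ) : EReal) ≤ obj ϑ := by
    intro ϑ
    rw [hreal, hobj]
    refine add_le_add le_rfl (EReal.coe_ennreal_le_coe_ennreal_iff.2 ?_)
    refine Finset.sum_le_sum fun j _ => Finset.sum_le_sum fun i _ => ?_
    gcongr
    rw [pairWeight]
    split_ifs with hc
    · exact hpen j i hc
    · exact (hpen' j i hc).ge
  have heq : ∀ ϑ, (∀ j i, c j = c i → ϑ j = ϑ i) → obj ϑ = ((fusionObj c Λ ε f ϑ : ℝ) : EReal) := by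
    intro ϑ hϑ
    rw [hreal, hobj]
    congr 2
    refine Finset.sum_congr rfl fun j _ => Finset.sum_congr rfl fun i _ => ?_
    by_cases hc : c j = c i
    · rw [hϑ j i hc]; simp
    · rw [hpen' j i hc, pairWeight, if_neg hc]
  obtain ⟨ϑ₀, hR, hmin⟩ := h.exists_minimizer
  have hϑ₀ := h.mem_ball_of_minimizer hmin
  have hfused : ∀ j i, c j = c i → ϑ₀ j = ϑ₀ i := fun j i hji =>
    h.fused_of_isMinOn hϑ₀ (fun ϑ' _ => hmin ϑ') hji
  have hexists : ∀ ϑ', obj ϑ₀ ≤ obj ϑ' := fun ϑ' => by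
    rw [heq ϑ₀ hfused]
    exact (EReal.coe_le_coe_iff.2 (hmin ϑ')).trans (hle ϑ')
  have hhat := hest ⟨ϑ₀, hexists⟩ ϑ₀
  rw [heq ϑ₀ hfused] at hhat
  have := EReal.coe_le_coe_iff.1 ((hle ϑ).trans hhat)
  exact h.minimizer_spec (fun ϑ' => this.trans (hmin ϑ')) j

end FusionRegular

end Fusion

end Multitask

namespace Multitask

/-! ### Differentiable random curves -/

theorem sq_lintegral_le {α : Type*} [MeasurableSpace α] {P : Measure α} [IsProbabilityMeasure P]
    {f : α → ℝ≥0∞} (hf : AEMeasurable f P) : (∫⁻ x, f x ∂P) ^ 2 ≤ ∫⁻ x, f x ^ 2 ∂P := by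
  have h := ENNReal.lintegral_mul_le_Lp_mul_Lq P (Real.HolderConjugate.two_two) hf
    (aemeasurable_const (b := (1:ℝ≥0∞)))
  simp only [Pi.mul_apply, mul_one, ENNReal.one_rpow, lintegral_one, measure_univ] at h
  calc _ ≤ ((∫⁻ x, f x ^ (2:ℝ) ∂P) ^ (1 / 2 : ℝ)) ^ 2 := by gcongr
    _ = ∫⁻ x, f x ^ (2:ℝ) ∂P := by
      rw [← ENNReal.rpow_natCast, ← ENNReal.rpow_mul]; norm_num
    _ = _ := by
      refine lintegral_congr fun x => ?_
      rw [← ENNReal.rpow_natCast]; norm_num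

section Curve

variable {𝒵 : Type*} [MeasurableSpace 𝒵] {d : ℕ} {u u' : ℝ → 𝒵 → Param d} {a : ℝ}

/-- The increments point towards c, so the quotients evaluate the curve only between t and c, where
measurability will be available. -/
theorem tendsto_diff_quotient {φ : ℝ → Param d} {x : Param d} {t : ℝ} (h : HasDerivAt φ x t) {c : ℝ}
    (hc : c ≠ t) : Tendsto (fun n : ℕ => ((c - t) / (n + 1))⁻¹ • (φ (t + (c - t) / (n + 1)) - φ t))
      atTop (𝓝 x) := by
  have h1 : Tendsto (fun n : ℕ => t + (c - t) / (n + 1)) atTop (𝓝[≠] t) := by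
    rw [tendsto_nhdsWithin_iff]
    constructor
    · have := (tendsto_const_nhds (x := c - t)).div_atTop
        (tendsto_natCast_atTop_atTop.atTop_add (tendsto_const_nhds (x := (1:ℝ))))
      simpa using this.const_add t
    · refine Eventually.of_forall fun n => ?_
      have : (c - t) / (n + 1) ≠ 0 := div_ne_zero (sub_ne_zero.2 hc) (by positivity)
      simpa using this
  have h2 := (hasDerivAt_iff_tendsto_slope.1 h).comp h1
  refine h2.congr fun n => ?_
  simp [slope_def_module]

theorem interpolant_mem {c t : ℝ} (hc : c ∈ Icc 0 a) (ht : t ∈ Icc 0 a) (n : ℕ) :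
    t + (c - t) / (n + 1) ∈ Icc 0 a := by
  have h1 : (0:ℝ) < n + 1 := by positivity
  have h2 : (0:ℝ) ≤ 1 / (n + 1) := by positivity
  have h3 : (1:ℝ) / (n + 1) ≤ 1 := by rw [div_le_one h1]; linarith [n.cast_nonneg (α := ℝ)]
  have : t + (c - t) / (n + 1) = (1 - 1 / (n + 1)) * t + 1 / (n + 1) * c := by ring
  rw [this]
  constructor
  · have := mul_nonneg (sub_nonneg.2 h3) ht.1
    have := mul_nonneg h2 hc.1
    linarith
  · have := mul_le_mul_of_nonneg_left ht.2 (sub_nonneg.2 h3)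
    have := mul_le_mul_of_nonneg_left hc.2 h2
    linarith

theorem measurable_curve_deriv (ha : 0 < a)
    (hd : ∀ t ∈ Icc 0 a, ∀ z, HasDerivAt (fun s => u s z) (u' t z) t)
    (hm : ∀ t ∈ Icc 0 a, Measurable (u t)) {t : ℝ} (ht : t ∈ Icc 0 a) : Measurable (u' t) := by
  obtain ⟨c, hc, hct⟩ : ∃ c ∈ Icc 0 a, c ≠ t := by
    rcases eq_or_ne t 0 with h | h
    · exact ⟨a, ⟨ha.le, le_rfl⟩, h ▸ ha.ne'⟩
    · exact ⟨0, ⟨le_rfl, ha.le⟩, h.symm⟩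
  refine measurable_of_tendsto_metrizable (f := fun (n : ℕ) z =>
    ((c - t) / (n + 1))⁻¹ • (u (t + (c - t) / (n + 1)) z - u t z)) (fun n => ?_)
    (tendsto_pi_nhds.2 fun z => tendsto_diff_quotient (hd t ht z) hct)
  exact ((hm _ (interpolant_mem hc ht n)).sub (hm t ht)).const_smul (((c - t) / (n + 1))⁻¹ : ℝ)

/-- Continuity in time together with measurability in the observation gives joint measurability; the
projection extends the curve constantly beyond the interval. -/
theorem measurable_uncurry_curve (ha : 0 < a)
    (hd : ∀ t ∈ Icc 0 a, ∀ z, HasDerivAt (fun s => u s z) (u' t z) t)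
    (hm : ∀ t ∈ Icc 0 a, Measurable (u t)) :
    Measurable fun p : ℝ × 𝒵 => u (projIcc 0 a ha.le p.1) p.2 := by
  have h : Measurable (Function.uncurry fun (s : ℝ) (z : 𝒵) => u (projIcc 0 a ha.le s) z) := by
    refine measurable_uncurry_of_continuous_of_measurable (fun z => ?_) fun s =>
      hm _ (projIcc 0 a ha.le s).2
    have hc : ContinuousOn (fun s => u s z) (Icc 0 a) := fun s hs =>
      (hd s hs z).continuousAt.continuousWithinAt
    exact hc.comp_continuous (continuous_subtype_val.comp continuous_projIcc)
      fun s => (projIcc 0 a ha.le s).2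
  exact h

/-- The derivative is a pointwise limit of difference quotients taken in the direction of the right
endpoint a. At a itself these degenerate, whence the half-open interval; one point does not affect
the integrals over time. -/
theorem measurable_uncurry_curve_deriv (ha : 0 < a)
    (hd : ∀ t ∈ Icc 0 a, ∀ z, HasDerivAt (fun s => u s z) (u' t z) t)
    (hm : ∀ t ∈ Icc 0 a, Measurable (u t)) :
    Measurable fun p : ℝ × 𝒵 => (Ico 0 a).indicator (fun s => u' s p.2) p.1 := by
  have hU := measurable_uncurry_curve ha hd hm
  have hI : MeasurableSet {p : ℝ × 𝒵 | p.1 ∈ Ico 0 a} := measurable_fst measurableSet_Ico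
  refine measurable_of_tendsto_metrizable (f := fun (n : ℕ) (p : ℝ × 𝒵) =>
    {p : ℝ × 𝒵 | p.1 ∈ Ico 0 a}.indicator (fun p => ((a - p.1) / (n + 1))⁻¹ •
      (u (projIcc 0 a ha.le (p.1 + (a - p.1) / (n + 1))) p.2 - u (projIcc 0 a ha.le p.1) p.2)) p)
    (fun n => ?_) (tendsto_pi_nhds.2 fun p => ?_)
  · have hq : Measurable fun p : ℝ × 𝒵 => ((a - p.1) / ((n:ℝ) + 1))⁻¹ := by fun_prop
    refine Measurable.indicator (hq.smul (Measurable.sub ?_ hU)) hI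
    have hg : Measurable fun p : ℝ × 𝒵 => (p.1 + (a - p.1) / ((n:ℝ) + 1), p.2) := by fun_prop
    exact hU.comp hg
  · by_cases hp : p.1 ∈ Ico 0 a
    · have hp' : p.1 ∈ Icc 0 a := Ico_subset_Icc_self hp
      rw [indicator_of_mem hp]
      refine (tendsto_diff_quotient (hd p.1 hp' p.2) hp.2.ne').congr fun n => ?_
      rw [indicator_of_mem (by exact hp), projIcc_of_mem ha.le hp',
        projIcc_of_mem ha.le (interpolant_mem ⟨ha.le, le_rfl⟩ hp' n)]
    · rw [indicator_of_notMem hp]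
      refine tendsto_const_nhds.congr fun n => ?_
      rw [indicator_of_notMem (by exact hp)]

/-- If the right side is infinite there is nothing to prove; if it is finite the derivative is
integrable and the fundamental theorem of calculus applies, without any continuity of the
derivative. -/
theorem enorm_curve_sub_le (ha : 0 < a)
    (hd : ∀ t ∈ Icc 0 a, ∀ z, HasDerivAt (fun s => u s z) (u' t z) t)
    (hm : ∀ t ∈ Icc 0 a, Measurable (u t)) (z : 𝒵) :
    ‖u a z - u 0 z‖ₑ ≤ ∫⁻ s in Ico 0 a, ‖u' s z‖ₑ := by
  rcases eq_or_ne (∫⁻ s in Ico 0 a, ‖u' s z‖ₑ) ∞ with h | h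
  · rw [h]; exact le_top
  have hsm : AEStronglyMeasurable (fun s => u' s z) (volume.restrict (Ico 0 a)) := by
    have h1 := (measurable_uncurry_curve_deriv ha hd hm).comp
      (measurable_prodMk_right (y := z) : Measurable fun s : ℝ => (s, z))
    refine ⟨_, h1.stronglyMeasurable, ?_⟩
    filter_upwards [ae_restrict_mem measurableSet_Ico] with s hs
    simp [indicator_of_mem hs]
  have hint : IntegrableOn (fun s => u' s z) (Ico 0 a) := ⟨hsm, lt_top_iff_ne_top.2 h⟩
  have hint' : IntervalIntegrable (fun s => u' s z) volume 0 a := by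
    rw [intervalIntegrable_iff_integrableOn_Ico_of_le ha.le]
    exact hint
  have := intervalIntegral.integral_eq_sub_of_hasDerivAt (a := 0) (b := a)
    (fun s hs => hd s (by rwa [uIcc_of_le ha.le] at hs) z) hint'
  rw [← this, intervalIntegral.integral_of_le ha.le, ← integral_Ico_eq_integral_Ioc]
  exact enorm_integral_le_lintegral_enorm _

variable {P : Measure 𝒵} [IsProbabilityMeasure P]

theorem lintegral_curve_sub_le (ha : 0 < a)
    (hd : ∀ t ∈ Icc 0 a, ∀ z, HasDerivAt (fun s => u s z) (u' t z) t)
    (hm : ∀ t ∈ Icc 0 a, Measurable (u t)) {B : ℝ≥0∞}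
    (hB : ∀ t ∈ Icc 0 a, ∫⁻ z, ‖u' t z‖ₑ ∂P ≤ B) :
    ∫⁻ z, ‖u a z - u 0 z‖ₑ ∂P ≤ ENNReal.ofReal a * B := by
  have hM := (measurable_uncurry_curve_deriv ha hd hm).enorm
  have e : ∀ z, ∫⁻ s in Ico 0 a, ‖u' s z‖ₑ
      = ∫⁻ s in Ico 0 a, ‖(Ico 0 a).indicator (fun s => u' s z) s‖ₑ := fun z =>
    setLIntegral_congr_fun measurableSet_Ico fun s hs => by simp [indicator_of_mem hs]
  calc _ ≤ ∫⁻ z, (∫⁻ s in Ico 0 a, ‖(Ico 0 a).indicator (fun s => u' s z) s‖ₑ) ∂P := by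
        refine lintegral_mono fun z => ?_
        rw [← e]
        exact enorm_curve_sub_le ha hd hm z
    _ = ∫⁻ s in Ico 0 a, ∫⁻ z, ‖(Ico 0 a).indicator (fun s => u' s z) s‖ₑ ∂P := by
        rw [lintegral_lintegral_swap]
        exact (hM.comp measurable_swap).aemeasurable
    _ ≤ ∫⁻ s in Ico 0 a, B := by
        refine setLIntegral_mono measurable_const fun s hs => ?_
        simp only [indicator_of_mem hs]
        exact hB s (Ico_subset_Icc_self hs)
    _ = _ := by simp [mul_comm]

/-- The fundamental theorem of calculus is followed by the Cauchy-Schwarz inequality in time on an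
interval of length one, and then by Tonelli. -/
theorem lintegral_curve_sub_sq_le
    (hd : ∀ t ∈ Icc (0:ℝ) 1, ∀ z, HasDerivAt (fun s => u s z) (u' t z) t)
    (hm : ∀ t ∈ Icc (0:ℝ) 1, Measurable (u t)) {B : ℝ≥0∞}
    (hB : ∀ t ∈ Icc (0:ℝ) 1, ∫⁻ z, ‖u' t z‖ₑ ^ 2 ∂P ≤ B) :
    ∫⁻ z, ‖u 1 z - u 0 z‖ₑ ^ 2 ∂P ≤ B := by
  have hM := (measurable_uncurry_curve_deriv one_pos hd hm).enorm
  have : IsProbabilityMeasure (volume.restrict (Ico (0:ℝ) 1)) := ⟨by simp⟩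
  have e : ∀ z, ∫⁻ s in Ico (0:ℝ) 1, ‖u' s z‖ₑ
      = ∫⁻ s in Ico (0:ℝ) 1, ‖(Ico 0 1).indicator (fun s => u' s z) s‖ₑ := fun z =>
    setLIntegral_congr_fun measurableSet_Ico fun s hs => by simp [indicator_of_mem hs]
  calc _ ≤ ∫⁻ z, (∫⁻ s in Ico (0:ℝ) 1, ‖(Ico 0 1).indicator (fun s => u' s z) s‖ₑ ^ 2) ∂P := by
        refine lintegral_mono fun z => ?_
        refine (pow_le_pow_left' (enorm_curve_sub_le one_pos hd hm z) 2).trans ?_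
        rw [e]
        exact sq_lintegral_le
          (hM.comp (measurable_prodMk_right (y := z) : Measurable fun s : ℝ => (s, z))).aemeasurable
    _ = ∫⁻ s in Ico (0:ℝ) 1, ∫⁻ z, ‖(Ico 0 1).indicator (fun s => u' s z) s‖ₑ ^ 2 ∂P := by
        rw [lintegral_lintegral_swap]
        exact ((hM.comp measurable_swap).pow_const 2).aemeasurable
    _ ≤ ∫⁻ s in Ico (0:ℝ) 1, B := by
        refine setLIntegral_mono measurable_const fun s hs => ?_
        simp only [indicator_of_mem hs]
        exact hB s (Ico_subset_Icc_self hs)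
    _ = _ := by simp

/-- If the mean of a twice differentiable random curve is stationary at `0`, its increment has a
mean of second order. -/
theorem norm_integral_curve_sub_le {u'' : ℝ → 𝒵 → Param d} {G : ℝ → Param d}
    (hd : ∀ t ∈ Icc (0:ℝ) 1, ∀ z, HasDerivAt (fun s => u s z) (u' t z) t)
    (hd' : ∀ t ∈ Icc (0:ℝ) 1, ∀ z, HasDerivAt (fun s => u' s z) (u'' t z) t)
    (hint : ∀ t ∈ Icc (0:ℝ) 1, Integrable (u t) P) (hm : ∀ t ∈ Icc (0:ℝ) 1, Measurable (u t))
    (hint' : Integrable (u' 0) P) {C : ℝ} (hC : 0 ≤ C)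
    (hB : ∀ t ∈ Icc (0:ℝ) 1, ∫⁻ z, ‖u'' t z‖ₑ ∂P ≤ ENNReal.ofReal C)
    (hG : HasDerivAt G 0 0) (hGu : ∀ t ∈ Icc (0:ℝ) 1, G t = ∫ z, u t z ∂P) :
    ‖∫ z, u 1 z - u 0 z ∂P‖ ≤ C := by
  have hm' : ∀ t ∈ Icc (0:ℝ) 1, Measurable (u' t) := fun t ht =>
    measurable_curve_deriv one_pos hd hm ht
  -- The bound on the second derivative controls the drift of the first; the same argument applied
  -- to the curve minus its tangent at 0 gives the quadratic estimate that follows.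
  have h1 : ∀ t ∈ Icc (0:ℝ) 1, ∫⁻ z, ‖u' t z - u' 0 z‖ₑ ∂P ≤ ENNReal.ofReal (t * C) := by
    intro t ht
    rcases ht.1.eq_or_lt with h0 | h0
    · rw [← h0]; simp
    have hsub : ∀ {x}, x ∈ Icc 0 t → x ∈ Icc (0:ℝ) 1 := fun hx => ⟨hx.1, hx.2.trans ht.2⟩
    refine (lintegral_curve_sub_le h0 (fun s hs => hd' s (hsub hs)) (fun s hs => hm' s (hsub hs))
      fun s hs => hB s (hsub hs)).trans ?_
    rw [ENNReal.ofReal_mul ht.1]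
  have h2 : ∀ t ∈ Ioc (0:ℝ) 1,
      ‖(∫ z, u t z - u 0 z ∂P) - t • ∫ z, u' 0 z ∂P‖ ≤ t * (t * C) := by
    intro t ht
    have hsub : ∀ {x}, x ∈ Icc 0 t → x ∈ Icc (0:ℝ) 1 := fun hx => ⟨hx.1, hx.2.trans ht.2⟩
    have := lintegral_curve_sub_le (P := P) (u := fun s z => u s z - s • u' 0 z)
      (u' := fun s z => u' s z - u' 0 z) ht.1
      (fun s hs z => by
        simpa using! (hd s (hsub hs) z).sub ((hasDerivAt_id s).smul_const (u' 0 z)))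
      (fun s hs => (hm s (hsub hs)).sub ((hm' 0 (by simp)).const_smul s))
      (B := ENNReal.ofReal (t * C))
      (fun s hs => (h1 s (hsub hs)).trans
        (ENNReal.ofReal_le_ofReal (mul_le_mul_of_nonneg_right hs.2 hC)))
    have hsm : Integrable (fun z => t • u' 0 z) P := hint'.smul t
    have hsb : Integrable (fun z => u t z - u 0 z) P :=
      (hint t (Ioc_subset_Icc_self ht)).sub (hint 0 (by simp))
    rw [← integral_smul, ← integral_sub hsb hsm]
    rw [← ENNReal.ofReal_mul ht.1.le] at this
    have h3 := (enorm_integral_le_lintegral_enorm (μ := P)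
      (fun z => u t z - u 0 z - t • u' 0 z)).trans (by
        refine (le_of_eq ?_).trans this
        refine lintegral_congr fun z => ?_
        congr 1
        simp only [zero_smul, sub_zero]
        abel)
    rw [← ofReal_norm] at h3
    exact (ENNReal.ofReal_le_ofReal_iff (mul_nonneg ht.1.le (mul_nonneg ht.1.le hC))).1 h3
  -- The quadratic estimate shows that the right difference quotients of G converge to the mean of
  -- the derivative at 0, which must then be G'(0) = 0. This replaces a differentiation under the
  -- integral.
  have h4 : ∫ z, u' 0 z ∂P = 0 := by
    have hlim : Tendsto (fun t : ℝ => t⁻¹ • (G t - G 0)) (𝓝[>] 0) (𝓝 0) := by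
      have := hG.tendsto_slope_zero_right
      simpa using this
    have hlim2 : Tendsto (fun t : ℝ => t⁻¹ • (G t - G 0)) (𝓝[>] 0) (𝓝 (∫ z, u' 0 z ∂P)) := by
      rw [tendsto_iff_norm_sub_tendsto_zero]
      refine squeeze_zero' (g := fun t => t * C) (Eventually.of_forall fun t => norm_nonneg _) ?_ ?_
      · filter_upwards [Ioc_mem_nhdsGT (one_pos (α := ℝ))] with t ht
        have h5 := h2 t ht
        rw [integral_sub (hint t (Ioc_subset_Icc_self ht)) (hint 0 (by simp)),
          ← hGu t (Ioc_subset_Icc_self ht), ← hGu 0 (by simp)] at h5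
        have h6 : t⁻¹ • (G t - G 0) - ∫ z, u' 0 z ∂P
            = t⁻¹ • ((G t - G 0) - t • ∫ z, u' 0 z ∂P) := by
          rw [smul_sub t⁻¹ _ (t • _), smul_smul, inv_mul_cancel₀ ht.1.ne', one_smul]
        rw [h6, norm_smul, norm_inv, Real.norm_eq_abs, abs_of_pos ht.1,
          inv_mul_le_iff₀ ht.1]
        exact h5
      · have : Tendsto (fun t : ℝ => t * C) (𝓝 0) (𝓝 (0 * C)) :=
          (continuous_id.mul continuous_const).tendsto 0
        rw [zero_mul] at this
        exact this.mono_left nhdsWithin_le_nhds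
    exact tendsto_nhds_unique hlim2 hlim
  have h7 := h2 1 (by simp)
  rw [h4] at h7
  simpa using h7

end Curve

end Multitask

namespace Multitask

/-! ### Gradients and Hessians of random convex functions -/

section Calculus

variable {d : ℕ}

theorem TwiceDiffAt.hasGradientAt {g : Param d → ℝ} {x : Param d} (h : TwiceDiffAt g x) :
    HasGradientAt g (gradient g x) x := h.1.hasGradientAt

theorem TwiceDiffAt.hasFDerivAt {g : Param d → ℝ} {x : Param d} (h : TwiceDiffAt g x) :
    HasFDerivAt (gradient g) (hess g x) x := h.2.hasFDerivAt

theorem inner_hess_comm {g : Param d → ℝ} {x : Param d} (h : ∀ᶠ y in 𝓝 x, TwiceDiffAt g y)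
    (v w : Param d) : inner ℝ (hess g x v) w = inner ℝ (hess g x w) v := by
  have h1 : ∀ᶠ y in 𝓝 x, HasFDerivAt g (innerSL ℝ (gradient g y)) y := by
    filter_upwards [h] with y hy using hy.hasGradientAt.hasFDerivAt
  have h2 : HasFDerivAt (fun y => innerSL ℝ (gradient g y)) ((innerSL ℝ).comp (hess g x)) x :=
    (innerSL ℝ : Param d →L[ℝ] Param d →L[ℝ] ℝ).hasFDerivAt.comp x h.self_of_nhds.hasFDerivAt
  exact second_derivative_symmetric_of_eventually_of_real h1 h2 v w

theorem clm_eq_sum_smulRight (A : Param d →L[ℝ] Param d) :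
    A = ∑ b, ContinuousLinearMap.smulRightL ℝ (Param d) (Param d)
      (EuclideanSpace.proj b) (A (EuclideanSpace.single b 1)) := by
  ext1 v
  rw [sum_apply]
  have hv : v = ∑ b, v b • EuclideanSpace.single b (1:ℝ) := by
    ext a
    simp [Finset.sum_apply, Pi.single_apply]
  conv_lhs => rw [hv, map_sum]
  refine Finset.sum_congr rfl fun b _ => ?_
  simp

theorem norm_clm_le_sum (A : Param d →L[ℝ] Param d) :
    ‖A‖ ≤ ∑ b, ‖A (EuclideanSpace.single b 1)‖ := by
  conv_lhs => rw [clm_eq_sum_smulRight A]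
  refine (norm_sum_le _ _).trans (Finset.sum_le_sum fun b _ => ?_)
  refine ContinuousLinearMap.opNorm_le_bound _ (norm_nonneg _) fun v => ?_
  change ‖v b • A (EuclideanSpace.single b 1)‖ ≤ _
  rw [norm_smul, mul_comm]
  gcongr
  exact PiLp.norm_apply_le v b

theorem norm_le_sum_abs (x : Param d) : ‖x‖ ≤ ∑ a, |x a| := by
  have hv : x = ∑ b, x b • EuclideanSpace.single b (1:ℝ) := by
    ext a
    simp [Finset.sum_apply, Pi.single_apply]
  conv_lhs => rw [hv]
  refine (norm_sum_le _ _).trans (Finset.sum_le_sum fun b _ => ?_)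
  simp [norm_smul]

end Calculus

section Measurability

variable {d : ℕ} {𝒵 : Type*} [MeasurableSpace 𝒵]

theorem measurable_param {g : 𝒵 → Param d} (h : ∀ a, Measurable fun z => g z a) : Measurable g :=
  (WithLp.measurable_toLp 2 (Fin d → ℝ)).comp (measurable_pi_lambda (fun z a => g z a) h)

theorem measurable_clm {A : 𝒵 → Param d →L[ℝ] Param d} (h : ∀ v, Measurable fun z => A z v) :
    Measurable A := by
  have : A = fun z => ∑ b, ContinuousLinearMap.smulRightL ℝ (Param d) (Param d)
      (EuclideanSpace.proj b) (A z (EuclideanSpace.single b 1)) := by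
    funext z; exact clm_eq_sum_smulRight (A z)
  rw [this]
  exact Finset.measurable_sum _ fun b _ =>
    (ContinuousLinearMap.continuous _).measurable.comp (h _)

theorem tendsto_quotient_line {F : Type*} [NormedAddCommGroup F] [NormedSpace ℝ F]
    {g : Param d → F} {g' : Param d →L[ℝ] F} {x : Param d} (h : HasFDerivAt g g' x)
    (v : Param d) (s : ℝ) (hs : s ≠ 0) : Tendsto (fun n : ℕ => (s / (n + 1))⁻¹ • (g (x + (s / (n + 1)) • v) - g x))
      atTop (𝓝 (g' v)) := by
  have h0 : HasDerivAt (fun t : ℝ => x + t • v) v 0 := by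
    simpa using ((hasDerivAt_id (0:ℝ)).smul_const v).const_add x
  have h1 : HasDerivAt (fun t : ℝ => g (x + t • v)) (g' v) 0 := by
    have h2 : HasFDerivAt g g' (x + (0:ℝ) • v) := by simpa using h
    simpa [Function.comp_def] using! h2.comp_hasDerivAt (0:ℝ) h0
  have h2 : Tendsto (fun n : ℕ => s / ((n:ℝ) + 1)) atTop (𝓝[≠] 0) := by
    rw [tendsto_nhdsWithin_iff]
    refine ⟨(tendsto_const_nhds (x := s)).div_atTop
        (tendsto_natCast_atTop_atTop.atTop_add (tendsto_const_nhds (x := (1:ℝ)))), ?_⟩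
    exact Eventually.of_forall fun n => div_ne_zero hs (by positivity)
  refine ((hasDerivAt_iff_tendsto_slope.1 h1).comp h2).congr fun n => ?_
  simp [slope_def_module]

theorem measurable_gradient {ℓ : Param d → 𝒵 → ℝ} (hm : ∀ x, Measurable (ℓ x)) {x : Param d}
    (hd : ∀ z, DifferentiableAt ℝ (fun y => ℓ y z) x) :
    Measurable fun z => gradient (fun y => ℓ y z) x := by
  refine measurable_param fun a => ?_
  refine measurable_of_tendsto_metrizable (f := fun (n : ℕ) z =>
    ((1:ℝ) / (n + 1))⁻¹ • (ℓ (x + ((1:ℝ) / (n + 1)) • EuclideanSpace.single a 1) z - ℓ x z))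
    (fun n => ((hm (x + ((1:ℝ) / (n + 1)) • EuclideanSpace.single a 1)).sub (hm x)).const_smul
      (((1:ℝ) / (n + 1))⁻¹)) (tendsto_pi_nhds.2 fun z => ?_)
  have := tendsto_quotient_line (hd z).hasGradientAt.hasFDerivAt (EuclideanSpace.single a (1:ℝ)) 1
    one_ne_zero
  have e : (InnerProductSpace.toDual ℝ (Param d) (gradient (fun y => ℓ y z) x))
      (EuclideanSpace.single a (1:ℝ)) = gradient (fun y => ℓ y z) x a := by
    rw [InnerProductSpace.toDual_apply_apply, EuclideanSpace.inner_single_right]; simp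
  rw [e] at this
  exact this

theorem measurable_hess {ℓ : Param d → 𝒵 → ℝ} (hm : ∀ x, Measurable (ℓ x)) {x : Param d} {M : ℝ}
    (hM : 0 < M) (hd : ∀ y, ‖y - x‖ ≤ M → ∀ z, TwiceDiffAt (fun y => ℓ y z) y) :
    Measurable fun z => hess (fun y => ℓ y z) x := by
  refine measurable_clm fun v => ?_
  -- The scale s keeps all the points x + (s/(n+1)) v in the ball where the gradient is known to
  -- exist.
  obtain ⟨s, hs, hsv⟩ : ∃ s : ℝ, 0 < s ∧ s * ‖v‖ ≤ M :=
    ⟨M / (‖v‖ + 1), by positivity, by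
      rw [div_mul_eq_mul_div, div_le_iff₀ (by positivity)]; nlinarith [norm_nonneg v]⟩
  refine measurable_of_tendsto_metrizable (f := fun (n : ℕ) z => (s / (n + 1))⁻¹ •
    (gradient (fun y => ℓ y z) (x + (s / (n + 1)) • v) - gradient (fun y => ℓ y z) x))
    (fun n => ?_) (tendsto_pi_nhds.2 fun z =>
      tendsto_quotient_line (hd x (by simp [hM.le]) z).hasFDerivAt v s hs.ne')
  refine Measurable.const_smul (Measurable.sub (measurable_gradient hm fun z => (hd _ ?_ z).1)
    (measurable_gradient hm fun z => (hd _ (by simp [hM.le]) z).1)) ((s / (n + 1))⁻¹ : ℝ)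
  rw [add_sub_cancel_left, norm_smul, Real.norm_eq_abs, abs_of_pos (by positivity)]
  refine le_trans ?_ hsv
  gcongr
  exact div_le_self hs.le (by linarith [n.cast_nonneg (α := ℝ)])

end Measurability

section Interchange

variable {d : ℕ} {𝒵 : Type*} [MeasurableSpace 𝒵] {P : Measure 𝒵}

/-- A random function which is convex and twice differentiable near `x₀`, with an integrable bound
on its Hessian. -/
structure RandomConvex (P : Measure 𝒵) (ℓ : Param d → 𝒵 → ℝ) (x₀ : Param d) (M : ℝ) (B : 𝒵 → ℝ) :
    Prop where
  pos : 0 < M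
  meas : ∀ x, Measurable (ℓ x)
  convex : ∀ z, ConvexOn ℝ univ fun x => ℓ x z
  smooth : ∀ x, ‖x - x₀‖ ≤ M → ∀ z, TwiceDiffAt (fun y => ℓ y z) x
  integrable : ∀ x, ‖x - x₀‖ ≤ M → Integrable (ℓ x) P
  integrable_bound : Integrable B P
  hess_le : ∀ᵐ z ∂P, ∀ x, ‖x - x₀‖ ≤ M → ‖hess (fun y => ℓ y z) x‖ ≤ B z

namespace RandomConvex

variable {ℓ : Param d → 𝒵 → ℝ} {x₀ : Param d} {M : ℝ} {B : 𝒵 → ℝ}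

theorem measurable_gradient (h : RandomConvex P ℓ x₀ M B) {x : Param d} (hx : ‖x - x₀‖ ≤ M) :
    Measurable fun z => gradient (fun y => ℓ y z) x :=
  Multitask.measurable_gradient h.meas fun z => (h.smooth x hx z).1

/-- By convexity a partial derivative lies between the backward and the forward difference
quotients, whose steps ±s stay in the ball. Integrability of the gradient therefore follows from
that of the losses and is not an extra assumption. -/
theorem integrable_gradient (h : RandomConvex P ℓ x₀ M B) {x : Param d} (hx : ‖x - x₀‖ < M) :
    Integrable (fun z => gradient (fun y => ℓ y z) x) P := by
  set s := M - ‖x - x₀‖ with hs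
  have hs0 : 0 < s := sub_pos.2 hx
  have hball : ∀ a : Fin d, ∀ t : ℝ, |t| = s →
      ‖x + t • EuclideanSpace.single a (1:ℝ) - x₀‖ ≤ M := fun a t ht => by
    have : x + t • EuclideanSpace.single a (1:ℝ) - x₀
      = (x - x₀) + t • EuclideanSpace.single a (1:ℝ) := by abel
    rw [this]
    refine (norm_add_le _ _).trans ?_
    rw [norm_smul, Real.norm_eq_abs, ht]
    simp [hs]
  have habs : |s| = s := abs_of_pos hs0
  have hb : Integrable (fun z => ∑ a : Fin d, s⁻¹ *
      (|ℓ (x + s • EuclideanSpace.single a (1:ℝ)) z - ℓ x z|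
        + |ℓ (x + (-s) • EuclideanSpace.single a (1:ℝ)) z - ℓ x z|)) P := by
    refine integrable_finsetSum _ fun a _ => Integrable.const_mul (Integrable.add ?_ ?_) _
    · exact ((h.integrable _ (hball a s habs)).sub (h.integrable x hx.le)).abs
    · exact ((h.integrable _ (hball a (-s) (by rw [abs_neg, habs]))).sub
        (h.integrable x hx.le)).abs
  refine hb.mono' (h.measurable_gradient hx.le).aestronglyMeasurable
    (Eventually.of_forall fun z => (norm_le_sum_abs _).trans (Finset.sum_le_sum fun a _ => ?_))
  have hg := (h.smooth x hx.le z).hasGradientAt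
  have h1 := (h.convex z).add_inner_le hg (x + s • EuclideanSpace.single a (1:ℝ))
  have h2 := (h.convex z).add_inner_le hg (x + (-s) • EuclideanSpace.single a (1:ℝ))
  rw [add_sub_cancel_left, inner_smul_right] at h1 h2
  have e : (inner ℝ (gradient (fun y => ℓ y z) x) (EuclideanSpace.single a (1:ℝ)) : ℝ)
      = gradient (fun y => ℓ y z) x a := by
    rw [EuclideanSpace.inner_single_right]; simp
  rw [e] at h1 h2
  rw [inv_mul_eq_div, le_div_iff₀ hs0, ← abs_of_pos hs0, ← abs_mul, abs_of_pos hs0, abs_le]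
  have l1 := le_abs_self (ℓ (x + s • EuclideanSpace.single a (1:ℝ)) z - ℓ x z)
  have l2 := le_abs_self (ℓ (x + (-s) • EuclideanSpace.single a (1:ℝ)) z - ℓ x z)
  have l3 := abs_nonneg (ℓ (x + s • EuclideanSpace.single a (1:ℝ)) z - ℓ x z)
  have l4 := abs_nonneg (ℓ (x + (-s) • EuclideanSpace.single a (1:ℝ)) z - ℓ x z)
  constructor <;> linarith

theorem norm_gradient_sub_le (h : RandomConvex P ℓ x₀ M B) : ∀ᵐ z ∂P, ∀ x y,
    ‖x - x₀‖ ≤ M → ‖y - x₀‖ ≤ M →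
      ‖gradient (fun y => ℓ y z) y - gradient (fun y => ℓ y z) x‖ ≤ B z * ‖y - x‖ := by
  filter_upwards [h.hess_le] with z hz x y hx hy
  exact (convex_closedBall x₀ M).norm_image_sub_le_of_norm_hasFDerivWithin_le
    (fun w hw => (h.smooth w (by rwa [mem_closedBall_iff_norm] at hw) z).hasFDerivAt.hasFDerivWithinAt)
    (fun w hw => hz w (by rwa [mem_closedBall_iff_norm] at hw))
    (by rwa [mem_closedBall_iff_norm]) (by rwa [mem_closedBall_iff_norm])

/-- The dominating function is the gradient at x plus the Lipschitz bound of the gradient times the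
diameter 2M of the ball. -/
theorem hasGradientAt_integral (h : RandomConvex P ℓ x₀ M B) {x : Param d} (hx : ‖x - x₀‖ < M) :
    HasGradientAt (fun y => ∫ z, ℓ y z ∂P) (∫ z, gradient (fun y => ℓ y z) x ∂P) x := by
  have hnear : ∀ᶠ y in 𝓝 x, ‖y - x₀‖ < M :=
    (continuous_id.sub continuous_const).norm.continuousAt.eventually_lt continuousAt_const hx
  have hs : {y | ‖y - x₀‖ < M} ∈ 𝓝 x := hnear
  have key := hasFDerivAt_integral_of_dominated_of_fderiv_le (μ := P) (F := ℓ)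
    (F' := fun y z => innerSL ℝ (gradient (fun y => ℓ y z) y))
    (bound := fun z => ‖gradient (fun y => ℓ y z) x‖ + B z * (2 * M)) hs
    (Eventually.of_forall fun y => (h.meas y).aestronglyMeasurable) (h.integrable x hx.le)
    ((innerSL ℝ).continuous.comp_aestronglyMeasurable
      (h.measurable_gradient hx.le).aestronglyMeasurable)
    (by
      filter_upwards [h.norm_gradient_sub_le, h.hess_le] with z hz hz' y hy
      have hB : 0 ≤ B z := (norm_nonneg _).trans (hz' x hx.le)
      rw [innerSL_apply_norm]
      have h1 := hz x y hx.le (le_of_lt hy)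
      have h2 : ‖y - x‖ ≤ 2 * M := by
        have : y - x = (y - x₀) - (x - x₀) := by abel
        rw [this]
        refine (norm_sub_le _ _).trans ?_
        have : ‖y - x₀‖ < M := hy
        linarith
      have h3 : gradient (fun y => ℓ y z) y = gradient (fun y => ℓ y z) x
        + (gradient (fun y => ℓ y z) y - gradient (fun y => ℓ y z) x) := by abel
      rw [h3]
      refine (norm_add_le _ _).trans (add_le_add le_rfl (h1.trans ?_))
      gcongr)
    ((h.integrable_gradient hx).norm.add (h.integrable_bound.mul_const _))
    (Eventually.of_forall fun z y hy =>
      (h.smooth y (le_of_lt hy) z).hasGradientAt.hasFDerivAt)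
  rw [hasGradientAt_iff_hasFDerivAt]
  rw [(innerSL ℝ : Param d →L[ℝ] Param d →L[ℝ] ℝ).integral_comp_comm
    (h.integrable_gradient hx)] at key
  exact key

theorem measurable_hess (h : RandomConvex P ℓ x₀ M B) :
    Measurable fun z => hess (fun y => ℓ y z) x₀ :=
  Multitask.measurable_hess h.meas h.pos h.smooth

/-- The gradient is Lipschitz with the integrable constant `B`, which dominates its difference
quotients; near x₀ the gradient of the integral is the integral of the gradients, so this can be
differentiated once more. -/
theorem hess_integral (h : RandomConvex P ℓ x₀ M B) :
    hess (fun y => ∫ z, ℓ y z ∂P) x₀ = ∫ z, hess (fun y => ℓ y z) x₀ ∂P := by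
  have hs : Metric.ball x₀ M ∈ 𝓝 x₀ := Metric.ball_mem_nhds x₀ h.pos
  have hball : ∀ {y}, y ∈ Metric.ball x₀ M → ‖y - x₀‖ < M := fun hy => by
    rwa [mem_ball_iff_norm] at hy
  have hx₀ : ‖x₀ - x₀‖ < M := by simp [h.pos]
  have key := (hasFDerivAt_integral_of_dominated_loc_of_lip' (μ := P)
    (F := fun y z => gradient (fun y => ℓ y z) y) (F' := fun z => hess (fun y => ℓ y z) x₀)
    (bound := B) hs
    (fun y hy => (h.measurable_gradient (hball hy).le).aestronglyMeasurable)
    (h.integrable_gradient hx₀) h.measurable_hess.aestronglyMeasurable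
    (by
      filter_upwards [h.norm_gradient_sub_le] with z hz y hy
      exact hz x₀ y hx₀.le (hball hy).le)
    h.integrable_bound
    (Eventually.of_forall fun z => (h.smooth x₀ hx₀.le z).hasFDerivAt)).2
  rw [hess, ← key.fderiv]
  refine Filter.EventuallyEq.fderiv_eq ?_
  filter_upwards [hs] with y hy using (h.hasGradientAt_integral (hball hy)).gradient

end RandomConvex

end Interchange

end Multitask

namespace Multitask

/-! ### Moments of the Hessians of a single task -/

theorem integrable_of_lintegral_sq {𝒵 : Type*} [MeasurableSpace 𝒵] {P : Measure 𝒵}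
    [IsProbabilityMeasure P] {E : Type*} [NormedAddCommGroup E] {g : 𝒵 → E}
    (hm : AEStronglyMeasurable g P) {C : ℝ} (h : ∫⁻ z, ‖g z‖ₑ ^ 2 ∂P ≤ ENNReal.ofReal C) :
    MemLp g 2 P := by
  refine ⟨hm, ?_⟩
  rw [eLpNorm_lt_top_iff_lintegral_rpow_enorm_lt_top (by norm_num) (by norm_num)]
  simpa using h.trans_lt ENNReal.ofReal_lt_top

theorem integral_norm_sq_le_of_lintegral {𝒵 : Type*} [MeasurableSpace 𝒵] {P : Measure 𝒵}
    {E : Type*} [NormedAddCommGroup E] {g : 𝒵 → E}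
    (hm : AEStronglyMeasurable g P) {C : ℝ} (hC : 0 ≤ C)
    (h : ∫⁻ z, ‖g z‖ₑ ^ 2 ∂P ≤ ENNReal.ofReal C) : ∫ z, ‖g z‖ ^ 2 ∂P ≤ C := by
  rw [integral_eq_lintegral_of_nonneg_ae (f := fun z => ‖g z‖ ^ 2) (Eventually.of_forall fun z => by positivity)
    (hm.norm.pow 2)]
  refine ENNReal.toReal_le_of_le_ofReal hC ((le_of_eq ?_).trans h)
  refine lintegral_congr fun z => ?_
  rw [ENNReal.ofReal_pow (norm_nonneg _), ofReal_norm]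

/-- Moments of order `r ≥ 2` control second moments. -/
theorem lintegral_sq_le_of_rpow {𝒵 : Type*} [MeasurableSpace 𝒵] {P : Measure 𝒵}
    [IsProbabilityMeasure P] {E : Type*} [NormedAddCommGroup E] {g : 𝒵 → E} {r C : ℝ} (hr : 2 ≤ r)
    (hC : 0 ≤ C) (h : ∫⁻ z, ‖g z‖ₑ ^ r ∂P ≤ ENNReal.ofReal C) :
    ∫⁻ z, ‖g z‖ₑ ^ 2 ∂P ≤ ENNReal.ofReal (1 + C) := by
  calc _ ≤ ∫⁻ z, (1 + ‖g z‖ₑ ^ r) ∂P := by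
        refine lintegral_mono fun z => ?_
        have := sq_le_one_add_rpow hr (norm_nonneg (g z))
        have h2 := ENNReal.ofReal_le_ofReal this
        rw [ENNReal.ofReal_add zero_le_one (by positivity), ENNReal.ofReal_one,
          ENNReal.ofReal_pow (norm_nonneg _), ← ENNReal.ofReal_rpow_of_nonneg (norm_nonneg _)
          (by linarith), ofReal_norm] at h2
        exact h2
    _ = 1 + ∫⁻ z, ‖g z‖ₑ ^ r ∂P := by
        rw [lintegral_add_left measurable_const]; simp
    _ ≤ _ := by
        rw [ENNReal.ofReal_add zero_le_one hC, ENNReal.ofReal_one]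
        gcongr

section Quadratic

variable {d : ℕ}

/-- Polarization. -/
theorem inner_single_eq_polarization {A : Param d →L[ℝ] Param d}
    (hA : ∀ v w, (inner ℝ (A v) w : ℝ) = inner ℝ (A w) v) (a b : Fin d) :
    (A (EuclideanSpace.single b 1)) a
      = (1 / 2) * ((inner ℝ (EuclideanSpace.single a (1:ℝ) + EuclideanSpace.single b 1)
          (A (EuclideanSpace.single a 1 + EuclideanSpace.single b 1)) : ℝ)
        - inner ℝ (EuclideanSpace.single a (1:ℝ)) (A (EuclideanSpace.single a 1))
        - inner ℝ (EuclideanSpace.single b (1:ℝ)) (A (EuclideanSpace.single b 1))) := by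
  have e : (A (EuclideanSpace.single b 1)) a
      = (inner ℝ (EuclideanSpace.single a (1:ℝ)) (A (EuclideanSpace.single b 1)) : ℝ) := by
    rw [EuclideanSpace.inner_single_left]; simp
  have h : (inner ℝ (EuclideanSpace.single b (1:ℝ)) (A (EuclideanSpace.single a 1)) : ℝ)
      = inner ℝ (EuclideanSpace.single a (1:ℝ)) (A (EuclideanSpace.single b 1)) := by
    rw [real_inner_comm, hA, real_inner_comm]
  rw [e, map_add, inner_add_left, inner_add_right, inner_add_right, h]
  ring

theorem norm_single_add_single_sq_le (a b : Fin d) :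
    ‖(EuclideanSpace.single a (1:ℝ) + EuclideanSpace.single b 1 : Param d)‖ ^ 2 ≤ 4 := by
  have : ‖(EuclideanSpace.single a (1:ℝ) + EuclideanSpace.single b 1 : Param d)‖ ≤ 2 :=
    (norm_add_le _ _).trans (by simp; norm_num)
  nlinarith [norm_nonneg (EuclideanSpace.single a (1:ℝ) + EuclideanSpace.single b 1 : Param d)]

/-- A quadratic form at `w` as a multiple of its value at a unit vector. -/
theorem exists_unit_quadratic (w : Param d) (hw : w ≠ 0) : ∃ v : Param d, ‖v‖ = 1 ∧
    ∀ A : Param d →L[ℝ] Param d, (inner ℝ w (A w) : ℝ) = ‖w‖ ^ 2 * inner ℝ v (A v) := by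
  have hw' : ‖w‖ ≠ 0 := norm_ne_zero_iff.2 hw
  refine ⟨‖w‖⁻¹ • w, by rw [norm_smul, norm_inv, norm_norm, inv_mul_cancel₀ hw'], fun A => ?_⟩
  rw [map_smul, inner_smul_left, inner_smul_right]
  simp
  field_simp

end Quadratic

namespace Model

variable {d : ℕ} {X : Model d}

/-- Measurable envelopes of the Lipschitz constants of the Hessians. -/
structure HessEnvelope (X : Model d) (M σ₃ : ℝ) (L : ∀ j, X.Obs j → ℝ≥0∞) : Prop where
  meas : ∀ j, Measurable (L j)
  lintegral_le : ∀ j, ∫⁻ z, L j z ∂(X.P j) ≤ ENNReal.ofReal σ₃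
  bound : ∀ j z θ θ' η η', ‖θ - X.θs j‖ ≤ M → ‖θ' - X.θs j‖ ≤ M →
      ‖η - X.ηs j‖ ≤ M → ‖η' - X.ηs j‖ ≤ M →
      ‖X.lossHess j θ η z - X.lossHess j θ' η' z‖ₑ ≤ L j z * (‖θ - θ'‖ₑ + ‖η - η'‖ₑ)

theorem LossRegular.exists_envelope {M ρ κ r₁ r₂ σ₁ σ₂ σ₃ σ₅ : ℝ}
    (h : X.LossRegular M ρ κ r₁ r₂ σ₁ σ₂ σ₃ σ₅) : ∃ L, X.HessEnvelope M σ₃ L := by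
  choose L hm hi hb using h.hess_lipschitz
  exact ⟨L, hm, hi, hb⟩

namespace HessEnvelope

variable {M σ₃ : ℝ} {L : ∀ j, X.Obs j → ℝ≥0∞}

theorem integrable (h : X.HessEnvelope M σ₃ L) (j : Fin X.m) :
    Integrable (fun z => (L j z).toReal) (X.P j) :=
  integrable_toReal_of_lintegral_ne_top (h.meas j).aemeasurable
    ((h.lintegral_le j).trans_lt ENNReal.ofReal_lt_top).ne

theorem ae_lt_top (h : X.HessEnvelope M σ₃ L) (j : Fin X.m) : ∀ᵐ z ∂(X.P j), L j z < ∞ :=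
  MeasureTheory.ae_lt_top (h.meas j) ((h.lintegral_le j).trans_lt ENNReal.ofReal_lt_top).ne

theorem norm_sub_le (h : X.HessEnvelope M σ₃ L) {j : Fin X.m} {z : X.Obs j} (hz : L j z < ∞)
    {θ θ' : Param d} {η η' : X.Nuis j} (h1 : ‖θ - X.θs j‖ ≤ M) (h2 : ‖θ' - X.θs j‖ ≤ M)
    (h3 : ‖η - X.ηs j‖ ≤ M) (h4 : ‖η' - X.ηs j‖ ≤ M) :
    ‖X.lossHess j θ η z - X.lossHess j θ' η' z‖
      ≤ (L j z).toReal * (‖θ - θ'‖ + ‖η - η'‖) := by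
  have := h.bound j z θ θ' η η' h1 h2 h3 h4
  rw [← ofReal_norm, ← ofReal_norm, ← ofReal_norm, ← ENNReal.ofReal_add (norm_nonneg _)
    (norm_nonneg _), ← ENNReal.ofReal_toReal hz.ne, ← ENNReal.ofReal_mul ENNReal.toReal_nonneg,
    ENNReal.ofReal_le_ofReal_iff (by positivity)] at this
  exact this

end HessEnvelope

theorem Sampling.measurable_loss_segment (h : X.Sampling) (j : Fin X.m) (y : X.Train j) (θ : Param d)
    {t : ℝ} (ht : t ∈ Icc (0:ℝ) 1) : Measurable (X.loss j θ (X.ηs j + t • (X.fit j y - X.ηs j))) :=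
  (h.measurable_loss j θ t ht).comp (measurable_prodMk_left (x := y))

theorem nonempty_train (X : Model d) (j : Fin X.m) : Nonempty (X.Train j) := by
  have : Nonempty X.Ω := nonempty_of_isProbabilityMeasure X.μ
  exact ⟨X.Y j (Classical.arbitrary _)⟩

theorem Sampling.measurable_loss_truth (h : X.Sampling) (j : Fin X.m) (θ : Param d) :
    Measurable (X.loss j θ (X.ηs j)) := by
  obtain ⟨y⟩ := X.nonempty_train j
  simpa using h.measurable_loss_segment j y θ (t := 0) (by simp)

section Task

variable {M ρ κ r₁ r₂ σ₁ σ₂ σ₃ σ₅ : ℝ} {L : ∀ j, X.Obs j → ℝ≥0∞}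

theorem measurable_lossHess (hM : 0 < M) (hS : X.Sampling)
    (hR : X.LossRegular M ρ κ r₁ r₂ σ₁ σ₂ σ₃ σ₅) (j : Fin X.m) :
    Measurable (X.lossHess j (X.θs j) (X.ηs j)) :=
  measurable_hess (hS.measurable_loss_truth j) hM fun y hy z =>
    hR.smooth j y (X.ηs j) hy (by simp [hM.le]) z

theorem lossHess_symm (hM : 0 < M) (hR : X.LossRegular M ρ κ r₁ r₂ σ₁ σ₂ σ₃ σ₅) (j : Fin X.m)
    (z : X.Obs j) (v w : Param d) :
    (inner ℝ (X.lossHess j (X.θs j) (X.ηs j) z v) w : ℝ)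
      = inner ℝ (X.lossHess j (X.θs j) (X.ηs j) z w) v := by
  refine inner_hess_comm ?_ v w
  filter_upwards [Metric.ball_mem_nhds (X.θs j) hM] with y hy
  exact hR.smooth j y (X.ηs j) (by rw [mem_ball_iff_norm] at hy; exact hy.le) (by simp [hM.le]) z

theorem integral_quadratic_sq_le (hM : 0 < M) (hr₂ : 2 < r₂) (hσ₂ : 0 < σ₂)
    (hR : X.LossRegular M ρ κ r₁ r₂ σ₁ σ₂ σ₃ σ₅) (j : Fin X.m) {v : Param d} (hv : ‖v‖ = 1) :
    ∫⁻ z, ‖(inner ℝ v ((X.lossHess j (X.θs j) (X.ηs j) z - X.riskHess j (X.θs j)) v) : ℝ)‖ₑ ^ 2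
      ∂(X.P j) ≤ ENNReal.ofReal (1 + σ₂) :=
  lintegral_sq_le_of_rpow hr₂.le hσ₂.le (hR.hess_moment j (X.θs j) (by simp [hM.le]) v hv)

/-- Homogeneity extends the assumption from unit vectors to all vectors; the square of a quadratic
form has degree four. -/
theorem memLp_quadratic (hM : 0 < M) (hr₂ : 2 < r₂) (hσ₂ : 0 < σ₂) (hS : X.Sampling)
    (hR : X.LossRegular M ρ κ r₁ r₂ σ₁ σ₂ σ₃ σ₅) (j : Fin X.m) (w : Param d) :
    MemLp (fun z => (inner ℝ w ((X.lossHess j (X.θs j) (X.ηs j) z - X.riskHess j (X.θs j)) w) : ℝ))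
      2 (X.P j) ∧
    ∫ z, (inner ℝ w ((X.lossHess j (X.θs j) (X.ηs j) z - X.riskHess j (X.θs j)) w) : ℝ) ^ 2 ∂(X.P j)
      ≤ ‖w‖ ^ 4 * (1 + σ₂) := by
  rcases eq_or_ne w 0 with h0 | h0
  · subst h0
    simp
  obtain ⟨v, hv, hq⟩ := exists_unit_quadratic w h0
  have hA := measurable_lossHess hM hS hR j
  have hm : Measurable fun z =>
      (inner ℝ v ((X.lossHess j (X.θs j) (X.ηs j) z - X.riskHess j (X.θs j)) v) : ℝ) := by
    have h1 : Continuous fun A : Param d →L[ℝ] Param d =>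
      (inner ℝ v ((A - X.riskHess j (X.θs j)) v) : ℝ) := by fun_prop
    exact h1.measurable.comp hA
  have hb := integral_quadratic_sq_le hM hr₂ hσ₂ hR j hv
  simp_rw [hq]
  refine ⟨(integrable_of_lintegral_sq hm.aestronglyMeasurable hb).const_mul _, ?_⟩
  have := integral_norm_sq_le_of_lintegral hm.aestronglyMeasurable (by linarith) hb
  simp_rw [mul_pow, integral_const_mul]
  simp only [Real.norm_eq_abs, sq_abs] at this
  calc _ ≤ (‖w‖ ^ 2) ^ 2 * (1 + σ₂) := by gcongr
    _ = _ := by ring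

/-- The assumptions control only quadratic forms of the Hessian; since Hessians are symmetric,
polarization recovers all the entries. -/
theorem integrable_lossHess (hM : 0 < M) (hr₂ : 2 < r₂) (hσ₂ : 0 < σ₂) (hS : X.Sampling)
    (hR : X.LossRegular M ρ κ r₁ r₂ σ₁ σ₂ σ₃ σ₅) (j : Fin X.m) :
    Integrable (X.lossHess j (X.θs j) (X.ηs j)) (X.P j) := by
  have hA := measurable_lossHess hM hS hR j
  have hq : ∀ w : Param d, Integrable
      (fun z => (inner ℝ w (X.lossHess j (X.θs j) (X.ηs j) z w) : ℝ)) (X.P j) := fun w => by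
    have h1 := ((memLp_quadratic hM hr₂ hσ₂ hS hR j w).1.integrable (by norm_num)).add
      (integrable_const (inner ℝ w (X.riskHess j (X.θs j) w) : ℝ))
    refine h1.congr (Eventually.of_forall fun z => ?_)
    simp [inner_sub_right]
  have hent : ∀ a b : Fin d, Integrable
      (fun z => X.lossHess j (X.θs j) (X.ηs j) z (EuclideanSpace.single b 1) a) (X.P j) := by
    intro a b
    simp_rw [inner_single_eq_polarization (lossHess_symm hM hR j _)]
    exact (((hq _).sub (hq _)).sub (hq _)).const_mul _
  refine (integrable_finsetSum Finset.univ fun b _ => integrable_finsetSum Finset.univ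
    fun a _ => (hent a b).abs).mono' hA.aestronglyMeasurable (Eventually.of_forall fun z => ?_)
  exact (norm_clm_le_sum _).trans (Finset.sum_le_sum fun b _ => norm_le_sum_abs _)

/-- The loss at a nuisance in the ball of radius `M`, as a random convex function. -/
theorem randomConvex_loss (hM : 0 < M) (hr₂ : 2 < r₂) (hσ₂ : 0 < σ₂) (hS : X.Sampling)
    (hR : X.LossRegular M ρ κ r₁ r₂ σ₁ σ₂ σ₃ σ₅) (hL : X.HessEnvelope M σ₃ L) (j : Fin X.m)
    {η : X.Nuis j} (hη : ‖η - X.ηs j‖ ≤ M) (hm : ∀ θ, Measurable (X.loss j θ η)) :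
    RandomConvex (X.P j) (fun θ => X.loss j θ η) (X.θs j) M
      (fun z => ‖X.lossHess j (X.θs j) (X.ηs j) z‖ + (L j z).toReal * (M + M)) where
  pos := hM
  meas := hm
  convex := hR.convex j η hη
  smooth := fun x hx z => hR.smooth j x η hx hη z
  integrable := fun x hx => hR.finite_risk j x η hx hη
  integrable_bound := (integrable_lossHess hM hr₂ hσ₂ hS hR j).norm.add
    ((hL.integrable j).mul_const _)
  hess_le := by
    filter_upwards [hL.ae_lt_top j] with z hz x hx
    have h1 := hL.norm_sub_le hz hx (θ' := X.θs j) (by simp [hM.le]) hη (η' := X.ηs j)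
      (by simp [hM.le])
    have h2 : X.lossHess j x η z = X.lossHess j (X.θs j) (X.ηs j) z
      + (X.lossHess j x η z - X.lossHess j (X.θs j) (X.ηs j) z) := by abel
    change ‖X.lossHess j x η z‖ ≤ _
    rw [h2]
    refine (norm_add_le _ _).trans (add_le_add le_rfl (h1.trans ?_))
    gcongr

theorem randomConvex_loss_truth (hM : 0 < M) (hr₂ : 2 < r₂) (hσ₂ : 0 < σ₂) (hS : X.Sampling)
    (hR : X.LossRegular M ρ κ r₁ r₂ σ₁ σ₂ σ₃ σ₅) (hL : X.HessEnvelope M σ₃ L) (j : Fin X.m) :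
    RandomConvex (X.P j) (fun θ => X.loss j θ (X.ηs j)) (X.θs j) M
      (fun z => ‖X.lossHess j (X.θs j) (X.ηs j) z‖ + (L j z).toReal * (M + M)) :=
  randomConvex_loss hM hr₂ hσ₂ hS hR hL j (by simp [hM.le]) (hS.measurable_loss_truth j)

theorem riskHess_eq_integral (hM : 0 < M) (hr₂ : 2 < r₂) (hσ₂ : 0 < σ₂) (hS : X.Sampling)
    (hR : X.LossRegular M ρ κ r₁ r₂ σ₁ σ₂ σ₃ σ₅) (j : Fin X.m) :
    X.riskHess j (X.θs j) = ∫ z, X.lossHess j (X.θs j) (X.ηs j) z ∂(X.P j) := by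
  obtain ⟨L, hL⟩ := hR.exists_envelope
  exact (randomConvex_loss_truth hM hr₂ hσ₂ hS hR hL j).hess_integral

theorem riskHess_symm (hM : 0 < M) (hr₂ : 2 < r₂) (hσ₂ : 0 < σ₂) (hS : X.Sampling)
    (hR : X.LossRegular M ρ κ r₁ r₂ σ₁ σ₂ σ₃ σ₅) (j : Fin X.m) (v w : Param d) :
    (inner ℝ (X.riskHess j (X.θs j) v) w : ℝ) = inner ℝ (X.riskHess j (X.θs j) w) v := by
  have hi := integrable_lossHess hM hr₂ hσ₂ hS hR j
  have e : ∀ v w : Param d, (inner ℝ (X.riskHess j (X.θs j) v) w : ℝ)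
      = ∫ z, (inner ℝ (X.lossHess j (X.θs j) (X.ηs j) z v) w : ℝ) ∂(X.P j) := fun v w => by
    rw [riskHess_eq_integral hM hr₂ hσ₂ hS hR j, ContinuousLinearMap.integral_apply hi,
      real_inner_comm, ← integral_inner (hi.apply_continuousLinearMap v)]
    simp_rw [real_inner_comm]
  rw [e, e]
  simp_rw [lossHess_symm hM hR j _ v w]

theorem riskHess_entry_le (hM : 0 < M) (hρ : 0 < ρ) (hκ : 0 < κ) (hr₂ : 2 < r₂) (hσ₂ : 0 < σ₂)
    (hS : X.Sampling) (hR : X.LossRegular M ρ κ r₁ r₂ σ₁ σ₂ σ₃ σ₅) (j : Fin X.m) (a b : Fin d) :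
    |X.riskHess j (X.θs j) (EuclideanSpace.single b 1) a| ≤ 3 * κ := by
  have hc := hR.curvature j (X.θs j) (by simp [hM.le])
  rw [inner_single_eq_polarization (riskHess_symm hM hr₂ hσ₂ hS hR j)]
  have h1 := hc (EuclideanSpace.single a (1:ℝ) + EuclideanSpace.single b 1)
  have h2 := hc (EuclideanSpace.single a (1:ℝ))
  have h3 := hc (EuclideanSpace.single b (1:ℝ))
  have h4 := norm_single_add_single_sq_le a b
  have h5 : 0 ≤ ‖(EuclideanSpace.single a (1:ℝ) + EuclideanSpace.single b 1 : Param d)‖ ^ 2 := by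
    positivity
  have h6 := mul_le_mul_of_nonneg_left h4 hκ.le
  have h7 := mul_nonneg hρ.le h5
  simp only [PiLp.norm_single, norm_one, one_pow, mul_one] at h2 h3
  rw [abs_le]
  constructor <;> linarith [h1.1, h1.2, h2.1, h2.2, h3.1, h3.2]

/-- A bound on the second moments of the columns of the centred Hessians. -/
noncomputable def hessVar (d : ℕ) (σ₂ : ℝ) : ℝ := d * (14 * (1 + σ₂))

theorem column_moments (hM : 0 < M) (hr₂ : 2 < r₂) (hσ₂ : 0 < σ₂) (hS : X.Sampling)
    (hR : X.LossRegular M ρ κ r₁ r₂ σ₁ σ₂ σ₃ σ₅) (j : Fin X.m) (b : Fin d) :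
    MemLp (fun z => (X.lossHess j (X.θs j) (X.ηs j) z - X.riskHess j (X.θs j))
      (EuclideanSpace.single b 1)) 2 (X.P j) ∧
    ∫ z, ‖(X.lossHess j (X.θs j) (X.ηs j) z - X.riskHess j (X.θs j))
      (EuclideanSpace.single b 1)‖ ^ 2 ∂(X.P j) ≤ hessVar d σ₂ := by
  set D : X.Obs j → Param d →L[ℝ] Param d :=
    fun z => X.lossHess j (X.θs j) (X.ηs j) z - X.riskHess j (X.θs j) with hD
  have hsymm : ∀ z v w, (inner ℝ (D z v) w : ℝ) = inner ℝ (D z w) v := fun z v w => by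
    simp only [hD, sub_apply, inner_sub_left]
    rw [lossHess_symm hM hR, riskHess_symm hM hr₂ hσ₂ hS hR]
  have hq := fun w => memLp_quadratic hM hr₂ hσ₂ hS hR j w
  have hent : ∀ a, MemLp (fun z => D z (EuclideanSpace.single b 1) a) 2 (X.P j) ∧
      ∫ z, (D z (EuclideanSpace.single b 1) a) ^ 2 ∂(X.P j) ≤ 14 * (1 + σ₂) := by
    intro a
    simp_rw [inner_single_eq_polarization (hsymm _)]
    refine ⟨(((hq _).1.sub (hq _).1).sub (hq _).1).const_mul _, ?_⟩
    have i1 := (hq (EuclideanSpace.single a (1:ℝ) + EuclideanSpace.single b 1)).1.integrable_sq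
    have i2 := (hq (EuclideanSpace.single a (1:ℝ))).1.integrable_sq
    have i3 := (hq (EuclideanSpace.single b (1:ℝ))).1.integrable_sq
    have b1 := (hq (EuclideanSpace.single a (1:ℝ) + EuclideanSpace.single b 1)).2
    have b2 := (hq (EuclideanSpace.single a (1:ℝ))).2
    have b3 := (hq (EuclideanSpace.single b (1:ℝ))).2
    have h4 := norm_single_add_single_sq_le a b
    have h5 : ‖(EuclideanSpace.single a (1:ℝ) + EuclideanSpace.single b 1 : Param d)‖ ^ 4 ≤ 16 := by
      nlinarith [sq_nonneg ‖(EuclideanSpace.single a (1:ℝ) + EuclideanSpace.single b 1 : Param d)‖]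
    simp only [PiLp.norm_single, norm_one, one_pow, one_mul] at b2 b3
    have b1' := b1.trans (mul_le_mul_of_nonneg_right h5 (by linarith))
    -- Cauchy-Schwarz in the polarization formula gives the factor 3/4, and the three second moments
    -- sum to (16 + 1 + 1)(1 + σ₂); the resulting 27/2 is rounded up to 14.
    have hi := ((i1.add i2).add i3).const_mul (3 / 4)
    refine (integral_mono_of_nonneg (Eventually.of_forall fun z => by positivity) hi
      (Eventually.of_forall fun z => ?_)).trans ?_
    · simp only [Pi.add_apply]
      have key : ∀ x y w : ℝ, (1 / 2 * (x - y - w)) ^ 2 ≤ 3 / 4 * (x ^ 2 + y ^ 2 + w ^ 2) :=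
        fun x y w => by nlinarith [sq_nonneg (x + y), sq_nonneg (x + w), sq_nonneg (y - w)]
      exact key _ _ _
    · rw [integral_const_mul, integral_add' (i1.add i2) i3, integral_add' i1 i2]
      linarith
  have hmem : MemLp (fun z => D z (EuclideanSpace.single b 1)) 2 (X.P j) := by
    have hm : Measurable fun z => D z (EuclideanSpace.single b 1) := by
      have h1 : Continuous fun A : Param d →L[ℝ] Param d =>
        (A - X.riskHess j (X.θs j)) (EuclideanSpace.single b 1) := by fun_prop
      exact h1.measurable.comp (measurable_lossHess hM hS hR j)
    refine (memLp_two_iff_integrable_sq_norm hm.aestronglyMeasurable).2 ?_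
    simp_rw [EuclideanSpace.real_norm_sq_eq]
    exact integrable_finsetSum _ fun a _ => (hent a).1.integrable_sq
  refine ⟨hmem, ?_⟩
  simp_rw [EuclideanSpace.real_norm_sq_eq]
  rw [integral_finsetSum _ fun a _ => (hent a).1.integrable_sq]
  refine (Finset.sum_le_sum fun a _ => (hent a).2).trans ?_
  simp [hessVar]

/-- A bound on the mean norms of the Hessians. -/
noncomputable def hessMean (d : ℕ) (κ σ₂ : ℝ) : ℝ := d * (1 + hessVar d σ₂) + d * (d * (3 * κ))

theorem hessVar_nonneg (d : ℕ) {σ₂ : ℝ} (hσ₂ : 0 < σ₂) : 0 ≤ hessVar d σ₂ := by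
  unfold hessVar; positivity

theorem integral_norm_lossHess_le (hM : 0 < M) (hρ : 0 < ρ) (hκ : 0 < κ) (hr₂ : 2 < r₂)
    (hσ₂ : 0 < σ₂) (hS : X.Sampling) (hR : X.LossRegular M ρ κ r₁ r₂ σ₁ σ₂ σ₃ σ₅) (j : Fin X.m) :
    ∫ z, ‖X.lossHess j (X.θs j) (X.ηs j) z‖ ∂(X.P j) ≤ hessMean d κ σ₂ := by
  set D : X.Obs j → Param d →L[ℝ] Param d :=
    fun z => X.lossHess j (X.θs j) (X.ηs j) z - X.riskHess j (X.θs j) with hD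
  have hc := fun b => column_moments hM hr₂ hσ₂ hS hR j b
  have hH : ‖X.riskHess j (X.θs j)‖ ≤ d * (d * (3 * κ)) := by
    refine (norm_clm_le_sum _).trans ((Finset.sum_le_sum fun b _ => (norm_le_sum_abs _).trans
      (Finset.sum_le_sum fun a _ => riskHess_entry_le hM hρ hκ hr₂ hσ₂ hS hR j a b)).trans ?_)
    simp
  have hcol : ∀ b : Fin d, Integrable (fun z => 1 + ‖D z (EuclideanSpace.single b 1)‖ ^ 2) (X.P j) :=
    fun b => (integrable_const _).add (hc b).1.integrable_norm_pow'
  refine (integral_mono_of_nonneg (g := fun z => ∑ b : Fin d,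
    (1 + ‖D z (EuclideanSpace.single b 1)‖ ^ 2) + ‖X.riskHess j (X.θs j)‖)
    (Eventually.of_forall fun z => norm_nonneg _)
    ((integrable_finsetSum _ fun b _ => hcol b).add (integrable_const _))
    (Eventually.of_forall fun z => ?_)).trans ?_
  · have h2 : X.lossHess j (X.θs j) (X.ηs j) z = D z + X.riskHess j (X.θs j) := by
      simp [hD]
    simp only [h2]
    refine (norm_add_le _ _).trans (add_le_add ((norm_clm_le_sum _).trans
      (Finset.sum_le_sum fun b _ => ?_)) le_rfl)
    nlinarith [sq_nonneg (‖D z (EuclideanSpace.single b 1)‖ - 1)]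
  · rw [integral_add (integrable_finsetSum _ fun b _ => hcol b) (integrable_const _),
      integral_finsetSum _ fun b _ => hcol b, integral_const, probReal_univ, one_smul, hessMean]
    refine add_le_add ((Finset.sum_le_sum (g := fun _ => 1 + hessVar d σ₂) fun b _ => ?_).trans
      (by simp [mul_add])) hH
    rw [integral_add (integrable_const _) (hc b).1.integrable_norm_pow']
    simpa using (hc b).2

end Task

end Model

end Multitask

namespace Multitask

/-! ### Neyman orthogonality and the effect of the estimated nuisance -/

section Gateaux

variable {d : ℕ} {H : Type*} [AddCommGroup H] [Module ℝ H]

theorem TwiceGateauxAt.hasDerivAt_line {g : H → Param d} {η h : H} {t : ℝ}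
    (hg : TwiceGateauxAt g (η + t • h) h) :
    HasDerivAt (fun s : ℝ => g (η + s • h)) (gateaux g (η + t • h) h) t ∧
      HasDerivAt (fun s : ℝ => gateaux g (η + s • h) h) (gateaux₂ g (η + t • h) h) t := by
  have key : ∀ f : H → Param d, DifferentiableAt ℝ (fun u : ℝ => f ((η + t • h) + u • h)) 0 →
      HasDerivAt (fun s : ℝ => f (η + s • h))
        (deriv (fun u : ℝ => f ((η + t • h) + u • h)) 0) t := by
    intro f hf
    have h1 : HasDerivAt (fun u : ℝ => f ((η + t • h) + u • h))
        (deriv (fun u : ℝ => f ((η + t • h) + u • h)) 0) (t - t) := by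
      rw [sub_self]; exact hf.hasDerivAt
    have h2 := h1.comp_sub_const t t
    refine h2.congr_of_eventuallyEq (Eventually.of_forall fun s => ?_)
    simp only
    rw [add_assoc, ← add_smul, add_sub_cancel]
  exact ⟨key g hg.1, key (fun x => gateaux g x h) hg.2⟩

end Gateaux

namespace Model

variable {d : ℕ} {X : Model d} {M ρ κ r₁ r₂ σ₁ σ₂ σ₃ σ₅ : ℝ}

theorem measurable_score_truth (hM : 0 < M) (hS : X.Sampling)
    (hR : X.LossRegular M ρ κ r₁ r₂ σ₁ σ₂ σ₃ σ₅) (j : Fin X.m) :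
    Measurable (X.score j (X.θs j) (X.ηs j)) :=
  measurable_gradient (hS.measurable_loss_truth j) fun z =>
    (hR.smooth j (X.θs j) (X.ηs j) (by simp [hM.le]) (by simp [hM.le]) z).1

theorem lintegral_score_sq_le (hr₁ : 2 < r₁) (hσ₁ : 0 < σ₁)
    (hR : X.LossRegular M ρ κ r₁ r₂ σ₁ σ₂ σ₃ σ₅) (j : Fin X.m) :
    ∫⁻ z, ‖X.score j (X.θs j) (X.ηs j) z‖ₑ ^ 2 ∂(X.P j) ≤ ENNReal.ofReal (1 + σ₁) :=
  lintegral_sq_le_of_rpow hr₁.le hσ₁.le (hR.score_moment j)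

theorem memLp_score (hM : 0 < M) (hr₁ : 2 < r₁) (hσ₁ : 0 < σ₁) (hS : X.Sampling)
    (hR : X.LossRegular M ρ κ r₁ r₂ σ₁ σ₂ σ₃ σ₅) (j : Fin X.m) :
    MemLp (X.score j (X.θs j) (X.ηs j)) 2 (X.P j) ∧
      ∫ z, ‖X.score j (X.θs j) (X.ηs j) z‖ ^ 2 ∂(X.P j) ≤ 1 + σ₁ :=
  ⟨integrable_of_lintegral_sq (measurable_score_truth hM hS hR j).aestronglyMeasurable
      (lintegral_score_sq_le hr₁ hσ₁ hR j),
    integral_norm_sq_le_of_lintegral (measurable_score_truth hM hS hR j).aestronglyMeasurable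
      (by linarith) (lintegral_score_sq_le hr₁ hσ₁ hR j)⟩

/-- The gradient of the risk at the target is the mean score by interchange, and is zero by
stationarity. -/
theorem integral_score (hM : 0 < M) (hr₂ : 2 < r₂) (hσ₂ : 0 < σ₂) (hS : X.Sampling)
    (hR : X.LossRegular M ρ κ r₁ r₂ σ₁ σ₂ σ₃ σ₅) (j : Fin X.m) :
    ∫ z, X.score j (X.θs j) (X.ηs j) z ∂(X.P j) = 0 := by
  obtain ⟨L, hL⟩ := hR.exists_envelope
  exact ((randomConvex_loss_truth hM hr₂ hσ₂ hS hR hL j).hasGradientAt_integral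
    (x := X.θs j) (by simp [hM])).unique (hR.score_mean j)

/-- The change of the score at the true target caused by the estimated nuisance. -/
noncomputable def scoreShift (X : Model d) (j : Fin X.m) (y : X.Train j) (z : X.Obs j) : Param d :=
  X.score j (X.θs j) (X.fit j y) z - X.score j (X.θs j) (X.ηs j) z

/-- The training samples on which the fitted nuisance is within `e` of the truth and in `T`. -/
def goodTrain (X : Model d) (e : ℝ) (j : Fin X.m) : Set (X.Train j) :=
  {y | X.fit j y ∈ X.T j ∧ ‖X.fit j y - X.ηs j‖ ≤ e}

theorem measurableSet_goodTrain (hS : X.Sampling) (e : ℝ) (j : Fin X.m) :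
    MeasurableSet (X.goodTrain e j) :=
  (hS.measurable_T j).inter (measurableSet_le (hS.measurable_fit j) measurable_const)

/-- The scores along the segment from the true to the fitted nuisance form a random curve. Its first
derivative controls the second moment of the increment. The mean has no first order term by
orthogonality, so the second derivative makes it quadratic in the nuisance error: this is what
allows nuisance rates slower than the parametric one. -/
theorem scoreShift_moments (hM : 0 < M) (hr₂ : 2 < r₂) (hσ₂ : 0 < σ₂) (hσ₅ : 0 < σ₅)
    (hS : X.Sampling) (hR : X.LossRegular M ρ κ r₁ r₂ σ₁ σ₂ σ₃ σ₅) (j : Fin X.m)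
    {y : X.Train j} (hy : y ∈ X.goodTrain M j) :
    Measurable (X.scoreShift j y) ∧
      MemLp (X.scoreShift j y) 2 (X.P j) ∧
      ∫ z, ‖X.scoreShift j y z‖ ^ 2 ∂(X.P j) ≤ σ₅ * ‖X.fit j y - X.ηs j‖ ^ 2 ∧
      ‖∫ z, X.scoreShift j y z ∂(X.P j)‖ ≤ σ₅ * ‖X.fit j y - X.ηs j‖ ^ 2 := by
  obtain ⟨L, hL⟩ := hR.exists_envelope
  set h := X.fit j y - X.ηs j with hh
  have hC : 0 ≤ σ₅ * ‖h‖ ^ 2 := by positivity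
  have hin : ∀ t ∈ Icc (0:ℝ) 1, ‖X.ηs j + t • h - X.ηs j‖ ≤ M := fun t ht => by
    rw [add_sub_cancel_left, norm_smul, Real.norm_eq_abs, abs_of_nonneg ht.1]
    calc t * ‖h‖ ≤ 1 * ‖h‖ := by gcongr; exact ht.2
      _ ≤ M := by rw [one_mul]; exact hy.2
  have hrc : ∀ t ∈ Icc (0:ℝ) 1, RandomConvex (X.P j) (fun θ => X.loss j θ (X.ηs j + t • h))
      (X.θs j) M _ := fun t ht =>
    randomConvex_loss hM hr₂ hσ₂ hS hR hL j (hin t ht)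
      fun θ => hS.measurable_loss_segment j y θ ht
  have h00 : ‖X.θs j - X.θs j‖ < M := by simp [hM]
  let u : ℝ → X.Obs j → Param d := fun t z => X.score j (X.θs j) (X.ηs j + t • h) z
  let u' : ℝ → X.Obs j → Param d := fun t z =>
    gateaux (fun η' => X.score j (X.θs j) η' z) (X.ηs j + t • h) h
  let u'' : ℝ → X.Obs j → Param d := fun t z =>
    gateaux₂ (fun η' => X.score j (X.θs j) η' z) (X.ηs j + t • h) h
  have hd : ∀ t ∈ Icc (0:ℝ) 1, ∀ z, HasDerivAt (fun s => u s z) (u' t z) t := fun t ht z =>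
    (hR.gateaux_smooth j _ hy.1 t ht z).hasDerivAt_line.1
  have hd' : ∀ t ∈ Icc (0:ℝ) 1, ∀ z, HasDerivAt (fun s => u' s z) (u'' t z) t := fun t ht z =>
    (hR.gateaux_smooth j _ hy.1 t ht z).hasDerivAt_line.2
  have hm : ∀ t ∈ Icc (0:ℝ) 1, Measurable (u t) := fun t ht =>
    (hrc t ht).measurable_gradient h00.le
  have hint : ∀ t ∈ Icc (0:ℝ) 1, Integrable (u t) (X.P j) := fun t ht =>
    (hrc t ht).integrable_gradient h00
  have hB' : ∀ t ∈ Icc (0:ℝ) 1, ∫⁻ z, ‖u' t z‖ₑ ^ 2 ∂(X.P j) ≤ ENNReal.ofReal (σ₅ * ‖h‖ ^ 2) :=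
    fun t ht => hR.gateaux_moment j _ hy.1 t ht
  have hB'' : ∀ t ∈ Icc (0:ℝ) 1, ∫⁻ z, ‖u'' t z‖ₑ ∂(X.P j) ≤ ENNReal.ofReal (σ₅ * ‖h‖ ^ 2) :=
    fun t ht => hR.gateaux₂_moment j _ hy.1 t ht
  have hshift : X.scoreShift j y = fun z => u 1 z - u 0 z := by
    funext z
    simp [scoreShift, u, hh]
  have hmeas : Measurable (X.scoreShift j y) := by
    rw [hshift]; exact (hm 1 (by simp)).sub (hm 0 (by simp))
  have hsq : ∫⁻ z, ‖X.scoreShift j y z‖ₑ ^ 2 ∂(X.P j) ≤ ENNReal.ofReal (σ₅ * ‖h‖ ^ 2) := by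
    rw [hshift]; exact lintegral_curve_sub_sq_le hd hm hB'
  refine ⟨hmeas, integrable_of_lintegral_sq hmeas.aestronglyMeasurable hsq,
    integral_norm_sq_le_of_lintegral hmeas.aestronglyMeasurable hC hsq, ?_⟩
  rw [hshift]
  have hint' : Integrable (u' 0) (X.P j) :=
    (integrable_of_lintegral_sq (measurable_curve_deriv one_pos hd hm (by simp)).aestronglyMeasurable
      (hB' 0 (by simp))).integrable (by norm_num)
  exact norm_integral_curve_sub_le hd hd' hint hm hint' hC hB'' (hR.orthogonal j _ hy.1)
    fun t ht => ((hrc t ht).hasGradientAt_integral h00).gradient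

/-- Joint measurability of the score shift, on the good training samples. -/
theorem measurable_indicator_scoreShift (hM : 0 < M) (hS : X.Sampling)
    (hR : X.LossRegular M ρ κ r₁ r₂ σ₁ σ₂ σ₃ σ₅) (j : Fin X.m) :
    Measurable fun p : X.Train j × X.Obs j =>
      (X.goodTrain M j).indicator (fun y => X.scoreShift j y p.2) p.1 := by
  have hI : MeasurableSet {p : X.Train j × X.Obs j | p.1 ∈ X.goodTrain M j} :=
    measurable_fst (measurableSet_goodTrain hS M j)
  have h0 : Measurable fun p : X.Train j × X.Obs j =>
      {p : X.Train j × X.Obs j | p.1 ∈ X.goodTrain M j}.indicator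
        (fun p => X.score j (X.θs j) (X.ηs j) p.2) p :=
    ((measurable_score_truth hM hS hR j).comp measurable_snd).indicator hI
  have hl : ∀ θ, Measurable fun p : X.Train j × X.Obs j => X.loss j θ (X.fit j p.1) p.2 :=
    fun θ => by simpa using hS.measurable_loss j θ 1 (by simp)
  have h1 : Measurable fun p : X.Train j × X.Obs j =>
      {p : X.Train j × X.Obs j | p.1 ∈ X.goodTrain M j}.indicator
        (fun p => X.score j (X.θs j) (X.fit j p.1) p.2) p := by
    refine measurable_param fun a => ?_
    refine measurable_of_tendsto_metrizable (f := fun (n : ℕ) (p : X.Train j × X.Obs j) =>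
      {p : X.Train j × X.Obs j | p.1 ∈ X.goodTrain M j}.indicator (fun p => ((1:ℝ) / (n + 1))⁻¹ •
        (X.loss j (X.θs j + ((1:ℝ) / (n + 1)) • EuclideanSpace.single a 1) (X.fit j p.1) p.2
          - X.loss j (X.θs j) (X.fit j p.1) p.2)) p)
      (fun n => (((hl (X.θs j + ((1:ℝ) / (n + 1)) • EuclideanSpace.single a 1)).sub
        (hl (X.θs j))).const_smul (((1:ℝ) / (n + 1))⁻¹)).indicator hI)
      (tendsto_pi_nhds.2 fun p => ?_)
    by_cases hp : p.1 ∈ X.goodTrain M j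
    · have hg := (hR.smooth j (X.θs j) (X.fit j p.1) (by simp [hM.le]) hp.2 p.2).hasGradientAt
      have := tendsto_quotient_line hg.hasFDerivAt (EuclideanSpace.single a (1:ℝ)) 1 one_ne_zero
      have e : (InnerProductSpace.toDual ℝ (Param d)
          (gradient (fun θ' => X.loss j θ' (X.fit j p.1) p.2) (X.θs j)))
          (EuclideanSpace.single a (1:ℝ)) = X.score j (X.θs j) (X.fit j p.1) p.2 a := by
        rw [InnerProductSpace.toDual_apply_apply, EuclideanSpace.inner_single_right]; simp [score]
      rw [e] at this
      rw [indicator_of_mem (by exact hp)]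
      refine this.congr fun n => ?_
      rw [indicator_of_mem (by exact hp)]
    · rw [indicator_of_notMem (by exact hp)]
      refine tendsto_const_nhds.congr fun n => ?_
      rw [indicator_of_notMem (by exact hp)]
      rfl
  convert h1.sub h0 using 1
  funext p
  by_cases hp : p.1 ∈ X.goodTrain M j
  · simp [hp, scoreShift]
  · simp [hp]

end Model

end Multitask

namespace Multitask

/-! ### Pooled sums over a cluster, conditionally on the training samples -/

namespace Model

variable {d : ℕ} {X : Model d}

/-- The observations of the tasks in cluster `k`. -/
def obsIdx (X : Model d) (k : Fin X.K) : Finset (Σ j, Fin (X.n j)) :=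
  (X.S k).sigma fun _ => Finset.univ

theorem sum_obsIdx {F : Type*} [AddCommMonoid F] (k : Fin X.K) (g : ∀ j, Fin (X.n j) → F) :
    ∑ p ∈ X.obsIdx k, g p.1 p.2 = ∑ j ∈ X.S k, ∑ i, g j i :=
  Finset.sum_sigma _ _ _

theorem card_obsIdx (k : Fin X.K) : (X.obsIdx k).card = X.N k := by
  rw [obsIdx, Finset.card_sigma]
  simp [N]

section Moments

variable (hS : X.Sampling)
include hS

theorem Sampling.integral_comp_Z {F : Type*} [NormedAddCommGroup F] [NormedSpace ℝ F]
    (j : Fin X.m) (i : Fin (X.n j)) {g : X.Obs j → F} (hg : AEStronglyMeasurable g (X.P j)) :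
    ∫ ω, g (X.Z j i ω) ∂X.μ = ∫ z, g z ∂(X.P j) := by
  rw [← hS.law_Z j i] at hg ⊢
  rw [integral_map (hS.measurable_Z j i).aemeasurable hg]

theorem Sampling.measurePreserving_Z (j : Fin X.m) (i : Fin (X.n j)) :
    MeasurePreserving (X.Z j i) X.μ (X.P j) := ⟨hS.measurable_Z j i, hS.law_Z j i⟩

theorem Sampling.measure_lt_sum_le (k : Fin X.K) {g : ∀ j, X.Obs j → ℝ} (hg0 : ∀ j z, 0 ≤ g j z)
    (hg : ∀ j, Integrable (g j) (X.P j)) {B C : ℝ} (hB : ∀ j, ∫ z, g j z ∂(X.P j) ≤ B)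
    (hC : 0 < C) (hN : 0 < X.N k) :
    X.μ.real {ω | C * X.N k < ∑ p ∈ X.obsIdx k, g p.1 (X.Z p.1 p.2 ω)} ≤ B / C := by
  have hint : ∀ p : Σ j, Fin (X.n j), Integrable (fun ω => g p.1 (X.Z p.1 p.2 ω)) X.μ := fun p =>
    (hS.measurePreserving_Z p.1 p.2).integrable_comp_of_integrable (hg p.1)
  have h := mul_meas_ge_le_integral_of_nonneg (μ := X.μ)
    (f := fun ω => ∑ p ∈ X.obsIdx k, g p.1 (X.Z p.1 p.2 ω))
    (Eventually.of_forall fun ω => Finset.sum_nonneg fun p _ => hg0 _ _)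
    (integrable_finsetSum _ fun p _ => hint p) (C * X.N k)
  rw [integral_finsetSum _ fun p _ => hint p] at h
  have h2 : ∑ p ∈ X.obsIdx k, ∫ ω, g p.1 (X.Z p.1 p.2 ω) ∂X.μ ≤ X.N k * B := by
    rw [← card_obsIdx, ← nsmul_eq_mul]
    refine Finset.sum_le_card_nsmul _ _ _ fun p _ => ?_
    rw [hS.integral_comp_Z p.1 p.2 (hg p.1).1]
    exact hB p.1
  have h3 : X.μ.real {ω | C * X.N k < ∑ p ∈ X.obsIdx k, g p.1 (X.Z p.1 p.2 ω)}
      ≤ X.μ.real {ω | C * X.N k ≤ ∑ p ∈ X.obsIdx k, g p.1 (X.Z p.1 p.2 ω)} :=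
    measureReal_mono (ofPred_subset_ofPred.2 fun ω hω => le_of_lt hω)
  have hN' : (0:ℝ) < X.N k := by exact_mod_cast hN
  rw [le_div_iff₀ hC]
  refine le_of_mul_le_mul_left ?_ hN'
  calc _ = C * X.N k * X.μ.real {ω | C * X.N k < ∑ p ∈ X.obsIdx k, g p.1 (X.Z p.1 p.2 ω)} := by ring
    _ ≤ C * X.N k * X.μ.real {ω | C * X.N k ≤ ∑ p ∈ X.obsIdx k, g p.1 (X.Z p.1 p.2 ω)} := by
        gcongr
    _ ≤ _ := h.trans h2

theorem Sampling.iIndepFun_comp {F : Type*} [MeasurableSpace F] {g : ∀ j, X.Obs j → F}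
    (hm : ∀ j, Measurable (g j)) :
    iIndepFun (fun (p : Σ j, Fin (X.n j)) ω => g p.1 (X.Z p.1 p.2 ω)) X.μ :=
  hS.indep_Z.comp (fun p => g p.1) fun p => hm p.1

theorem Sampling.memLp_comp_Z {F : Type*} [NormedAddCommGroup F] {j : Fin X.m} {i : Fin (X.n j)}
    {g : X.Obs j → F} (hg : MemLp g 2 (X.P j)) : MemLp (fun ω => g (X.Z j i ω)) 2 X.μ :=
  hg.comp_measurePreserving (hS.measurePreserving_Z j i)

theorem Sampling.integral_norm_sq_sum_le (k : Fin X.K) {g : ∀ j, X.Obs j → Param d}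
    (hm : ∀ j, Measurable (g j)) (hg : ∀ j, MemLp (g j) 2 (X.P j))
    (h0 : ∀ j, ∫ z, g j z ∂(X.P j) = 0) {B : Fin X.m → ℝ}
    (hB : ∀ j, ∫ z, ‖g j z‖ ^ 2 ∂(X.P j) ≤ B j) :
    ∫ ω, ‖∑ p ∈ X.obsIdx k, g p.1 (X.Z p.1 p.2 ω)‖ ^ 2 ∂X.μ ≤ ∑ j ∈ X.S k, X.n j * B j := by
  rw [integral_norm_sq_sum_eq (X.obsIdx k) (hS.iIndepFun_comp hm)
    (fun p _ => hS.memLp_comp_Z (hg p.1))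
    (fun p _ => by rw [hS.integral_comp_Z p.1 p.2 (hg p.1).1, h0]),
    X.sum_obsIdx k fun j i => ∫ ω, ‖g j (X.Z j i ω)‖ ^ 2 ∂X.μ]
  refine Finset.sum_le_sum fun j _ => ?_
  refine (Finset.sum_le_card_nsmul _ _ (B j) fun i _ => ?_).trans (by simp)
  rw [hS.integral_comp_Z j i (g := fun z => ‖g j z‖ ^ 2) ((hg j).1.norm.pow 2)]
  exact hB j

theorem Sampling.measure_le_norm_sum_le (k : Fin X.K) {g : ∀ j, X.Obs j → Param d}
    (hm : ∀ j, Measurable (g j)) (hg : ∀ j, MemLp (g j) 2 (X.P j))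
    (h0 : ∀ j, ∫ z, g j z ∂(X.P j) = 0) {B : Fin X.m → ℝ}
    (hB : ∀ j, ∫ z, ‖g j z‖ ^ 2 ∂(X.P j) ≤ B j) {t : ℝ} (ht : 0 < t) :
    X.μ.real {ω | t ≤ ‖∑ p ∈ X.obsIdx k, g p.1 (X.Z p.1 p.2 ω)‖}
      ≤ (∑ j ∈ X.S k, X.n j * B j) / t ^ 2 := by
  have hL2 : MemLp (fun ω => ∑ p ∈ X.obsIdx k, g p.1 (X.Z p.1 p.2 ω)) 2 X.μ :=
    memLp_finsetSum _ fun p _ => hS.memLp_comp_Z (hg p.1)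
  have h := mul_meas_ge_le_integral_of_nonneg (μ := X.μ)
    (f := fun ω => ‖∑ p ∈ X.obsIdx k, g p.1 (X.Z p.1 p.2 ω)‖ ^ 2)
    (Eventually.of_forall fun ω => by positivity) hL2.integrable_norm_pow' (t ^ 2)
  rw [le_div_iff₀ (by positivity), mul_comm]
  refine le_trans ?_ (h.trans (hS.integral_norm_sq_sum_le k hm hg h0 hB))
  have hsub : X.μ.real {ω | t ≤ ‖∑ p ∈ X.obsIdx k, g p.1 (X.Z p.1 p.2 ω)‖}
      ≤ X.μ.real {ω | t ^ 2 ≤ ‖∑ p ∈ X.obsIdx k, g p.1 (X.Z p.1 p.2 ω)‖ ^ 2} :=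
    measureReal_mono (ofPred_subset_ofPred.2 fun ω hω => pow_le_pow_left₀ ht.le hω 2)
  exact mul_le_mul_of_nonneg_left hsub (by positivity)

end Moments

section Conditioning

/-- Conditioning on the training samples. -/
theorem Sampling.measure_le_of_forall_train (hS : X.Sampling)
    {A : Set ((∀ j, X.Train j) × (∀ j, Fin (X.n j) → X.Obs j))} (hA : MeasurableSet A)
    {c : (∀ j, X.Train j) → ℝ≥0∞} (hc : Measurable c)
    (h : ∀ y, X.μ {ω | (y, fun j i => X.Z j i ω) ∈ A} ≤ c y) :
    X.μ {ω | ((fun j => X.Y j ω), fun j i => X.Z j i ω) ∈ A} ≤ ∫⁻ ω, c (fun j => X.Y j ω) ∂X.μ := by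
  have hY : Measurable fun ω j => X.Y j ω := measurable_pi_lambda _ hS.measurable_Y
  have hZ : Measurable fun ω j i => X.Z j i ω :=
    measurable_pi_lambda _ fun j => measurable_pi_lambda _ (hS.measurable_Z j)
  have hprod := (indepFun_iff_map_prod_eq_prod_map_map hY.aemeasurable hZ.aemeasurable).1 hS.split
  have : IsProbabilityMeasure (X.μ.map fun ω j i => X.Z j i ω) :=
    Measure.isProbabilityMeasure_map hZ.aemeasurable
  have e : X.μ {ω | ((fun j => X.Y j ω), fun j i => X.Z j i ω) ∈ A}
      = (X.μ.map fun ω => ((fun j => X.Y j ω), fun j i => X.Z j i ω)) A := by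
    rw [Measure.map_apply (hY.prodMk hZ) hA]; rfl
  rw [e, hprod, Measure.prod_apply hA, ← lintegral_map hc hY]
  refine lintegral_mono fun y => ?_
  rw [Measure.map_apply hZ (measurable_prodMk_left hA)]
  exact h y

variable {M ρ κ r₁ r₂ σ₁ σ₂ σ₃ σ₅ : ℝ}

/-- The score shift, set to zero outside the good training samples. -/
noncomputable def goodShift (X : Model d) (M : ℝ) (j : Fin X.m) (y : X.Train j) (z : X.Obs j) : Param d :=
  (X.goodTrain M j).indicator (fun y => X.scoreShift j y z) y

/-- The minimum retains two bounds on the second moment: one vanishes with the nuisance error, the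
other is uniform over all training samples. -/
theorem goodShift_moments (hM : 0 < M) (hr₂ : 2 < r₂) (hσ₂ : 0 < σ₂) (hσ₅ : 0 < σ₅)
    (hS : X.Sampling) (hR : X.LossRegular M ρ κ r₁ r₂ σ₁ σ₂ σ₃ σ₅) (j : Fin X.m) (y : X.Train j) :
    Measurable (X.goodShift M j y) ∧ MemLp (X.goodShift M j y) 2 (X.P j) ∧
      ∫ z, ‖X.goodShift M j y z‖ ^ 2 ∂(X.P j) ≤ σ₅ * min (‖X.fit j y - X.ηs j‖ ^ 2) (M ^ 2) ∧
      ‖∫ z, X.goodShift M j y z ∂(X.P j)‖ ≤ σ₅ * ‖X.fit j y - X.ηs j‖ ^ 2 := by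
  by_cases hy : y ∈ X.goodTrain M j
  · have e : X.goodShift M j y = X.scoreShift j y := by
      funext z; simp [goodShift, hy]
    rw [e]
    have h := scoreShift_moments hM hr₂ hσ₂ hσ₅ hS hR j hy
    rw [min_eq_left (pow_le_pow_left₀ (norm_nonneg _) hy.2 2)]
    exact h
  · have e : X.goodShift M j y = 0 := by
      funext z; simp [goodShift, hy]
    rw [e]
    have : 0 ≤ min (‖X.fit j y - X.ηs j‖ ^ 2) (M ^ 2) := by positivity
    refine ⟨measurable_const, MemLp.zero, ?_, ?_⟩ <;> simp <;> positivity

theorem measurable_goodShift (hM : 0 < M) (hS : X.Sampling)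
    (hR : X.LossRegular M ρ κ r₁ r₂ σ₁ σ₂ σ₃ σ₅) (j : Fin X.m) :
    Measurable fun q : X.Train j × X.Obs j => X.goodShift M j q.1 q.2 := by
  unfold goodShift
  exact measurable_indicator_scoreShift hM hS hR j

theorem measurable_train_obs (j : Fin X.m) (i : Fin (X.n j)) :
    Measurable fun q : (∀ j, X.Train j) × (∀ j, Fin (X.n j) → X.Obs j) => (q.1 j, q.2 j i) := by
  refine Measurable.prodMk (by fun_prop) ?_
  have h2 : Measurable fun q : (∀ j, X.Train j) × (∀ j, Fin (X.n j) → X.Obs j) => q.2 j :=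
    (measurable_pi_apply j).comp measurable_snd
  exact (measurable_pi_apply i).comp h2

theorem measurable_comp_train_obs (j : Fin X.m) (i : Fin (X.n j)) {F : Type*}
    [MeasurableSpace F] {G : X.Train j → X.Obs j → F}
    (hG : Measurable fun q : X.Train j × X.Obs j => G q.1 q.2) :
    Measurable fun q : (∀ j, X.Train j) × (∀ j, Fin (X.n j) → X.Obs j) => G (q.1 j) (q.2 j i) :=
  hG.comp (measurable_train_obs j i)

theorem measurable_sum_goodShift (hM : 0 < M) (hS : X.Sampling)
    (hR : X.LossRegular M ρ κ r₁ r₂ σ₁ σ₂ σ₃ σ₅) (p : Σ j, Fin (X.n j)) :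
    Measurable fun q : (∀ j, X.Train j) × (∀ j, Fin (X.n j) → X.Obs j) =>
      X.goodShift M p.1 (q.1 p.1) (q.2 p.1 p.2) :=
  measurable_comp_train_obs p.1 p.2 (measurable_goodShift hM hS hR p.1)

theorem integral_norm_sub_mean_sq_le {𝒵 : Type*} [MeasurableSpace 𝒵] {P : Measure 𝒵}
    [IsProbabilityMeasure P] {g : 𝒵 → Param d} (hg : MemLp g 2 P) :
    ∫ z, ‖g z - ∫ w, g w ∂P‖ ^ 2 ∂P ≤ ∫ z, ‖g z‖ ^ 2 ∂P := by
  set c := ∫ w, g w ∂P with hc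
  have hi := hg.integrable (q := 2) (by norm_num)
  have e : ∀ z, ‖g z - c‖ ^ 2 = ‖g z‖ ^ 2 - 2 * inner ℝ c (g z) + ‖c‖ ^ 2 := fun z => by
    rw [norm_sub_sq_real, real_inner_comm]
  have hin : Integrable (fun z => 2 * (inner ℝ c (g z) : ℝ)) P := (hi.const_inner c).const_mul 2
  simp_rw [e]
  have h2 : Integrable (fun z => ‖g z‖ ^ 2 - 2 * (inner ℝ c (g z) : ℝ)) P :=
    hg.integrable_norm_pow'.sub hin
  rw [integral_add h2 (integrable_const _),
    integral_sub hg.integrable_norm_pow' hin, integral_const_mul, integral_inner hi, ← hc,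
    real_inner_self_eq_norm_sq]
  simp
  nlinarith [sq_nonneg ‖c‖]

/-- The weighted squared nuisance error of a cluster. -/
noncomputable def nuisErr (X : Model d) (k : Fin X.K) (y : ∀ j, X.Train j) : ℝ :=
  ∑ j ∈ X.S k, X.n j * ‖X.fit j (y j) - X.ηs j‖ ^ 2

theorem nuisErr_nonneg (k : Fin X.K) (y : ∀ j, X.Train j) : 0 ≤ X.nuisErr k y :=
  Finset.sum_nonneg fun j _ => by positivity

/-- For fixed training samples both the mean and the total variance of the sum are at most σ₅
`nuisErr`. If the mean may exceed t/2, the term 2/t already makes the bound at least one; otherwise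
Chebyshev's inequality is applied at level t/2. Linearity of the bound in `nuisErr` prepares the
integration over the training samples. -/
theorem measure_goodShift_le_of_train (hM : 0 < M) (hr₂ : 2 < r₂) (hσ₂ : 0 < σ₂) (hσ₅ : 0 < σ₅)
    (hS : X.Sampling) (hR : X.LossRegular M ρ κ r₁ r₂ σ₁ σ₂ σ₃ σ₅) (k : Fin X.K)
    (y : ∀ j, X.Train j) {t : ℝ} (ht : 0 < t) :
    X.μ.real {ω | t < ‖∑ p ∈ X.obsIdx k, X.goodShift M p.1 (y p.1) (X.Z p.1 p.2 ω)‖}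
      ≤ (4 / t ^ 2 + 2 / t) * σ₅ * X.nuisErr k y := by
  have hmom := fun j => goodShift_moments hM hr₂ hσ₂ hσ₅ hS hR j (y j)
  set c : Fin X.m → Param d := fun j => ∫ z, X.goodShift M j (y j) z ∂(X.P j) with hc
  set Q := X.nuisErr k y with hQ
  have hQ0 : 0 ≤ Q := nuisErr_nonneg k y
  have hmean : ‖∑ p ∈ X.obsIdx k, c p.1‖ ≤ σ₅ * Q := by
    refine (norm_sum_le _ _).trans ?_
    rw [X.sum_obsIdx k fun j _ => ‖c j‖, hQ, nuisErr, Finset.mul_sum]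
    refine Finset.sum_le_sum fun j _ => ?_
    simp only [Finset.sum_const, Finset.card_univ, Fintype.card_fin, nsmul_eq_mul]
    have := mul_le_mul_of_nonneg_left (hmom j).2.2.2 (Nat.cast_nonneg (α := ℝ) (X.n j))
    linarith
  have hvar := hS.measure_le_norm_sum_le k (g := fun j z => X.goodShift M j (y j) z - c j)
    (fun j => (hmom j).1.sub_const _) (fun j => (hmom j).2.1.sub (memLp_const _))
    (fun j => by
      rw [integral_sub ((hmom j).2.1.integrable (by norm_num)) (integrable_const _)]
      simp [hc])
    (B := fun j => σ₅ * ‖X.fit j (y j) - X.ηs j‖ ^ 2)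
    (fun j => (integral_norm_sub_mean_sq_le (hmom j).2.1).trans ((hmom j).2.2.1.trans
      (mul_le_mul_of_nonneg_left (min_le_left _ _) hσ₅.le))) (half_pos ht)
  have hQ' : ∑ j ∈ X.S k, (X.n j : ℝ) * (σ₅ * ‖X.fit j (y j) - X.ηs j‖ ^ 2) = σ₅ * Q := by
    rw [hQ, nuisErr, Finset.mul_sum]
    exact Finset.sum_congr rfl fun j _ => by ring
  rw [hQ'] at hvar
  by_cases hcase : t / 2 < σ₅ * Q
  · have h1 : (1:ℝ) ≤ 2 / t * (σ₅ * Q) := by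
      rw [div_mul_eq_mul_div, le_div_iff₀ ht]; linarith
    have h2 : 0 ≤ 4 / t ^ 2 * (σ₅ * Q) := by positivity
    calc _ ≤ (1:ℝ) := measureReal_le_one
      _ ≤ _ := by linarith
  · rw [not_lt] at hcase
    have h1 : X.μ.real {ω | t < ‖∑ p ∈ X.obsIdx k, X.goodShift M p.1 (y p.1) (X.Z p.1 p.2 ω)‖}
      ≤ X.μ.real {ω | t / 2
        ≤ ‖∑ p ∈ X.obsIdx k, (X.goodShift M p.1 (y p.1) (X.Z p.1 p.2 ω) - c p.1)‖} := by
      refine measureReal_mono fun ω hω => ?_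
      simp only [mem_ofPred_eq] at hω ⊢
      rw [Finset.sum_sub_distrib]
      have := norm_sub_norm_le (∑ p ∈ X.obsIdx k, X.goodShift M p.1 (y p.1) (X.Z p.1 p.2 ω))
        (∑ p ∈ X.obsIdx k, c p.1)
      linarith
    refine h1.trans (hvar.trans ?_)
    have h2 : 0 ≤ 2 / t * (σ₅ * Q) := by positivity
    have h3 : σ₅ * Q / (t / 2) ^ 2 = 4 / t ^ 2 * (σ₅ * Q) := by field_simp; ring
    rw [h3]
    linarith

/-- The conditional bound is linear in the squared nuisance errors, so integrating over the training
samples requires nothing beyond the mean square rate. -/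
theorem measure_goodShift_le (hM : 0 < M) (hr₂ : 2 < r₂) (hσ₂ : 0 < σ₂) (hσ₅ : 0 < σ₅)
    (hS : X.Sampling) (hR : X.LossRegular M ρ κ r₁ r₂ σ₁ σ₂ σ₃ σ₅) {s : ℕ → ℝ} {σ₄ : ℝ}
    (hσ₄ : 0 < σ₄) (hn : X.NuisanceRate s σ₄) (k : Fin X.K) {t : ℝ} (ht : 0 < t) :
    X.μ.real {ω | t < ‖∑ p ∈ X.obsIdx k, X.goodShift M p.1 (X.Y p.1 ω) (X.Z p.1 p.2 ω)‖}
      ≤ (4 / t ^ 2 + 2 / t) * σ₅ * (σ₄ * ∑ j ∈ X.S k, X.n j / s (X.n j) ^ 2) := by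
  have hA : MeasurableSet {q : (∀ j, X.Train j) × (∀ j, Fin (X.n j) → X.Obs j) |
      t < ‖∑ p ∈ X.obsIdx k, X.goodShift M p.1 (q.1 p.1) (q.2 p.1 p.2)‖} :=
    measurableSet_lt measurable_const
      (Finset.measurable_sum _ fun p _ => measurable_sum_goodShift hM hS hR p).norm
  have hcoef : 0 ≤ (4 / t ^ 2 + 2 / t) * σ₅ := by positivity
  have hmQ : Measurable (X.nuisErr k) := Finset.measurable_sum _ fun j _ =>
    ((((hS.measurable_fit j).comp (measurable_pi_apply j)).pow_const 2).const_mul _)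
  have h := hS.measure_le_of_forall_train hA
    (c := fun y => ENNReal.ofReal ((4 / t ^ 2 + 2 / t) * σ₅ * X.nuisErr k y))
    (hmQ.const_mul _).ennreal_ofReal
    (fun y => by
      rw [← ofReal_measureReal]
      exact ENNReal.ofReal_le_ofReal (measure_goodShift_le_of_train hM hr₂ hσ₂ hσ₅ hS hR k y ht))
  refine ENNReal.toReal_le_of_le_ofReal (by positivity) (h.trans ?_)
  have e : ∀ ω, ENNReal.ofReal ((4 / t ^ 2 + 2 / t) * σ₅ * X.nuisErr k fun j => X.Y j ω)
      = ENNReal.ofReal ((4 / t ^ 2 + 2 / t) * σ₅)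
        * ∑ j ∈ X.S k, (X.n j : ℝ≥0∞) * ‖X.ηhat j ω - X.ηs j‖ₑ ^ 2 := fun ω => by
    rw [ENNReal.ofReal_mul hcoef, nuisErr, ENNReal.ofReal_sum_of_nonneg fun j _ => by positivity]
    congr 1
    refine Finset.sum_congr rfl fun j _ => ?_
    rw [ENNReal.ofReal_mul (by positivity), ENNReal.ofReal_natCast,
      ENNReal.ofReal_pow (norm_nonneg _), ofReal_norm]
    rfl
  have hme : ∀ j, Measurable fun ω => ‖X.ηhat j ω - X.ηs j‖ₑ ^ 2 := fun j => by
    have h1 : Measurable fun ω => ENNReal.ofReal ‖X.ηhat j ω - X.ηs j‖ :=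
      ((hS.measurable_fit j).comp (hS.measurable_Y j)).ennreal_ofReal
    simp_rw [ofReal_norm] at h1
    exact h1.pow_const 2
  simp_rw [e]
  rw [lintegral_const_mul _ (Finset.measurable_sum _ fun j _ => (hme j).const_mul _),
    lintegral_finsetSum _ fun j _ => (hme j).const_mul _, ENNReal.ofReal_mul hcoef]
  gcongr
  rw [Finset.mul_sum, ENNReal.ofReal_sum_of_nonneg fun j _ => by positivity]
  refine Finset.sum_le_sum fun j _ => ?_
  rw [lintegral_const_mul _ (hme j)]
  refine (mul_le_mul_right (hn j) _).trans (le_of_eq ?_)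
  rw [← ENNReal.ofReal_natCast, ← ENNReal.ofReal_mul (by positivity)]
  congr 1
  ring

/-- The uniform bound by M² makes the conditional Markov bound independent of the training samples.
-/
theorem measure_sum_norm_goodShift_le (hM : 0 < M) (hr₂ : 2 < r₂) (hσ₂ : 0 < σ₂) (hσ₅ : 0 < σ₅)
    (hS : X.Sampling) (hR : X.LossRegular M ρ κ r₁ r₂ σ₁ σ₂ σ₃ σ₅) (k : Fin X.K) {C : ℝ}
    (hC : 0 < C) (hN : 0 < X.N k) :
    X.μ.real {ω | C * X.N k < ∑ p ∈ X.obsIdx k, ‖X.goodShift M p.1 (X.Y p.1 ω) (X.Z p.1 p.2 ω)‖}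
      ≤ (1 + σ₅ * M ^ 2) / C := by
  have hA : MeasurableSet {q : (∀ j, X.Train j) × (∀ j, Fin (X.n j) → X.Obs j) |
      C * X.N k < ∑ p ∈ X.obsIdx k, ‖X.goodShift M p.1 (q.1 p.1) (q.2 p.1 p.2)‖} :=
    measurableSet_lt measurable_const
      (Finset.measurable_sum _ fun p _ => (measurable_sum_goodShift hM hS hR p).norm)
  have h := hS.measure_le_of_forall_train hA
    (c := fun _ => ENNReal.ofReal ((1 + σ₅ * M ^ 2) / C)) measurable_const
    (fun y => by
      rw [← ofReal_measureReal]
      refine ENNReal.ofReal_le_ofReal (hS.measure_lt_sum_le k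
        (g := fun j z => ‖X.goodShift M j (y j) z‖) (fun _ _ => norm_nonneg _)
        (fun j => ((goodShift_moments hM hr₂ hσ₂ hσ₅ hS hR j (y j)).2.1.integrable
          (by norm_num)).norm) (fun j => ?_) hC hN)
      have hm := goodShift_moments hM hr₂ hσ₂ hσ₅ hS hR j (y j)
      calc _ ≤ ∫ z, (1 + ‖X.goodShift M j (y j) z‖ ^ 2) ∂(X.P j) := by
            refine integral_mono (hm.2.1.integrable (by norm_num)).norm
              ((integrable_const _).add hm.2.1.integrable_norm_pow') fun z => ?_
            simp only
            nlinarith [sq_nonneg (‖X.goodShift M j (y j) z‖ - 1)]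
        _ ≤ _ := by
            rw [integral_add (integrable_const _) hm.2.1.integrable_norm_pow']
            have := hm.2.2.1.trans (mul_le_mul_of_nonneg_left (min_le_right _ _) hσ₅.le)
            simpa using this)
  refine ENNReal.toReal_le_of_le_ofReal (by positivity) (h.trans ?_)
  simp

end Conditioning

end Model

end Multitask

namespace Multitask

/-! ### Linearization of the estimator on good samples -/

namespace Model

variable {d : ℕ} {X : Model d} {M ρ κ r₁ r₂ σ₁ σ₂ σ₃ σ₅ : ℝ} {L : ∀ j, X.Obs j → ℝ≥0∞}

/-- The mean value inequality for the score minus its linear part, with the Hessian frozen at the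
true target and nuisance. Along the segment the Hessian deviates by the Lipschitz constant times the
sum of the two distances, so the nuisance error appears in the bound. -/
theorem norm_score_sub_linear_le (hM : 0 < M) (hR : X.LossRegular M ρ κ r₁ r₂ σ₁ σ₂ σ₃ σ₅)
    (hL : X.HessEnvelope M σ₃ L) {j : Fin X.m} {z : X.Obs j} (hz : L j z < ∞) {β : Param d}
    (hβ : ‖β - X.θs j‖ ≤ M) {η : X.Nuis j} (hη : ‖η - X.ηs j‖ ≤ M) :
    ‖X.score j β η z - X.score j (X.θs j) η z
        - X.lossHess j (X.θs j) (X.ηs j) z (β - X.θs j)‖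
      ≤ (L j z).toReal * (‖β - X.θs j‖ + ‖η - X.ηs j‖) * ‖β - X.θs j‖ := by
  have hball : ∀ w ∈ Metric.closedBall (X.θs j) ‖β - X.θs j‖, ‖w - X.θs j‖ ≤ M := fun w hw => by
    rw [mem_closedBall_iff_norm] at hw; exact hw.trans hβ
  refine (convex_closedBall (X.θs j) ‖β - X.θs j‖).norm_image_sub_le_of_norm_hasFDerivWithin_le'
    (f := fun θ => X.score j θ η z) (f' := fun θ => X.lossHess j θ η z)
    (fun w hw => (hR.smooth j w η (hball w hw) hη z).hasFDerivAt.hasFDerivWithinAt)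
    (fun w hw => ?_) (Metric.mem_closedBall_self (norm_nonneg _)) (by simp [dist_eq_norm])
  refine (hL.norm_sub_le hz (hball w hw) (by simp [hM.le]) hη (by simp [hM.le])).trans ?_
  rw [mem_closedBall_iff_norm] at hw
  gcongr

/-- The sum over a cluster of the true Hessians of the risk, one for each observation. -/
noncomputable def pooledHess (X : Model d) (k : Fin X.K) : Param d →L[ℝ] Param d :=
  ∑ p ∈ X.obsIdx k, X.riskHess p.1 (X.θs p.1)

theorem pooledHess_coercive (hM : 0 < M) (hR : X.LossRegular M ρ κ r₁ r₂ σ₁ σ₂ σ₃ σ₅)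
    (k : Fin X.K) (v : Param d) : ρ * X.N k * ‖v‖ ^ 2 ≤ inner ℝ (X.pooledHess k v) v := by
  rw [pooledHess, sum_apply, sum_inner]
  have := Finset.card_nsmul_le_sum (X.obsIdx k)
    (fun p => (inner ℝ (X.riskHess p.1 (X.θs p.1) v) v : ℝ)) (ρ * ‖v‖ ^ 2) fun p _ => by
      rw [real_inner_comm]
      exact (hR.curvature p.1 (X.θs p.1) (by simp [hM.le]) v).1
  rw [card_obsIdx, nsmul_eq_mul] at this
  linarith

/-- The sum of the scores of the observations in a cluster, at the truth. -/
noncomputable def scoreSum (X : Model d) (k : Fin X.K) (ω : X.Ω) : Param d :=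
  ∑ p ∈ X.obsIdx k, X.score p.1 (X.θs p.1) (X.ηs p.1) (X.Z p.1 p.2 ω)

/-- The samples on which the empirical quantities of a cluster are under control. -/
structure GoodCluster (X : Model d) (M : ℝ) (L : ∀ j, X.Obs j → ℝ≥0∞) (C e : ℝ) (k : Fin X.K)
    (ω : X.Ω) : Prop where
  envelope : ∑ p ∈ X.obsIdx k, (L p.1 (X.Z p.1 p.2 ω)).toReal ≤ C * X.N k
  hess : ∑ p ∈ X.obsIdx k, ‖X.lossHess p.1 (X.θs p.1) (X.ηs p.1) (X.Z p.1 p.2 ω)‖ ≤ C * X.N k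
  scores : ∑ p ∈ X.obsIdx k, ‖X.score p.1 (X.θs p.1) (X.ηs p.1) (X.Z p.1 p.2 ω)‖ ≤ C * X.N k
  shifts : ∑ p ∈ X.obsIdx k, ‖X.goodShift M p.1 (X.Y p.1 ω) (X.Z p.1 p.2 ω)‖ ≤ C * X.N k
  score : ‖X.scoreSum k ω‖ ≤ C * √(X.N k)
  shift : ‖∑ p ∈ X.obsIdx k, X.goodShift M p.1 (X.Y p.1 ω) (X.Z p.1 p.2 ω)‖ ≤ e * √(X.N k)
  hessDev : ‖∑ p ∈ X.obsIdx k, (X.lossHess p.1 (X.θs p.1) (X.ηs p.1) (X.Z p.1 p.2 ω)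
    - X.riskHess p.1 (X.θs p.1))‖ ≤ e * X.N k

/-- The samples on which the training samples and all the clusters are under control. -/
structure GoodSample (X : Model d) (M : ℝ) (L : ∀ j, X.Obs j → ℝ≥0∞) (C e : ℝ) (ω : X.Ω) : Prop where
  train : ∀ j, X.Y j ω ∈ X.goodTrain e j
  lt_top : ∀ j i, L j (X.Z j i ω) < ∞
  cluster : ∀ k, X.GoodCluster M L C e k ω

/-- The gradient of the empirical loss of a task at the estimated nuisance. -/
noncomputable def taskGrad (X : Model d) (ω : X.Ω) (j : Fin X.m) (β : Param d) : Param d :=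
  ∑ i, X.score j β (X.ηhat j ω) (X.Z j i ω)

/-- Smallness of the tuning parameters at the radii `e` and `r`. -/
structure SmallTuning (X : Model d) (M C ρ e r : ℝ) : Prop where
  C_pos : 0 < C
  e_pos : 0 < e
  r_pos : 0 < r
  e_le : e ≤ M
  r_le : 2 * r ≤ M
  e_half : e ≤ 1 / 2
  r_quarter : r ≤ 1 / 4
  -- The relative error of the pooled Hessian may use up at most half of the curvature.
  small : e + C * (2 * r + e) ≤ ρ / 2
  -- These are the errors of order √N: one e from the nuisance shift, one from the cross penalty,
  -- and the rest from the offset between targets and centroid.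
  small' : 2 * e + C * e + C * (2 * r + e) * e ≤ 2
  penalty : ∀ k, X.ε * X.m * (X.S k).card ≤ e * √(X.N k)
  N_pos : ∀ k, 0 < X.N k
  near : ∀ j, ‖X.θs j - X.βs (X.cluster j)‖ ≤ X.ξ (X.cluster j)
  ξ_le : ∀ k, X.ξ k ≤ r
  ξ_small : ∀ k, √(X.N k) * X.ξ k ≤ e
  ξ_nonneg : ∀ k, 0 ≤ X.ξ k
  -- The score C√N and the errors 2√N, divided by the remaining curvature N ρ/2, give this radius.
  radius : ∀ k, 2 * (C + 2) / (ρ * √(X.N k)) ≤ r / 2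

theorem mem_S {k : Fin X.K} {j : Fin X.m} : j ∈ X.S k ↔ X.cluster j = k := by simp [S]

namespace SmallTuning

variable {C e r : ℝ}

theorem norm_sub_target_le (h : X.SmallTuning M C ρ e r) {j : Fin X.m} {β : Param d} :
    ‖β - X.θs j‖ ≤ ‖β - X.βs (X.cluster j)‖ + X.ξ (X.cluster j) := by
  have : β - X.θs j = (β - X.βs (X.cluster j)) - (X.θs j - X.βs (X.cluster j)) := by abel
  rw [this]
  exact (norm_sub_le _ _).trans (by linarith [h.near j])

theorem sum_taskGrad (k : Fin X.K) (ω : X.Ω) (β : Param d) : ∑ j ∈ X.S k, X.taskGrad ω j β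
    = ∑ p ∈ X.obsIdx k, X.score p.1 β (X.ηhat p.1 ω) (X.Z p.1 p.2 ω) :=
  (X.sum_obsIdx k fun j i => X.score j β (X.ηhat j ω) (X.Z j i ω)).symm

theorem goodShift_eq (h : X.SmallTuning M C ρ e r) {ω : X.Ω} (hω : X.GoodSample M L C e ω)
    {j : Fin X.m} (z : X.Obs j) : X.goodShift M j (X.Y j ω) z
    = X.score j (X.θs j) (X.ηhat j ω) z - X.score j (X.θs j) (X.ηs j) z := by
  have : X.Y j ω ∈ X.goodTrain M j := ⟨(hω.train j).1, (hω.train j).2.trans h.e_le⟩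
  rw [goodShift, indicator_of_mem this]
  rfl

variable (h : X.SmallTuning M C ρ e r) (hM : 0 < M) (hR : X.LossRegular M ρ κ r₁ r₂ σ₁ σ₂ σ₃ σ₅)
  (hL : X.HessEnvelope M σ₃ L) {ω : X.Ω} (hω : X.GoodSample M L C e ω)
include h hM hR hL hω

/-- All tasks of a cluster are expanded around the common centroid, so that their linear parts can
be summed. Moving the base point from the target to the centroid costs the norm of the Hessian times
`ξ`. -/
theorem norm_score_remainder_le {j : Fin X.m} (i : Fin (X.n j)) {β : Param d}
    (hβ : ‖β - X.βs (X.cluster j)‖ ≤ r) :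
    ‖X.score j β (X.ηhat j ω) (X.Z j i ω) - X.score j (X.θs j) (X.ηs j) (X.Z j i ω)
        - X.goodShift M j (X.Y j ω) (X.Z j i ω)
        - X.lossHess j (X.θs j) (X.ηs j) (X.Z j i ω) (β - X.βs (X.cluster j))‖
      ≤ ‖X.lossHess j (X.θs j) (X.ηs j) (X.Z j i ω)‖ * X.ξ (X.cluster j)
        + (L j (X.Z j i ω)).toReal * ((2 * r + e)
          * (‖β - X.βs (X.cluster j)‖ + X.ξ (X.cluster j))) := by
  have h1 := h.norm_sub_target_le (j := j) (β := β)
  have h2 : ‖β - X.θs j‖ ≤ 2 * r := by linarith [h.ξ_le (X.cluster j)]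
  have h3 : ‖X.ηhat j ω - X.ηs j‖ ≤ e := (hω.train j).2
  have key := norm_score_sub_linear_le hM hR hL (hω.lt_top j i) (h2.trans h.r_le) (h3.trans h.e_le)
  rw [h.goodShift_eq hω]
  set A := X.lossHess j (X.θs j) (X.ηs j) (X.Z j i ω)
  have e1 : X.score j β (X.ηhat j ω) (X.Z j i ω) - X.score j (X.θs j) (X.ηs j) (X.Z j i ω)
        - (X.score j (X.θs j) (X.ηhat j ω) (X.Z j i ω) - X.score j (X.θs j) (X.ηs j) (X.Z j i ω))
        - A (β - X.βs (X.cluster j))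
      = - A (X.θs j - X.βs (X.cluster j)) + (X.score j β (X.ηhat j ω) (X.Z j i ω)
        - X.score j (X.θs j) (X.ηhat j ω) (X.Z j i ω) - A (β - X.θs j)) := by
    simp only [map_sub]; abel
  rw [e1]
  refine (norm_add_le _ _).trans (add_le_add ?_ (key.trans ?_))
  · rw [norm_neg]
    exact (A.le_opNorm _).trans (mul_le_mul_of_nonneg_left (h.near j) (norm_nonneg _))
  · have := h.e_pos
    have := h.r_pos
    rw [mul_assoc]
    gcongr

/-- The gradient of one task is bounded crudely by four sums over its whole cluster. This suffices
because it is only compared with the within-cluster weights, which can exceed any fixed multiple of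
`nMax`. -/
theorem norm_taskGrad_le {j : Fin X.m} {β : Param d} (hβ : ‖β - X.βs (X.cluster j)‖ ≤ r) :
    ‖X.taskGrad ω j β‖ ≤ 4 * C * X.N (X.cluster j) := by
  set k := X.cluster j with hk
  have hCN : 0 ≤ C * X.N k := mul_nonneg h.C_pos.le (Nat.cast_nonneg _)
  have hr := h.r_pos
  have hobs : ∀ i, ‖X.score j β (X.ηhat j ω) (X.Z j i ω)‖
      ≤ ‖X.score j (X.θs j) (X.ηs j) (X.Z j i ω)‖ + ‖X.goodShift M j (X.Y j ω) (X.Z j i ω)‖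
        + ‖X.lossHess j (X.θs j) (X.ηs j) (X.Z j i ω)‖ + (L j (X.Z j i ω)).toReal := by
    intro i
    have h1 := h.norm_score_remainder_le hM hR hL hω i hβ
    have hξ := h.ξ_le (X.cluster j)
    have hξ0 := h.ξ_nonneg (X.cluster j)
    have hq := h.r_quarter
    have he := h.e_half
    have he0 := h.e_pos
    have hA := norm_nonneg (X.lossHess j (X.θs j) (X.ηs j) (X.Z j i ω))
    have hl : 0 ≤ (L j (X.Z j i ω)).toReal := ENNReal.toReal_nonneg
    have h2 := (X.lossHess j (X.θs j) (X.ηs j) (X.Z j i ω)).le_opNorm (β - X.βs (X.cluster j))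
    have h3 : (2 * r + e) * (‖β - X.βs (X.cluster j)‖ + X.ξ (X.cluster j)) ≤ 1 := by
      have : ‖β - X.βs (X.cluster j)‖ + X.ξ (X.cluster j) ≤ 1 / 2 := by linarith
      have h0 : 0 ≤ ‖β - X.βs (X.cluster j)‖ + X.ξ (X.cluster j) := by positivity
      calc _ ≤ (1:ℝ) * (1 / 2) := by
            refine mul_le_mul ?_ this h0 zero_le_one
            linarith
        _ ≤ 1 := by norm_num
    have h4 := mul_le_mul_of_nonneg_left h3 hl
    have h5 : ‖X.lossHess j (X.θs j) (X.ηs j) (X.Z j i ω)‖ * X.ξ (X.cluster j)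
        + ‖X.lossHess j (X.θs j) (X.ηs j) (X.Z j i ω)‖ * ‖β - X.βs (X.cluster j)‖
        ≤ ‖X.lossHess j (X.θs j) (X.ηs j) (X.Z j i ω)‖ := by
      rw [← mul_add]
      exact mul_le_of_le_one_right hA (by linarith)
    have e1 : X.score j β (X.ηhat j ω) (X.Z j i ω)
        = (X.score j β (X.ηhat j ω) (X.Z j i ω) - X.score j (X.θs j) (X.ηs j) (X.Z j i ω)
        - X.goodShift M j (X.Y j ω) (X.Z j i ω)
        - X.lossHess j (X.θs j) (X.ηs j) (X.Z j i ω) (β - X.βs (X.cluster j)))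
        + X.score j (X.θs j) (X.ηs j) (X.Z j i ω) + X.goodShift M j (X.Y j ω) (X.Z j i ω)
        + X.lossHess j (X.θs j) (X.ηs j) (X.Z j i ω) (β - X.βs (X.cluster j)) := by abel
    rw [e1]
    refine (norm_add_le _ _).trans ((add_le_add (norm_add₃_le ..) le_rfl).trans ?_)
    linarith
  have hj : j ∈ X.S k := mem_S.2 rfl
  calc _ ≤ ∑ i, ‖X.score j β (X.ηhat j ω) (X.Z j i ω)‖ := norm_sum_le _ _
    _ ≤ ∑ i, (‖X.score j (X.θs j) (X.ηs j) (X.Z j i ω)‖ + ‖X.goodShift M j (X.Y j ω) (X.Z j i ω)‖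
        + ‖X.lossHess j (X.θs j) (X.ηs j) (X.Z j i ω)‖ + (L j (X.Z j i ω)).toReal) :=
      Finset.sum_le_sum fun i _ => hobs i
    _ ≤ ∑ j ∈ X.S k, ∑ i, (‖X.score j (X.θs j) (X.ηs j) (X.Z j i ω)‖
        + ‖X.goodShift M j (X.Y j ω) (X.Z j i ω)‖
        + ‖X.lossHess j (X.θs j) (X.ηs j) (X.Z j i ω)‖ + (L j (X.Z j i ω)).toReal) :=
      Finset.single_le_sum (f := fun j => ∑ i, (‖X.score j (X.θs j) (X.ηs j) (X.Z j i ω)‖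
        + ‖X.goodShift M j (X.Y j ω) (X.Z j i ω)‖
        + ‖X.lossHess j (X.θs j) (X.ηs j) (X.Z j i ω)‖ + (L j (X.Z j i ω)).toReal))
        (fun j _ => Finset.sum_nonneg fun i _ => by positivity) hj
    _ = ∑ p ∈ X.obsIdx k, (‖X.score p.1 (X.θs p.1) (X.ηs p.1) (X.Z p.1 p.2 ω)‖
        + ‖X.goodShift M p.1 (X.Y p.1 ω) (X.Z p.1 p.2 ω)‖
        + ‖X.lossHess p.1 (X.θs p.1) (X.ηs p.1) (X.Z p.1 p.2 ω)‖
        + (L p.1 (X.Z p.1 p.2 ω)).toReal) :=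
      (X.sum_obsIdx k fun j i => ‖X.score j (X.θs j) (X.ηs j) (X.Z j i ω)‖
        + ‖X.goodShift M j (X.Y j ω) (X.Z j i ω)‖
        + ‖X.lossHess j (X.θs j) (X.ηs j) (X.Z j i ω)‖ + (L j (X.Z j i ω)).toReal).symm
    _ ≤ _ := by
      simp only [Finset.sum_add_distrib]
      linarith [(hω.cluster k).scores, (hω.cluster k).shifts, (hω.cluster k).hess, (hω.cluster k).envelope]

/-- The pooled gradient of a cluster is affine up to a small error. -/
theorem norm_sum_taskGrad_sub_le (k : Fin X.K) {β : Param d} (hβ : ‖β - X.βs k‖ ≤ r) :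
    ‖∑ j ∈ X.S k, X.taskGrad ω j β - X.scoreSum k ω - X.pooledHess k (β - X.βs k)‖
      ≤ (e + C * (2 * r + e)) * X.N k * ‖β - X.βs k‖
        + (e + C * e + C * (2 * r + e) * e) * √(X.N k) := by
  set x := ‖β - X.βs k‖ with hx
  set A : (Σ j, Fin (X.n j)) → Param d →L[ℝ] Param d :=
    fun p => X.lossHess p.1 (X.θs p.1) (X.ηs p.1) (X.Z p.1 p.2 ω) with hA
  -- Three sources of error: the remainders of the expansions, the nuisance shift, and the
  -- fluctuation of the empirical Hessians around those of the risk.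
  have e1 : ∑ j ∈ X.S k, X.taskGrad ω j β - X.scoreSum k ω - X.pooledHess k (β - X.βs k)
      = ∑ p ∈ X.obsIdx k, (X.score p.1 β (X.ηhat p.1 ω) (X.Z p.1 p.2 ω)
          - X.score p.1 (X.θs p.1) (X.ηs p.1) (X.Z p.1 p.2 ω)
          - X.goodShift M p.1 (X.Y p.1 ω) (X.Z p.1 p.2 ω) - A p (β - X.βs k))
        + ∑ p ∈ X.obsIdx k, X.goodShift M p.1 (X.Y p.1 ω) (X.Z p.1 p.2 ω)
        + (∑ p ∈ X.obsIdx k, (A p - X.riskHess p.1 (X.θs p.1))) (β - X.βs k) := by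
    rw [sum_taskGrad, scoreSum, pooledHess]
    simp only [Finset.sum_sub_distrib, sub_apply, sum_apply]
    abel
  rw [e1]
  have hcl : ∀ p ∈ X.obsIdx k, X.cluster p.1 = k := fun p hp =>
    mem_S.1 (Finset.mem_sigma.1 hp).1
  have b1 : ‖∑ p ∈ X.obsIdx k, (X.score p.1 β (X.ηhat p.1 ω) (X.Z p.1 p.2 ω)
          - X.score p.1 (X.θs p.1) (X.ηs p.1) (X.Z p.1 p.2 ω)
          - X.goodShift M p.1 (X.Y p.1 ω) (X.Z p.1 p.2 ω) - A p (β - X.βs k))‖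
      ≤ C * X.N k * X.ξ k + C * X.N k * ((2 * r + e) * (x + X.ξ k)) := by
    refine (norm_sum_le_of_le (X.obsIdx k) (f := fun p => X.score p.1 β (X.ηhat p.1 ω) (X.Z p.1 p.2 ω)
          - X.score p.1 (X.θs p.1) (X.ηs p.1) (X.Z p.1 p.2 ω)
          - X.goodShift M p.1 (X.Y p.1 ω) (X.Z p.1 p.2 ω) - A p (β - X.βs k))
      (n := fun p => ‖A p‖ * X.ξ k
      + (L p.1 (X.Z p.1 p.2 ω)).toReal * ((2 * r + e) * (x + X.ξ k))) fun p hp => ?_).trans ?_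
    · have hp' := hcl p hp
      have := h.norm_score_remainder_le hM hR hL hω p.2 (β := β) (by rw [hp']; exact hβ)
      rw [hp'] at this
      exact this
    · rw [Finset.sum_add_distrib, ← Finset.sum_mul, ← Finset.sum_mul]
      have := h.ξ_nonneg k
      have := h.e_pos
      have := h.r_pos
      exact add_le_add (mul_le_mul_of_nonneg_right ((hω.cluster k).hess) (by positivity))
        (mul_le_mul_of_nonneg_right ((hω.cluster k).envelope) (by positivity))
  have b3 : ‖(∑ p ∈ X.obsIdx k, (A p - X.riskHess p.1 (X.θs p.1))) (β - X.βs k)‖ ≤ e * X.N k * x :=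
    ContinuousLinearMap.le_of_opNorm_le _ ((hω.cluster k).hessDev) _
  have hNξ : X.N k * X.ξ k ≤ e * √(X.N k) := by
    have := mul_le_mul_of_nonneg_left (h.ξ_small k) (Real.sqrt_nonneg (X.N k))
    rw [← mul_assoc, Real.mul_self_sqrt (Nat.cast_nonneg _)] at this
    linarith
  refine (norm_add₃_le ..).trans ((add_le_add_three b1 ((hω.cluster k).shift) b3).trans ?_)
  have h2 := mul_le_mul_of_nonneg_left hNξ h.C_pos.le
  have h3 := mul_le_mul_of_nonneg_left hNξ
    (mul_nonneg h.C_pos.le (by linarith [h.e_pos, h.r_pos] : 0 ≤ 2 * r + e))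
  nlinarith

/-- Beyond a distance of order N^(-1/2) the curvature term, at least (ρ/2) N x² after the Hessian
errors, dominates the score term C√N x and the remaining errors 2√N x, the cross penalty included.
-/
theorem inner_sum_taskGrad_gt (hρ : 0 < ρ) (k : Fin X.K) {β : Param d} (hβ : ‖β - X.βs k‖ ≤ r)
    (hβ' : 2 * (C + 2) / (ρ * √(X.N k)) < ‖β - X.βs k‖) :
    X.ε * X.m * (X.S k).card * ‖β - X.βs k‖
      < inner ℝ (∑ j ∈ X.S k, X.taskGrad ω j β) (β - X.βs k) := by
  have hexp := h.norm_sum_taskGrad_sub_le hM hR hL hω k hβ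
  have hc := pooledHess_coercive hM hR k (β - X.βs k)
  have hsc := (hω.cluster k).score
  set x := ‖β - X.βs k‖ with hx
  set w := √(X.N k) with hw
  have hN : (X.N k : ℝ) = w * w := (Real.mul_self_sqrt (Nat.cast_nonneg _)).symm
  have hw0 : 0 < w := Real.sqrt_pos.2 (by exact_mod_cast h.N_pos k)
  set E := ∑ j ∈ X.S k, X.taskGrad ω j β - X.scoreSum k ω - X.pooledHess k (β - X.βs k) with hE
  have e1 : ∑ j ∈ X.S k, X.taskGrad ω j β
      = X.pooledHess k (β - X.βs k) + (E + X.scoreSum k ω) := by rw [hE]; abel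
  have h1 : -(‖E + X.scoreSum k ω‖ * x) ≤ inner ℝ (E + X.scoreSum k ω) (β - X.βs k) :=
    (abs_le.1 (abs_real_inner_le_norm _ _)).1
  have h2 : ‖E + X.scoreSum k ω‖ ≤ ((e + C * (2 * r + e)) * X.N k * x
      + (e + C * e + C * (2 * r + e) * e) * w) + C * w :=
    (norm_add_le _ _).trans (add_le_add hexp hsc)
  rw [e1, inner_add_left]
  have hx0 : 0 < x := lt_of_le_of_lt (div_nonneg (by linarith [h.C_pos]) (by positivity)) hβ'
  have h3 := mul_le_mul_of_nonneg_right h2 hx0.le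
  have h4 := mul_le_mul_of_nonneg_right (h.penalty k) hx0.le
  rw [div_lt_iff₀ (by positivity)] at hβ'
  have h5 : (e + C * (2 * r + e)) * X.N k * x * x ≤ ρ / 2 * X.N k * x * x := by
    have := h.small
    gcongr
  have h6 : (2 * e + C * e + C * (2 * r + e) * e) * (w * x) ≤ 2 * (w * x) :=
    mul_le_mul_of_nonneg_right h.small' (by positivity)
  have h7 : 2 * (C + 2) * (w * x) < x * (ρ * w) * (w * x) :=
    mul_lt_mul_of_pos_right hβ' (by positivity)
  rw [hN] at h3 h5 hc
  nlinarith

/-- The empirical fusion problem is regular on good samples. -/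
theorem fusionRegular (hρ : 0 < ρ) (hε : 0 ≤ X.ε) {Λ : ℝ} (hΛ : 8 * C * X.nMax < Λ) :
    FusionRegular X.cluster Λ X.ε (fun j β => X.f j ω β (X.ηhat j ω)) (X.taskGrad ω) X.βs r (r / 2)
      (8 * C * X.nMax) where
  eps_nonneg := hε
  bound_lt := hΛ
  bound_nonneg := by have := h.C_pos; positivity
  radius_nonneg := by linarith [h.r_pos]
  radius_lt := by linarith [h.r_pos]
  convex := fun j => convexOn_finset_sum convex_univ Finset.univ fun i _ =>
    hR.convex j _ ((hω.train j).2.trans h.e_le) _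
  grad := fun j x hx => by
    rw [hasGradientAt_iff_hasFDerivAt, taskGrad, map_sum]
    refine HasFDerivAt.fun_sum fun i _ => ?_
    have h1 := h.norm_sub_target_le (j := j) (β := x)
    exact (hR.smooth j x (X.ηhat j ω) (by linarith [h.ξ_le (X.cluster j), h.r_le])
      ((hω.train j).2.trans h.e_le) (X.Z j i ω)).hasGradientAt.hasFDerivAt
  grad_le := fun j x hx => by
    refine (h.norm_taskGrad_le hM hR hL hω hx).trans ?_
    -- The pooled size is at most the number of tasks times `nMax`, so 4 C N has the form g |fiber|
    -- / 2 with g = 8 C `nMax`.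
    have h1 : (X.N (X.cluster j) : ℝ) ≤ (fiber X.cluster (X.cluster j)).card * X.nMax := by
      have : X.N (X.cluster j) ≤ (X.S (X.cluster j)).card • X.nMax :=
        Finset.sum_le_card_nsmul _ _ _ fun i _ => le_ciSup (finite_range X.n).bddAbove i
      rw [smul_eq_mul] at this
      exact_mod_cast this
    have := mul_le_mul_of_nonneg_left h1 (by linarith [h.C_pos] : 0 ≤ 4 * C)
    linarith
  curved := fun k x hx hx' =>
    h.inner_sum_taskGrad_gt hM hR hL hω hρ k hx ((h.radius k).trans_lt hx')

/-- On good samples the fused estimator is asymptotically linear in the scores. -/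
theorem norm_estimator_sub_le (hρ : 0 < ρ) (hε : 0 ≤ X.ε) {Λ c_w γ : ℝ} (hΛ : 8 * C * X.nMax < Λ)
    (hpen : ∀ j i, X.cluster j = X.cluster i → ENNReal.ofReal Λ ≤ X.pen c_w γ ω j i)
    (hpen' : ∀ j i, X.cluster j ≠ X.cluster i → X.pen c_w γ ω j i = ENNReal.ofReal X.ε)
    (hest : X.IsFusionEstimator c_w γ) (j : Fin X.m) {u : Param d}
    (hu : X.pooledHess (X.cluster j) u = -(√(X.N (X.cluster j)) • X.scoreSum (X.cluster j) ω)) :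
    ‖√(X.N (X.cluster j)) • (X.θhat ω j - X.θs j) - u‖
      ≤ e + ρ⁻¹ * (2 * e + C * e + C * (2 * r + e) * e
        + (e + C * (2 * r + e)) * (2 * (C + 2) / ρ)) := by
  obtain ⟨h1, h2⟩ := (h.fusionRegular hM hR hL hω hρ hε hΛ).extended_minimizer_spec hpen hpen'
    (obj := X.objective c_w γ ω) (fun ϑ => rfl) (hest ω) j
  set k := X.cluster j with hk
  set Δ := X.θhat ω j - X.βs k with hΔ
  set w := √(X.N k) with hw
  have hN : (X.N k : ℝ) = w * w := (Real.mul_self_sqrt (Nat.cast_nonneg _)).symm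
  have hw0 : 0 < w := Real.sqrt_pos.2 (by exact_mod_cast h.N_pos k)
  have hΔr : ‖Δ‖ ≤ r := h1.trans (by linarith [h.r_pos])
  have h2' : ‖∑ i ∈ X.S k, X.taskGrad ω i (X.θhat ω j)‖ ≤ e * w := h2.trans (h.penalty k)
  -- Regularity of the fusion problem localizes the minimizer only at the fixed radius r/2.
  -- Confronting the strict curvature inequality with the stationarity bound improves this to the
  -- rate N^(-1/2).
  have hΔR : ‖Δ‖ ≤ 2 * (C + 2) / (ρ * w) := by
    by_contra hcon
    rw [not_le] at hcon
    have h3 := h.inner_sum_taskGrad_gt hM hR hL hω hρ k hΔr hcon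
    have h4 := real_inner_le_norm (∑ i ∈ X.S k, X.taskGrad ω i (X.θhat ω j)) Δ
    have h5 := mul_le_mul_of_nonneg_right h2 (norm_nonneg Δ)
    exact absurd (h3.trans_le (h4.trans h5)) (lt_irrefl _)
  have hwΔ : w * ‖Δ‖ ≤ 2 * (C + 2) / ρ := by
    rw [le_div_iff₀ (by positivity)] at hΔR ⊢
    linarith
  have hexp := h.norm_sum_taskGrad_sub_le hM hR hL hω k hΔr
  set q := e + C * (2 * r + e) with hq
  have hq0 : 0 ≤ q := by have := h.C_pos; have := h.e_pos; have := h.r_pos; positivity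
  have h6 : ‖X.pooledHess k Δ + X.scoreSum k ω‖
      ≤ (2 * e + C * e + C * (2 * r + e) * e + q * (2 * (C + 2) / ρ)) * w := by
    have e1 : X.pooledHess k Δ + X.scoreSum k ω = ∑ i ∈ X.S k, X.taskGrad ω i (X.θhat ω j)
      - (∑ i ∈ X.S k, X.taskGrad ω i (X.θhat ω j) - X.scoreSum k ω - X.pooledHess k Δ) := by abel
    rw [e1]
    refine (norm_sub_le _ _).trans ((add_le_add h2' hexp).trans ?_)
    have := mul_le_mul_of_nonneg_left hwΔ (mul_nonneg hq0 hw0.le)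
    rw [← hw, ← hΔ, hN]
    linarith
  -- The vector u solves the linearized equation exactly, so the pooled Hessian applied to the
  -- difference is √N times the residual; coercivity with constant ρN bounds the difference.
  have h7 : ‖w • Δ - u‖ ≤ ρ⁻¹ * (2 * e + C * e + C * (2 * r + e) * e + q * (2 * (C + 2) / ρ)) := by
    have e2 : X.pooledHess k (w • Δ - u) = w • (X.pooledHess k Δ + X.scoreSum k ω) := by
      rw [map_sub, map_smul, hu]; simp [smul_add]
    have h8 := pooledHess_coercive hM hR k (w • Δ - u)
    have h9 := (real_inner_le_norm (X.pooledHess k (w • Δ - u)) (w • Δ - u))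
    rw [e2, norm_smul, Real.norm_eq_abs, abs_of_pos hw0] at h9
    rw [e2] at h8
    set y := ‖w • Δ - u‖ with hy
    rcases (norm_nonneg (w • Δ - u)).eq_or_lt with h0 | h0
    · rw [hy, ← h0]
      have := h.C_pos; have := h.e_pos; have := h.r_pos; positivity
    have h10 := mul_le_mul_of_nonneg_left h6 hw0.le
    have h11 : (ρ * y) * (w * w * y)
        ≤ (2 * e + C * e + C * (2 * r + e) * e + q * (2 * (C + 2) / ρ)) * (w * w * y) := by
      have := mul_le_mul_of_nonneg_right h10 h0.le
      rw [hN] at h8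
      linarith
    have h12 := le_of_mul_le_mul_right h11 (mul_pos (mul_pos hw0 hw0) h0)
    rw [inv_mul_eq_div, le_div_iff₀ hρ]
    linarith
  have e3 : w • (X.θhat ω j - X.θs j) - u = w • (X.βs k - X.θs j) + (w • Δ - u) := by
    rw [hΔ]; simp only [smul_sub]; abel
  rw [e3]
  refine (norm_add_le _ _).trans (add_le_add ?_ h7)
  rw [norm_smul, Real.norm_eq_abs, abs_of_pos hw0, norm_sub_rev]
  exact (mul_le_mul_of_nonneg_left (h.near j) hw0.le).trans (h.ξ_small k)

end SmallTuning

end Model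

end Multitask

/-! ### Adaptive penalties and the probability of bad samples -/

namespace Multitask

theorem ofReal_mul_rpow_neg_le {F : Type*} [SeminormedAddCommGroup F] {c γ D : ℝ} (hγ : 0 ≤ γ)
    (hD : 0 < D) (hc : 0 ≤ c) {x : F} (hx : ‖x‖ ≤ D) :
    ENNReal.ofReal (c * D ^ (-γ)) ≤ ENNReal.ofReal c * ‖x‖ₑ ^ (-γ) := by
  rw [ENNReal.ofReal_mul hc, ← ENNReal.ofReal_rpow_of_pos hD, ← ofReal_norm, ENNReal.rpow_neg,
    ENNReal.rpow_neg]
  gcongr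

theorem ofReal_mul_rpow_neg_ge {F : Type*} [SeminormedAddCommGroup F] {c γ D : ℝ} (hγ : 0 ≤ γ)
    (hD : 0 < D) (hc : 0 ≤ c) {x : F} (hx : D ≤ ‖x‖) :
    ENNReal.ofReal c * ‖x‖ₑ ^ (-γ) ≤ ENNReal.ofReal (c * D ^ (-γ)) := by
  rw [ENNReal.ofReal_mul hc, ← ENNReal.ofReal_rpow_of_pos hD, ← ofReal_norm, ENNReal.rpow_neg,
    ENNReal.rpow_neg]
  gcongr

namespace Model

variable {d : ℕ} {X : Model d}

theorem NearHomogeneous.radius_nonneg {δ : ℝ} (h : X.NearHomogeneous δ) (k : Fin X.K) : 0 ≤ X.ξ k := by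
  obtain ⟨j, rfl⟩ := h.nonempty k
  exact (norm_nonneg _).trans (h.near j)

theorem nMin_le (j : Fin X.m) : X.nMin ≤ X.n j := ciInf_le (OrderBot.bddBelow _) j

/-- When the pilots are accurate, the adaptive penalties separate the clusters. -/
theorem pen_spec {δ c_w γ α ζ c₀ c₁ c₂ c_ξ a : ℝ} {ω : X.Ω} (hc_w : 0 < c_w) (hγ : 0 < γ)
    (hδ : 0 < δ) (hα : 0 < α)
    (hc₂ : c_w * (δ / 2) ^ (-γ) ≤ c₂) (ha : 0 < a) (hn : 0 < X.nMin)
    (hcl : X.NearHomogeneous δ) (ht : X.Tuned c_w γ α ζ c₀ c₁ c₂ c_ξ)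
    (hξ : ∀ k, X.ξ k ≤ a * (X.nMin : ℝ) ^ (-α)) (ha' : 4 * a ≤ δ / 2)
    (hc₂' : c₂ ≤ c_w * (4 * a) ^ (-γ))
    (hω : ∀ j, (X.n j : ℝ) ^ α * ‖X.pilot j ω - X.θs j‖ < a) :
    (∀ j i, X.cluster j = X.cluster i →
      ENNReal.ofReal (c_w * (4 * a) ^ (-γ) * (c₀ * X.nMax)) ≤ X.pen c_w γ ω j i) ∧
    (∀ j i, X.cluster j ≠ X.cluster i → X.pen c_w γ ω j i = ENNReal.ofReal X.ε) := by
  have hn' : (1:ℝ) ≤ X.nMin := by exact_mod_cast hn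
  have hn0 : (0:ℝ) < X.nMin := by linarith
  set ν := (X.nMin : ℝ) ^ (-α) with hν
  have hν0 : 0 < ν := Real.rpow_pos_of_pos hn0 _
  have hν1 : ν ≤ 1 := Real.rpow_le_one_of_one_le_of_nonpos hn' (by linarith)
  have hp : ∀ j, ‖X.pilot j ω - X.θs j‖ ≤ a * ν := fun j => by
    have h1 : (X.nMin : ℝ) ^ α ≤ (X.n j : ℝ) ^ α :=
      Real.rpow_le_rpow hn0.le (by exact_mod_cast X.nMin_le j) hα.le
    have h2 : (X.nMin : ℝ) ^ α * ‖X.pilot j ω - X.θs j‖ ≤ a :=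
      (mul_le_mul_of_nonneg_right h1 (norm_nonneg _)).trans (hω j).le
    rw [hν, Real.rpow_neg hn0.le, ← div_eq_mul_inv, le_div_iff₀ (by positivity)]
    linarith
  have hb : ∀ j, ‖X.pilot j ω - X.βs (X.cluster j)‖ ≤ 2 * a * ν := fun j => by
    have := norm_sub_le_norm_sub_add_norm_sub (X.pilot j ω) (X.θs j) (X.βs (X.cluster j))
    linarith [hp j, hcl.near j, hξ (X.cluster j)]
  -- Pilots of the same cluster are within 4aν of each other with ν = `nMin`^(-α), so their weights
  -- carry the power `nMin`^(αγ) that the size condition compares with `nMax`.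
  have hpow : (4 * a * ν) ^ (-γ) = (4 * a) ^ (-γ) * (X.nMin : ℝ) ^ (α * γ) := by
    rw [Real.mul_rpow (by positivity) hν0.le, hν, ← Real.rpow_mul hn0.le]
    ring_nf
  have hξM : 0 ≤ X.ξMax := Real.iSup_nonneg fun k => hcl.radius_nonneg k
  have hnp : 0 < (X.nMin : ℝ) ^ (α * γ) := Real.rpow_pos_of_pos hn0 _
  have h4 : 0 < (4 * a) ^ (-γ) := Real.rpow_pos_of_pos (by positivity) _
  -- Dropping `ξMax` from the base of the negative power only increases it, and c₂ is below c_w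
  -- (4a)^(-γ); hence the threshold lies below every within-cluster weight.
  have hτ : X.τ < c_w * (4 * a * ν) ^ (-γ) := by
    refine ht.τ_lt.trans_le ?_
    have h1 : (ν + X.ξMax) ^ (-γ) ≤ ν ^ (-γ) :=
      Real.rpow_le_rpow_of_nonpos hν0 (by linarith) (by linarith)
    have h2 : ν ^ (-γ) = (X.nMin : ℝ) ^ (α * γ) := by
      rw [hν, ← Real.rpow_mul hn0.le]; ring_nf
    have hc0 : 0 ≤ c₂ := le_trans (by positivity) hc₂
    calc _ ≤ c₂ * ν ^ (-γ) := by gcongr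
      _ ≤ (c_w * (4 * a) ^ (-γ)) * ν ^ (-γ) := by
        have : 0 ≤ ν ^ (-γ) := by positivity
        gcongr
      _ = _ := by rw [h2, hpow]; ring
  constructor
  · intro j i hji
    have hd : ‖X.pilot j ω - X.pilot i ω‖ ≤ 4 * a * ν := by
      have := norm_sub_le_norm_sub_add_norm_sub (X.pilot j ω) (X.βs (X.cluster j)) (X.pilot i ω)
      have h1 := hb i
      rw [← hji, norm_sub_rev] at h1
      linarith [hb j]
    have hw : ENNReal.ofReal (c_w * (4 * a * ν) ^ (-γ)) ≤ X.w c_w γ ω j i :=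
      ofReal_mul_rpow_neg_le hγ.le (by positivity) hc_w.le hd
    have hlt : ¬ X.w c_w γ ω j i ≤ ENNReal.ofReal X.τ := by
      rw [not_le]
      refine lt_of_lt_of_le ?_ hw
      exact (ENNReal.ofReal_lt_ofReal_iff (by positivity)).2 hτ
    rw [pen, if_neg hlt]
    refine le_trans (ENNReal.ofReal_le_ofReal ?_) hw
    rw [hpow, mul_assoc]
    exact mul_le_mul_of_nonneg_left (mul_le_mul_of_nonneg_left ht.size h4.le) hc_w.le
  · intro j i hji
    have hd : δ / 2 ≤ ‖X.pilot j ω - X.pilot i ω‖ := by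
      have h1 := hcl.separated _ _ hji
      have h2 : X.βs (X.cluster j) - X.βs (X.cluster i)
        = -(X.pilot j ω - X.βs (X.cluster j)) + (X.pilot j ω - X.pilot i ω)
          + (X.pilot i ω - X.βs (X.cluster i)) := by abel
      rw [h2] at h1
      have h3 := h1.trans (norm_add₃_le ..)
      rw [norm_neg] at h3
      have h5 : a * ν ≤ a := mul_le_of_le_one_right ha.le hν1
      linarith [hb j, hb i]
    have hw : X.w c_w γ ω j i ≤ ENNReal.ofReal X.τ :=
      (ofReal_mul_rpow_neg_ge hγ.le (by positivity) hc_w.le hd).trans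
        (ENNReal.ofReal_le_ofReal (hc₂.trans ht.lt_τ.le))
    rw [pen, if_pos hw]

section BadSample

variable {M ρ κ r₁ r₂ σ₁ σ₂ σ₃ σ₄ σ₅ : ℝ} {L : ∀ j, X.Obs j → ℝ≥0∞} {s : ℕ → ℝ}

/-- Chebyshev's inequality is used column by column. The threshold is divided by d + 1 instead of d
so that it makes sense for d = 0. -/
theorem measure_hessDev_le (hM : 0 < M) (hr₂ : 2 < r₂) (hσ₂ : 0 < σ₂)
    (hS : X.Sampling) (hR : X.LossRegular M ρ κ r₁ r₂ σ₁ σ₂ σ₃ σ₅) (k : Fin X.K) {e : ℝ}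
    (he : 0 < e) (hN : 0 < X.N k) :
    X.μ.real {ω | e * X.N k < ‖∑ p ∈ X.obsIdx k, (X.lossHess p.1 (X.θs p.1) (X.ηs p.1)
        (X.Z p.1 p.2 ω) - X.riskHess p.1 (X.θs p.1))‖}
      ≤ d * (hessVar d σ₂ * (d + 1) ^ 2 / e ^ 2 * (X.N k : ℝ)⁻¹) := by
  have hN' : (0:ℝ) < X.N k := by exact_mod_cast hN
  have ht : 0 < e * X.N k / (d + 1) := by positivity
  have hcol : ∀ b : Fin d, X.μ.real {ω | e * X.N k / (d + 1) ≤ ‖∑ p ∈ X.obsIdx k,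
      (X.lossHess p.1 (X.θs p.1) (X.ηs p.1) (X.Z p.1 p.2 ω) - X.riskHess p.1 (X.θs p.1))
        (EuclideanSpace.single b 1)‖} ≤ hessVar d σ₂ * (d + 1) ^ 2 / e ^ 2 * (X.N k : ℝ)⁻¹ := by
    intro b
    have h1 : Continuous fun A : Param d →L[ℝ] Param d => A (EuclideanSpace.single b 1) := by
      fun_prop
    refine (hS.measure_le_norm_sum_le k (g := fun j z => (X.lossHess j (X.θs j) (X.ηs j) z
      - X.riskHess j (X.θs j)) (EuclideanSpace.single b 1))
      (fun j => h1.measurable.comp ((measurable_lossHess hM hS hR j).sub_const _))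
      (fun j => (column_moments hM hr₂ hσ₂ hS hR j b).1) (fun j => ?_)
      (B := fun _ => hessVar d σ₂) (fun j => (column_moments hM hr₂ hσ₂ hS hR j b).2) ht).trans
      (le_of_eq ?_)
    · have hi := integrable_lossHess hM hr₂ hσ₂ hS hR j
      simp only [sub_apply]
      rw [integral_sub (hi.apply_continuousLinearMap _) (integrable_const _),
        riskHess_eq_integral hM hr₂ hσ₂ hS hR j, ContinuousLinearMap.integral_apply hi]
      simp
    · rw [← Finset.sum_mul, ← Nat.cast_sum]
      change (X.N k : ℝ) * _ / _ = _
      field_simp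
  have hsub : {ω | e * X.N k < ‖∑ p ∈ X.obsIdx k, (X.lossHess p.1 (X.θs p.1) (X.ηs p.1)
        (X.Z p.1 p.2 ω) - X.riskHess p.1 (X.θs p.1))‖} ⊆ ⋃ b ∈ (Finset.univ : Finset (Fin d)),
      {ω | e * X.N k / (d + 1) ≤ ‖∑ p ∈ X.obsIdx k,
      (X.lossHess p.1 (X.θs p.1) (X.ηs p.1) (X.Z p.1 p.2 ω) - X.riskHess p.1 (X.θs p.1))
        (EuclideanSpace.single b 1)‖} := by
    intro ω hω
    by_contra hcon
    simp only [mem_iUnion, mem_ofPred_eq, not_exists, not_le, Finset.mem_univ, true_implies] at hcon hω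
    have h2 := (norm_clm_le_sum (∑ p ∈ X.obsIdx k, (X.lossHess p.1 (X.θs p.1) (X.ηs p.1)
        (X.Z p.1 p.2 ω) - X.riskHess p.1 (X.θs p.1)))).trans
      (Finset.sum_le_sum (g := fun _ => e * X.N k / (d + 1)) fun b _ => by
        rw [sum_apply]; exact (hcon b).le)
    simp only [Finset.sum_const, Finset.card_univ, Fintype.card_fin, nsmul_eq_mul] at h2
    have h3 : (d:ℝ) * (e * X.N k / (d + 1)) ≤ e * X.N k := by
      rw [mul_div_assoc', div_le_iff₀ (by positivity)]
      nlinarith [mul_pos he hN']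
    linarith
  refine (measureReal_mono hsub (measure_ne_top _ _)).trans ((measureReal_biUnion_finset_le _ _).trans
    ((Finset.sum_le_sum fun b _ => hcol b).trans (by simp)))

theorem sum_div_sq_le {S₀ : ℝ} (hS₀ : 0 < S₀) (hs : ∀ j, S₀ ≤ s (X.n j)) (k : Fin X.K) :
    ∑ j ∈ X.S k, X.n j / s (X.n j) ^ 2 ≤ X.N k / S₀ ^ 2 := by
  rw [N, Nat.cast_sum, Finset.sum_div]
  refine Finset.sum_le_sum fun j _ => ?_
  have := hs j
  gcongr

/-- Pull out the maximum of √n_j / s(n_j)² and apply Cauchy-Schwarz to the sum of √n_j; the factor K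
in `b` is at least one and is simply given away. -/
theorem sum_div_sq_le_b (s : ℕ → ℝ) (k : Fin X.K) :
    ∑ j ∈ X.S k, X.n j / s (X.n j) ^ 2 ≤ X.b s k * √(X.N k) := by
  set A := ⨆ j : X.S k, √(X.n j) / s (X.n j) ^ 2 with hA
  have hA0 : 0 ≤ A := Real.iSup_nonneg fun j => by positivity
  have hbd : BddAbove (range fun j : X.S k => √(X.n j) / s (X.n j) ^ 2) := (finite_range _).bddAbove
  have h1 : ∑ j ∈ X.S k, X.n j / s (X.n j) ^ 2 ≤ A * ∑ j ∈ X.S k, √(X.n j) := by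
    rw [Finset.mul_sum]
    refine Finset.sum_le_sum fun j hj => ?_
    have h2 := le_ciSup hbd ⟨j, hj⟩
    have h3 := mul_le_mul_of_nonneg_right h2 (Real.sqrt_nonneg (X.n j))
    refine le_trans (le_of_eq ?_) h3
    rw [div_mul_eq_mul_div, Real.mul_self_sqrt (Nat.cast_nonneg _)]
  have h2 : ∑ j ∈ X.S k, √(X.n j) ≤ √(X.S k).card * √(X.N k) := by
    rw [← Real.sqrt_mul (Nat.cast_nonneg _)]
    refine Real.le_sqrt_of_sq_le ((sq_sum_le_card_mul_sum_sq).trans (le_of_eq ?_))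
    rw [N, Nat.cast_sum]
    congr 1
    exact Finset.sum_congr rfl fun j _ => Real.sq_sqrt (Nat.cast_nonneg _)
  have hK : (1:ℝ) ≤ X.K := by
    have := k.pos
    exact_mod_cast this
  calc _ ≤ A * (√(X.S k).card * √(X.N k)) := h1.trans (mul_le_mul_of_nonneg_left h2 hA0)
    _ ≤ X.K * (A * (√(X.S k).card * √(X.N k))) := le_mul_of_one_le_left (by positivity) hK
    _ = _ := by rw [b]; ring

theorem measure_nuisance_gt_le (hS : X.Sampling) (hσ₄ : 0 < σ₄) (hn : X.NuisanceRate s σ₄) {S₀ e : ℝ}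
    (hS₀ : 0 < S₀) (hs : ∀ j, S₀ ≤ s (X.n j)) (he : 0 < e) (j : Fin X.m) :
    X.μ.real {ω | e < ‖X.ηhat j ω - X.ηs j‖} ≤ σ₄ / (S₀ ^ 2 * e ^ 2) := by
  have hme : Measurable fun ω => ‖X.ηhat j ω - X.ηs j‖ₑ ^ 2 := by
    have h1 : Measurable fun ω => ENNReal.ofReal ‖X.ηhat j ω - X.ηs j‖ :=
      ((hS.measurable_fit j).comp (hS.measurable_Y j)).ennreal_ofReal
    simp_rw [ofReal_norm] at h1
    exact h1.pow_const 2
  have h1 := (mul_meas_ge_le_lintegral (μ := X.μ) hme (ENNReal.ofReal (e ^ 2))).trans (hn j)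
  have h2 : {ω | e < ‖X.ηhat j ω - X.ηs j‖}
      ⊆ {ω | ENNReal.ofReal (e ^ 2) ≤ ‖X.ηhat j ω - X.ηs j‖ₑ ^ 2} :=
    ofPred_subset_ofPred.2 fun ω hω => by
      rw [← ofReal_norm, ← ENNReal.ofReal_pow (norm_nonneg _)]
      exact ENNReal.ofReal_le_ofReal (pow_le_pow_left₀ he.le hω.le 2)
  have h3 := (mul_le_mul_right (measure_mono (μ := X.μ) h2) (ENNReal.ofReal (e ^ 2))).trans h1
  have h4 := hs j
  rw [← ofReal_measureReal, ← ENNReal.ofReal_mul (by positivity),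
    ENNReal.ofReal_le_ofReal_iff (by positivity)] at h3
  have h5 : σ₄ / s (X.n j) ^ 2 ≤ σ₄ / S₀ ^ 2 := by gcongr
  rw [← div_div, le_div_iff₀ (by positivity)]
  linarith

/-- One Markov or Chebyshev bound for each field of `GoodCluster`. The terms over C do not vanish
along the sequence and are controlled by the choice of C; the others vanish for fixed C and e. -/
theorem measure_not_goodCluster_le (hM : 0 < M) (hρ : 0 < ρ) (hκ : 0 < κ) (hr₁ : 2 < r₁)
    (hr₂ : 2 < r₂) (hσ₁ : 0 < σ₁) (hσ₂ : 0 < σ₂) (hσ₃ : 0 < σ₃) (hσ₄ : 0 < σ₄) (hσ₅ : 0 < σ₅)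
    (hS : X.Sampling) (hR : X.LossRegular M ρ κ r₁ r₂ σ₁ σ₂ σ₃ σ₅) (hL : X.HessEnvelope M σ₃ L)
    (hn : X.NuisanceRate s σ₄) {C e S₀ : ℝ} (hC : 0 < C) (he : 0 < e) (hS₀ : 0 < S₀)
    (hs : ∀ j, S₀ ≤ s (X.n j)) (k : Fin X.K) (hN : 0 < X.N k) :
    X.μ.real {ω | ¬ X.GoodCluster M L C e k ω}
      ≤ σ₃ / C + hessMean d κ σ₂ / C + (2 + σ₁) / C + (1 + σ₅ * M ^ 2) / C + (1 + σ₁) / C ^ 2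
        + σ₅ * σ₄ * (4 / (e ^ 2 * S₀ ^ 2) + 2 * X.b s k / e)
        + d * (hessVar d σ₂ * (d + 1) ^ 2 / e ^ 2 * (X.N k : ℝ)⁻¹) := by
  have hN' : (0:ℝ) < X.N k := by exact_mod_cast hN
  have hw : 0 < √(X.N k : ℝ) := Real.sqrt_pos.2 hN'
  have hsc := memLp_score hM hr₁ hσ₁ hS hR
  have F1 := hS.measure_lt_sum_le k (g := fun j z => (L j z).toReal)
    (fun _ _ => ENNReal.toReal_nonneg) hL.integrable (B := σ₃) (fun j => by
      rw [integral_toReal (hL.meas j).aemeasurable (hL.ae_lt_top j)]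
      exact ENNReal.toReal_le_of_le_ofReal hσ₃.le (hL.lintegral_le j)) hC hN
  have F2 := hS.measure_lt_sum_le k (g := fun j z => ‖X.lossHess j (X.θs j) (X.ηs j) z‖)
    (fun _ _ => norm_nonneg _) (fun j => (integrable_lossHess hM hr₂ hσ₂ hS hR j).norm)
    (integral_norm_lossHess_le hM hρ hκ hr₂ hσ₂ hS hR) hC hN
  have F3 := hS.measure_lt_sum_le k (g := fun j z => ‖X.score j (X.θs j) (X.ηs j) z‖)
    (fun _ _ => norm_nonneg _) (fun j => ((hsc j).1.integrable (by norm_num)).norm)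
    (B := 2 + σ₁) (fun j => by
      have hi := (hsc j).1.integrable_norm_pow'
      calc _ ≤ ∫ z, (1 + ‖X.score j (X.θs j) (X.ηs j) z‖ ^ 2) ∂(X.P j) := by
            refine integral_mono ((hsc j).1.integrable (by norm_num)).norm
              ((integrable_const _).add hi) fun z => ?_
            simp only
            nlinarith [sq_nonneg (‖X.score j (X.θs j) (X.ηs j) z‖ - 1)]
        _ ≤ _ := by
            rw [integral_add (integrable_const _) hi]
            have := (hsc j).2
            simp only [integral_const, probReal_univ, one_smul]
            linarith) hC hN
  have F4 := measure_sum_norm_goodShift_le hM hr₂ hσ₂ hσ₅ hS hR k hC hN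
  have F5 : X.μ.real {ω | C * √(X.N k) < ‖X.scoreSum k ω‖} ≤ (1 + σ₁) / C ^ 2 := by
    have h1 := hS.measure_le_norm_sum_le k (g := fun j z => X.score j (X.θs j) (X.ηs j) z)
      (measurable_score_truth hM hS hR) (fun j => (hsc j).1)
      (integral_score hM hr₂ hσ₂ hS hR) (B := fun _ => 1 + σ₁) (fun j => (hsc j).2)
      (t := C * √(X.N k)) (by positivity)
    have h2 : X.μ.real {ω | C * √(X.N k) < ‖X.scoreSum k ω‖}
        ≤ X.μ.real {ω | C * √(X.N k) ≤ ‖X.scoreSum k ω‖} :=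
      measureReal_mono (ofPred_subset_ofPred.2 fun ω hω => le_of_lt hω)
    refine h2.trans (h1.trans (le_of_eq ?_))
    rw [← Finset.sum_mul, ← Nat.cast_sum, mul_pow, Real.sq_sqrt hN'.le]
    change (X.N k : ℝ) * _ / _ = _
    field_simp
  have F6 : X.μ.real {ω | e * √(X.N k)
      < ‖∑ p ∈ X.obsIdx k, X.goodShift M p.1 (X.Y p.1 ω) (X.Z p.1 p.2 ω)‖}
      ≤ σ₅ * σ₄ * (4 / (e ^ 2 * S₀ ^ 2) + 2 * X.b s k / e) := by
    refine (measure_goodShift_le hM hr₂ hσ₂ hσ₅ hS hR hσ₄ hn k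
      (t := e * √(X.N k)) (by positivity)).trans ?_
    have h1 := sum_div_sq_le hS₀ hs k
    have h2 := sum_div_sq_le_b s k
    set Q := ∑ j ∈ X.S k, X.n j / s (X.n j) ^ 2
    -- The variance of the nuisance shift requires only S₀ to grow, whereas its bias is measured
    -- against √N, and this is where `b` is needed.
    have h3 : 4 / (e * √(X.N k)) ^ 2 * Q ≤ 4 / (e ^ 2 * S₀ ^ 2) := by
      calc _ ≤ 4 / (e * √(X.N k)) ^ 2 * (X.N k / S₀ ^ 2) := by gcongr
        _ = _ := by rw [mul_pow, Real.sq_sqrt hN'.le]; field_simp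
    have h4 : 2 / (e * √(X.N k)) * Q ≤ 2 * X.b s k / e := by
      calc _ ≤ 2 / (e * √(X.N k)) * (X.b s k * √(X.N k)) := by gcongr
        _ = _ := by field_simp
    have h5 := mul_le_mul_of_nonneg_left (add_le_add h3 h4) (mul_pos hσ₅ hσ₄).le
    linarith
  have F7 := measure_hessDev_le hM hr₂ hσ₂ hS hR k he hN
  refine le_trans ?_ (add_le_add (add_le_add (add_le_add (add_le_add (add_le_add (add_le_add F1 F2)
    F3) F4) F5) F6) F7)
  refine le_trans (measureReal_mono ?_ (measure_ne_top _ _)) ((measureReal_union_le _ _).trans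
    (add_le_add ((measureReal_union_le _ _).trans (add_le_add ((measureReal_union_le _ _).trans
    (add_le_add ((measureReal_union_le _ _).trans (add_le_add ((measureReal_union_le _ _).trans
    (add_le_add (measureReal_union_le _ _) le_rfl)) le_rfl)) le_rfl)) le_rfl)) le_rfl))
  intro ω hω
  by_contra hcon
  simp only [mem_union, mem_ofPred_eq, not_or, not_lt] at hcon
  obtain ⟨⟨⟨⟨⟨⟨h1, h2⟩, h3⟩, h4⟩, h5⟩, h6⟩, h7⟩ := hcon
  exact hω ⟨h1, h2, h3, h4, h5, h6, h7⟩

/-- A union bound whose factor m, coming from the consistency of all the fitted nuisances, will be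
absorbed by S₀², as S₀ is taken to be m times `a`. -/
theorem measure_not_goodSample_le (hM : 0 < M) (hρ : 0 < ρ) (hκ : 0 < κ) (hr₁ : 2 < r₁)
    (hr₂ : 2 < r₂) (hσ₁ : 0 < σ₁) (hσ₂ : 0 < σ₂) (hσ₃ : 0 < σ₃) (hσ₄ : 0 < σ₄) (hσ₅ : 0 < σ₅)
    (hS : X.Sampling) (hR : X.LossRegular M ρ κ r₁ r₂ σ₁ σ₂ σ₃ σ₅) (hL : X.HessEnvelope M σ₃ L)
    (hn : X.NuisanceRate s σ₄) {C e S₀ n₀ B : ℝ} (hC : 0 < C) (he : 0 < e) (hS₀ : 0 < S₀)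
    (hs : ∀ j, S₀ ≤ s (X.n j)) (hn₀ : 0 < n₀) (hN : ∀ k, n₀ ≤ X.N k) (hB : ∀ k, X.b s k ≤ B) :
    X.μ.real {ω | ¬ X.GoodSample M L C e ω}
      ≤ X.μ.real {ω | ¬ ∀ j, X.ηhat j ω ∈ X.T j} + X.m * (σ₄ / (S₀ ^ 2 * e ^ 2))
        + X.K * (σ₃ / C + hessMean d κ σ₂ / C + (2 + σ₁) / C + (1 + σ₅ * M ^ 2) / C
          + (1 + σ₁) / C ^ 2 + σ₅ * σ₄ * (4 / (e ^ 2 * S₀ ^ 2) + 2 * B / e)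
          + d * (hessVar d σ₂ * (d + 1) ^ 2 / e ^ 2 * n₀⁻¹)) := by
  have hlt : ∀ᵐ ω ∂X.μ, ∀ j i, L j (X.Z j i ω) < ∞ := by
    rw [ae_all_iff]; intro j
    rw [ae_all_iff]; intro i
    exact (hS.measurePreserving_Z j i).quasiMeasurePreserving.ae (hL.ae_lt_top j)
  have hnull : X.μ.real {ω | ¬ ∀ j i, L j (X.Z j i ω) < ∞} = 0 := by
    rw [measureReal_def, ae_iff.1 hlt]; rfl
  have h2 : X.μ.real (⋃ j ∈ (Finset.univ : Finset (Fin X.m)), {ω | e < ‖X.ηhat j ω - X.ηs j‖})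
      ≤ X.m * (σ₄ / (S₀ ^ 2 * e ^ 2)) :=
    (measureReal_biUnion_finset_le _ _).trans ((Finset.sum_le_sum fun j _ =>
      measure_nuisance_gt_le hS hσ₄ hn hS₀ hs he j).trans (by simp))
  have h3 : X.μ.real (⋃ k ∈ (Finset.univ : Finset (Fin X.K)), {ω | ¬ X.GoodCluster M L C e k ω})
      ≤ X.K * (σ₃ / C + hessMean d κ σ₂ / C + (2 + σ₁) / C + (1 + σ₅ * M ^ 2) / C
          + (1 + σ₁) / C ^ 2 + σ₅ * σ₄ * (4 / (e ^ 2 * S₀ ^ 2) + 2 * B / e)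
          + d * (hessVar d σ₂ * (d + 1) ^ 2 / e ^ 2 * n₀⁻¹)) := by
    refine (measureReal_biUnion_finset_le _ _).trans ((Finset.sum_le_sum fun k _ =>
      (measure_not_goodCluster_le hM hρ hκ hr₁ hr₂ hσ₁ hσ₂ hσ₃ hσ₄ hσ₅ hS hR hL hn hC he hS₀ hs k
        (by have := hn₀.trans_le (hN k); exact_mod_cast this)).trans ?_).trans
      (le_of_eq (by rw [Finset.sum_const, nsmul_eq_mul, Finset.card_univ, Fintype.card_fin])))
    have h4 := hB k
    have h5 := hN k
    have h6 := hessVar_nonneg d hσ₂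
    gcongr
  refine le_trans (measureReal_mono (s₂ := (({ω | ¬ ∀ j, X.ηhat j ω ∈ X.T j}
      ∪ (⋃ j ∈ (Finset.univ : Finset (Fin X.m)), {ω | e < ‖X.ηhat j ω - X.ηs j‖}))
      ∪ (⋃ k ∈ (Finset.univ : Finset (Fin X.K)), {ω | ¬ X.GoodCluster M L C e k ω}))
      ∪ {ω | ¬ ∀ j i, L j (X.Z j i ω) < ∞}) ?_ (measure_ne_top _ _)) ?_
  · intro ω hω
    by_contra hcon
    simp only [mem_union, mem_iUnion, mem_ofPred_eq, not_or, not_lt, not_not, not_exists,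
      Finset.mem_univ, true_implies] at hcon
    obtain ⟨⟨⟨g1, g2⟩, g3⟩, g4⟩ := hcon
    exact hω ⟨fun j => ⟨g1 j, g2 j⟩, g4, g3⟩
  · refine (measureReal_union_le _ _).trans ?_
    rw [hnull, add_zero]
    refine (measureReal_union_le _ _).trans (add_le_add ?_ h3)
    exact (measureReal_union_le _ _).trans (add_le_add le_rfl h2)

end BadSample

end Model

end Multitask

namespace Multitask

/-! ### Consequences of the tuning and growth conditions -/

namespace Model

variable {d : ℕ} {X : Model d} {M δ ρ κ r₁ r₂ σ₁ σ₂ σ₃ σ₄ σ₅ c_w γ α ζ c₀ c₁ c₂ c_ξ : ℝ} {s : ℕ → ℝ}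

theorem NearHomogeneous.nMin_le_N (h : X.NearHomogeneous δ) (k : Fin X.K) : X.nMin ≤ X.N k := by
  obtain ⟨j, rfl⟩ := h.nonempty k
  exact (X.nMin_le j).trans (Finset.single_le_sum (f := X.n) (fun _ _ => Nat.zero_le _) (mem_S.2 rfl))

/-- The factor m⁻² in the bound on `ε` pays for the at most m² cross pairs, and ζ < 1/2 leaves a
negative power of `nMin` relative to √N. -/
theorem Tuned.penalty_le (ht : X.Tuned c_w γ α ζ c₀ c₁ c₂ c_ξ) (h : X.NearHomogeneous δ) (hζ : ζ < 1 / 2)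
    (hc₁ : 0 < c₁) (hn : 0 < X.nMin) (k : Fin X.K) :
    X.ε * X.m * (X.S k).card ≤ c₁ * (X.nMin : ℝ) ^ (ζ - 1 / 2) * √(X.N k) := by
  have hm : (0:ℝ) < X.m := by
    obtain ⟨j, -⟩ := h.nonempty k
    exact_mod_cast j.pos
  have : Nonempty (Fin X.K) := ⟨k⟩
  have h1 : X.nMin ≤ X.NMin := le_ciInf h.nMin_le_N
  have h2 : X.NMin ≤ X.N k := ciInf_le (OrderBot.bddBelow _) k
  have hn' : (0:ℝ) < X.nMin := by exact_mod_cast hn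
  have h1' : (X.nMin : ℝ) ≤ X.NMin := by exact_mod_cast h1
  have hN0 : (0:ℝ) < X.NMin := hn'.trans_le h1'
  have hcard : ((X.S k).card : ℝ) ≤ X.m := by
    have := Finset.card_le_univ (X.S k)
    rw [Fintype.card_fin] at this
    exact_mod_cast this
  have h3 : (X.NMin : ℝ) ^ ζ ≤ (X.nMin : ℝ) ^ (ζ - 1 / 2) * √(X.N k) := by
    have e1 : (X.NMin : ℝ) ^ ζ = (X.NMin : ℝ) ^ (ζ - 1 / 2) * √(X.NMin) := by
      rw [Real.sqrt_eq_rpow, ← Real.rpow_add hN0]; ring_nf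
    rw [e1]
    have e2 : (X.NMin : ℝ) ^ (ζ - 1 / 2) ≤ (X.nMin : ℝ) ^ (ζ - 1 / 2) :=
      Real.rpow_le_rpow_of_nonpos hn' h1' (by linarith)
    have e3 : (X.NMin : ℝ) ≤ X.N k := by exact_mod_cast h2
    gcongr
  calc X.ε * X.m * (X.S k).card ≤ X.ε * X.m * X.m := by
        have := ht.ε_nonneg
        gcongr
    _ ≤ (c₁ * ((X.m : ℝ) ^ 2)⁻¹ * (X.NMin : ℝ) ^ ζ) * X.m * X.m := by
        have := ht.ε_le
        gcongr
    _ = c₁ * (X.NMin : ℝ) ^ ζ := by field_simp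
    _ ≤ c₁ * ((X.nMin : ℝ) ^ (ζ - 1 / 2) * √(X.N k)) := by gcongr
    _ = _ := by ring

theorem smallTuning_of_le {C e : ℝ} (hρ : 0 < ρ) (hC : 0 < C) (he : 0 < e) (heM : 2 * e ≤ M)
    (he' : e ≤ 1 / 4) (hsmall : e + C * (2 * e + e) ≤ ρ / 2)
    (hsmall' : 2 * e + C * e + C * (2 * e + e) * e ≤ 2) (h : X.NearHomogeneous δ)
    (ht : X.Tuned c_w γ α ζ c₀ c₁ c₂ c_ξ) (hζ : ζ < 1 / 2) (hc₁ : 0 < c₁) (hn : 0 < X.nMin)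
    (hpen : c₁ * (X.nMin : ℝ) ^ (ζ - 1 / 2) ≤ e)
    (hrad : 2 * (C + 2) / (ρ * √(X.nMin)) ≤ e / 2)
    (hξ : ∀ k, √(X.N k) * X.ξ k ≤ e) : X.SmallTuning M C ρ e e where
  C_pos := hC
  e_pos := he
  r_pos := he
  e_le := by linarith
  r_le := heM
  e_half := by linarith
  r_quarter := he'
  small := hsmall
  small' := hsmall'
  penalty := fun k => (ht.penalty_le h hζ hc₁ hn k).trans
    (mul_le_mul_of_nonneg_right hpen (Real.sqrt_nonneg _))
  N_pos := fun k => hn.trans_le (h.nMin_le_N k)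
  near := h.near
  ξ_le := fun k => by
    have h1 : (1:ℝ) ≤ √(X.N k) := Real.one_le_sqrt.2 (by exact_mod_cast hn.trans_le (h.nMin_le_N k))
    exact (le_mul_of_one_le_left (h.radius_nonneg k) h1).trans (hξ k)
  ξ_small := hξ
  ξ_nonneg := h.radius_nonneg
  radius := fun k => by
    refine le_trans ?_ hrad
    have h1 : (X.nMin : ℝ) ≤ X.N k := by exact_mod_cast h.nMin_le_N k
    have h2 : (0:ℝ) < X.nMin := by exact_mod_cast hn
    have h3 : 0 < √(X.nMin : ℝ) := Real.sqrt_pos.2 h2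
    gcongr

/-- The radii are small at the scale `nMin`^(-1/2), hence also at the coarser pilot scale because α
≤ 1/2. -/
theorem radius_le_of_sqrt_mul_le (h : X.NearHomogeneous δ) (hα' : α ≤ 1 / 2) (hn : 0 < X.nMin)
    {a : ℝ} (ha : 0 < a) {k : Fin X.K} (hξ : √(X.N k) * X.ξ k ≤ a) :
    X.ξ k ≤ a * (X.nMin : ℝ) ^ (-α) := by
  have hn1 : (1:ℝ) ≤ X.nMin := by exact_mod_cast hn
  have hn0 : (0:ℝ) < X.nMin := by linarith
  have h1 : (X.nMin : ℝ) ≤ X.N k := by exact_mod_cast h.nMin_le_N k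
  have h2 : √(X.nMin : ℝ) * X.ξ k ≤ a :=
    (mul_le_mul_of_nonneg_right (Real.sqrt_le_sqrt h1) (h.radius_nonneg k)).trans hξ
  have h3 : (X.nMin : ℝ) ^ (-(1 / 2) : ℝ) ≤ (X.nMin : ℝ) ^ (-α) :=
    Real.rpow_le_rpow_of_exponent_le hn1 (by linarith)
  refine le_trans ?_ (mul_le_mul_of_nonneg_left h3 ha.le)
  rw [Real.rpow_neg hn0.le, ← Real.sqrt_eq_rpow, ← div_eq_mul_inv,
    le_div_iff₀ (Real.sqrt_pos.2 hn0)]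
  linarith

theorem measure_not_pilot_le (hS : X.Sampling) {p : ℝ → ℕ → ℝ} (hp : X.PilotRate α p) {a : ℝ}
    (ha : 0 < a) :
    X.μ.real {ω | ¬ ∀ j, (X.n j : ℝ) ^ α * ‖X.pilot j ω - X.θs j‖ < a} ≤ p a X.nMin := by
  have hm : MeasurableSet {ω | ∀ j, (X.n j : ℝ) ^ α * ‖X.pilot j ω - X.θs j‖ < a} := by
    simp only [ofPred_forall]
    exact MeasurableSet.iInter fun j => measurableSet_lt
      (((hS.measurable_pilot j).sub_const _).norm.const_mul _) measurable_const
  have h1 := hp a ha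
  have h2 := probReal_compl_eq_one_sub (μ := X.μ) hm
  rw [compl_ofPred] at h2
  rw [h2]
  linarith

theorem measure_not_realized_eq (hS : X.Sampling) :
    X.μ.real {ω | ¬ ∀ j, X.ηhat j ω ∈ X.T j} = 1 - (X.μ {ω | ∀ j, X.ηhat j ω ∈ X.T j}).toReal := by
  have hm : MeasurableSet {ω | ∀ j, X.ηhat j ω ∈ X.T j} := by
    simp only [ofPred_forall]
    exact MeasurableSet.iInter fun j => hS.measurable_Y j (hS.measurable_T j)
  have h2 := probReal_compl_eq_one_sub (μ := X.μ) hm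
  rw [compl_ofPred] at h2
  exact h2

theorem a_mul_le (hm : 0 < X.m) (j : Fin X.m) : X.m * X.a r₂ s ≤ s (X.n j) := by
  have hm' : (0:ℝ) < X.m := by exact_mod_cast hm
  rw [a, mul_inv_cancel_left₀ hm'.ne']
  exact (min_le_right _ _).trans (ciInf_le (finite_range _).bddBelow j)

theorem a_le_rpow (hm : 0 < X.m) :
    X.a r₂ s ≤ (X.nMin : ℝ) ^ (r₂ / (2 * (r₂ + d))) := by
  have hm' : (1:ℝ) ≤ X.m := by exact_mod_cast hm
  rw [a, inv_mul_le_iff₀ (by linarith)]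
  refine (min_le_left _ _).trans (le_mul_of_one_le_left (by positivity) hm')

theorem b_nonneg (k : Fin X.K) : 0 ≤ X.b s k := by
  rw [b]
  have : 0 ≤ ⨆ j : X.S k, √(X.n j) / s (X.n j) ^ 2 := Real.iSup_nonneg fun j => by positivity
  positivity

end Model

theorem tendsto_nMin {d : ℕ} {r₂ : ℝ} (hr₂ : 2 < r₂) {s : ℕ → ℝ} {X : ℕ → Model d}
    (hm : ∀ ν, 0 < (X ν).m) (h : Tendsto (fun ν => (X ν).a r₂ s) atTop atTop) :
    Tendsto (fun ν => (X ν).nMin) atTop atTop := by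
  have hq : 0 < r₂ / (2 * (r₂ + d)) := by positivity
  have h1 : Tendsto (fun ν => ((X ν).nMin : ℝ) ^ (r₂ / (2 * (r₂ + d)))) atTop atTop :=
    tendsto_atTop_mono (fun ν => Model.a_le_rpow (hm ν)) h
  have h2 := (tendsto_rpow_atTop (inv_pos.2 hq)).comp h1
  refine tendsto_natCast_atTop_iff.1 (h2.congr fun ν => ?_)
  simp only [Function.comp]
  rw [← Real.rpow_mul (Nat.cast_nonneg _), mul_inv_cancel₀ hq.ne', Real.rpow_one]

end Multitask

/-! ### Choice of the constants and asymptotic linearity -/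

namespace Multitask

/-- Every left side is continuous in e and vanishes at e = 0, while every bound is positive. -/
theorem exists_small_radius {C M ρ e' : ℝ} (hM : 0 < M) (hρ : 0 < ρ) (he' : 0 < e') :
    ∃ e : ℝ, 0 < e ∧ 2 * e ≤ M ∧ e ≤ 1 / 4 ∧ e + C * (2 * e + e) ≤ ρ / 2 ∧
      2 * e + C * e + C * (2 * e + e) * e ≤ 2 ∧
      e + ρ⁻¹ * (2 * e + C * e + C * (2 * e + e) * e
        + (e + C * (2 * e + e)) * (2 * (C + 2) / ρ)) ≤ e' := by
  have key : ∀ (f : ℝ → ℝ) (c : ℝ), Continuous f → f 0 < c → ∀ᶠ e in 𝓝[>] (0:ℝ), f e ≤ c :=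
    fun f c hf h => ((hf.tendsto 0).eventually_le_const h).filter_mono nhdsWithin_le_nhds
  have hpos : ∀ᶠ e in 𝓝[>] (0:ℝ), 0 < e := self_mem_nhdsWithin
  obtain ⟨e, h0, h1, h2, h3, h4, h5⟩ := (hpos.and
    ((key (fun e => 2 * e) M (by fun_prop) (by simpa)).and
    ((key (fun e => e) (1 / 4) (by fun_prop) (by norm_num)).and
    ((key (fun e => e + C * (2 * e + e)) (ρ / 2) (by fun_prop) (by simpa)).and
    ((key (fun e => 2 * e + C * e + C * (2 * e + e) * e) 2 (by fun_prop) (by simp)).and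
    (key (fun e => e + ρ⁻¹ * (2 * e + C * e + C * (2 * e + e) * e
        + (e + C * (2 * e + e)) * (2 * (C + 2) / ρ))) e' (by fun_prop) (by simpa))))))).exists
  exact ⟨e, h0, h1, h2, h3, h4, h5⟩

/-- The power (4a)^(-γ) blows up as a decreases to 0: more accurate pilots make the within-cluster
weights beat any prescribed multiple of `nMax`. -/
theorem exists_pilot_radius {c₀ c₂ c_w γ δ C : ℝ} (hδ : 0 < δ) (hc_w : 0 < c_w) (hγ : 0 < γ)
    (hc₀ : 0 < c₀) : ∃ a : ℝ, 0 < a ∧ 4 * a ≤ δ / 2 ∧ c₂ ≤ c_w * (4 * a) ^ (-γ) ∧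
      8 * C < c_w * (4 * a) ^ (-γ) * c₀ := by
  have h1 : Tendsto (fun a : ℝ => 4 * a) (𝓝[>] 0) (𝓝[>] 0) := by
    refine tendsto_nhdsWithin_iff.2 ⟨?_, ?_⟩
    · have : Continuous fun a : ℝ => 4 * a := by fun_prop
      have := this.tendsto 0
      rw [mul_zero] at this
      exact this.mono_left nhdsWithin_le_nhds
    · filter_upwards [self_mem_nhdsWithin] with a ha
      exact mul_pos (four_pos) (mem_Ioi.1 ha)
  have h2 : Tendsto (fun a : ℝ => c_w * (4 * a) ^ (-γ)) (𝓝[>] 0) atTop :=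
    ((tendsto_rpow_neg_nhdsGT_zero (by linarith)).comp h1).const_mul_atTop hc_w
  have h3 := h2.atTop_mul_const hc₀
  have h4 : ∀ᶠ a : ℝ in 𝓝[>] 0, 4 * a ≤ δ / 2 :=
    (h1.mono_right nhdsWithin_le_nhds).eventually_le_const (by positivity)
  have hpos : ∀ᶠ a in 𝓝[>] (0:ℝ), 0 < a := self_mem_nhdsWithin
  obtain ⟨a, g0, g1, g2, g3⟩ := (hpos.and (h4.and
    ((h2.eventually_ge_atTop c₂).and (h3.eventually_gt_atTop (8 * C))))).exists
  exact ⟨a, g0, g1, g2, g3⟩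

/-- The fused estimator is asymptotically linear in the scores. -/
theorem tendsto_measure_estimator_sub {d : ℕ}
    {M δ ρ κ r₁ r₂ σ₁ σ₂ σ₃ σ₄ σ₅ α : ℝ}
    (hM : 0 < M) (hδ : 0 < δ) (hρ : 0 < ρ) (hκ : 0 < κ) (hr₁ : 2 < r₁) (hr₂ : 2 < r₂)
    (hσ₁ : 0 < σ₁) (hσ₂ : 0 < σ₂) (hσ₃ : 0 < σ₃) (hσ₄ : 0 < σ₄) (hσ₅ : 0 < σ₅)
    (hα : 0 < α) (hα' : α ≤ 1 / 2)
    {c_w γ ζ c₀ c₁ c₂ c_ξ : ℝ}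
    (hc_w : 0 < c_w) (hγ : 0 < γ) (hζ : ζ < 1 / 2) (hc₀ : 0 < c₀) (hc₁ : 0 < c₁)
    (hc₂ : c_w * (δ / 2) ^ (-γ) ≤ c₂)
    {s : ℕ → ℝ} {p : ℝ → ℕ → ℝ} (hp : ∀ e > 0, Tendsto (p e) atTop (𝓝 0))
    {X : ℕ → Model d}
    (h_sampling : ∀ ν, (X ν).Sampling)
    (h_cluster : ∀ ν, (X ν).NearHomogeneous δ)
    (h_loss : ∀ ν, (X ν).LossRegular M ρ κ r₁ r₂ σ₁ σ₂ σ₃ σ₅)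
    (h_nuis : ∀ ν, (X ν).NuisanceRate s σ₄)
    (h_real : Tendsto (fun ν => (X ν).μ {ω | ∀ j, (X ν).ηhat j ω ∈ (X ν).T j}) atTop (𝓝 1))
    (h_pilot : ∀ ν, (X ν).PilotRate α p)
    (h_tuned : ∀ ν, (X ν).Tuned c_w γ α ζ c₀ c₁ c₂ c_ξ)
    (h_est : ∀ ν, (X ν).IsFusionEstimator c_w γ)
    (h_growth : Tendsto (fun ν => (X ν).a r₂ s) atTop atTop)
    (h_K : ∃ C : ℕ, ∀ ν, (X ν).K ≤ C)
    (h_b : Tendsto (fun ν => ⨆ k, (X ν).b s k) atTop (𝓝 0))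
    (h_ξ : Tendsto (fun ν => ⨆ k, Real.sqrt ((X ν).N k) * (X ν).ξ k) atTop (𝓝 0))
    (j : ∀ ν, Fin (X ν).m) {u : ∀ ν, (X ν).Ω → Param d}
    (hu : ∀ ν ω, (X ν).pooledHess ((X ν).cluster (j ν)) (u ν ω)
      = -(√((X ν).N ((X ν).cluster (j ν))) • (X ν).scoreSum ((X ν).cluster (j ν)) ω))
    {e' : ℝ} (he' : 0 < e') :
    Tendsto (fun ν => (X ν).μ.real {ω | e' < ‖√((X ν).N ((X ν).cluster (j ν))) •
      ((X ν).θhat ω (j ν) - (X ν).θs (j ν)) - u ν ω‖}) atTop (𝓝 0) := by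
  have hm : ∀ ν, 0 < (X ν).m := fun ν => (j ν).pos
  have hnMin := tendsto_nMin hr₂ hm h_growth
  have hnMin' : Tendsto (fun ν => ((X ν).nMin : ℝ)) atTop atTop :=
    tendsto_natCast_atTop_atTop.comp hnMin
  obtain ⟨Km, hKm⟩ := h_K
  refine tendsto_order.2 ⟨fun a ha => Eventually.of_forall fun ν => ha.trans_le measureReal_nonneg,
    fun η hη => ?_⟩
  -- The order of choices matters: C depends only on the target probability η, then e is small given
  -- C, and the pilot accuracy a is small given C.
  obtain ⟨C, hC0, hCη⟩ : ∃ C : ℝ, 0 < C ∧ (Km : ℝ) * (σ₃ / C + Model.hessMean d κ σ₂ / C + (2 + σ₁) / C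
      + (1 + σ₅ * M ^ 2) / C + (1 + σ₁) / C ^ 2) < η := by
    have t1 : ∀ x : ℝ, Tendsto (fun C : ℝ => x / C) atTop (𝓝 0) := fun x =>
      tendsto_const_nhds.div_atTop tendsto_id
    have t2 : Tendsto (fun C : ℝ => (1 + σ₁) / C ^ 2) atTop (𝓝 0) :=
      tendsto_const_nhds.div_atTop (tendsto_pow_atTop two_ne_zero)
    have t3 := ((((t1 σ₃).add (t1 (Model.hessMean d κ σ₂))).add (t1 (2 + σ₁))).add
      (t1 (1 + σ₅ * M ^ 2))).add t2 |>.const_mul (Km : ℝ)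
    simp only [add_zero, mul_zero] at t3
    exact ((eventually_gt_atTop 0).and (t3.eventually_lt_const hη)).exists
  obtain ⟨e, he, heM, he4, hs1, hs2, hfin⟩ := exists_small_radius (C := C) hM hρ he'
  obtain ⟨a, ha, ha4, hac, haΛ⟩ := exists_pilot_radius (c₂ := c₂) (C := C) hδ hc_w hγ hc₀
  -- the probability of the bad event
  have hreal0 : Tendsto (fun ν => (X ν).μ.real {ω | ¬ ∀ j, (X ν).ηhat j ω ∈ (X ν).T j})
      atTop (𝓝 0) := by
    have h1 := ((ENNReal.tendsto_toReal ENNReal.one_ne_top).comp h_real).const_sub 1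
    simp only [ENNReal.toReal_one, sub_self] at h1
    exact h1.congr fun ν => (Model.measure_not_realized_eq (h_sampling ν)).symm
  have ha2 : Tendsto (fun ν => (X ν).a r₂ s ^ 2) atTop atTop :=
    (tendsto_pow_atTop two_ne_zero).comp h_growth
  -- For fixed C, e and a, everything in the bound on the bad probability vanishes except the terms
  -- over C, which are below η.
  have hbound : Tendsto (fun ν => (X ν).μ.real {ω | ¬ ∀ j, (X ν).ηhat j ω ∈ (X ν).T j}
      + σ₄ / e ^ 2 / (X ν).a r₂ s ^ 2
      + Km * ((σ₃ / C + Model.hessMean d κ σ₂ / C + (2 + σ₁) / C + (1 + σ₅ * M ^ 2) / C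
          + (1 + σ₁) / C ^ 2) + σ₅ * σ₄ * (4 / e ^ 2 / (X ν).a r₂ s ^ 2 + 2 / e * ⨆ k, (X ν).b s k)
          + d * (Model.hessVar d σ₂ * (d + 1) ^ 2 / e ^ 2 * ((X ν).nMin : ℝ)⁻¹))
      + p a (X ν).nMin) atTop (𝓝 (Km * (σ₃ / C + Model.hessMean d κ σ₂ / C + (2 + σ₁) / C
          + (1 + σ₅ * M ^ 2) / C + (1 + σ₁) / C ^ 2))) := by
    have t1 : ∀ x : ℝ, Tendsto (fun ν => x / (X ν).a r₂ s ^ 2) atTop (𝓝 0) := fun x =>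
      tendsto_const_nhds.div_atTop ha2
    have t2 := (((t1 (4 / e ^ 2)).add (h_b.const_mul (2 / e))).const_mul (σ₅ * σ₄))
    have t3 := ((tendsto_inv_atTop_zero.comp hnMin').const_mul
      (Model.hessVar d σ₂ * (d + 1) ^ 2 / e ^ 2)).const_mul (d:ℝ)
    have t4 := (((hreal0.add (t1 (σ₄ / e ^ 2))).add ((((tendsto_const_nhds
      (x := (σ₃ / C + Model.hessMean d κ σ₂ / C + (2 + σ₁) / C + (1 + σ₅ * M ^ 2) / C
          + (1 + σ₁) / C ^ 2))).add t2).add t3).const_mul (Km : ℝ))).add ((hp a ha).comp hnMin))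
    simpa using t4
  have hpen : Tendsto (fun ν => c₁ * ((X ν).nMin : ℝ) ^ (ζ - 1 / 2)) atTop (𝓝 0) := by
    have := ((tendsto_rpow_neg_atTop (y := 1 / 2 - ζ) (by linarith)).comp hnMin').const_mul c₁
    simpa using this
  have hrad : Tendsto (fun ν => 2 * (C + 2) / (ρ * √((X ν).nMin : ℝ))) atTop (𝓝 0) :=
    tendsto_const_nhds.div_atTop ((Real.tendsto_sqrt_atTop.comp hnMin').const_mul_atTop hρ)
  filter_upwards [hbound.eventually_lt_const hCη, hpen.eventually_le_const he,
    hrad.eventually_le_const (half_pos he), h_ξ.eventually_le_const he,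
    h_ξ.eventually_le_const ha, hnMin.eventually_gt_atTop 0,
    h_growth.eventually_gt_atTop 0] with ν hν hpenν hradν hξe hξa hn haν
  obtain ⟨L, hL⟩ := (h_loss ν).exists_envelope
  have hξ' : ∀ k, √((X ν).N k) * (X ν).ξ k ≤ ⨆ k, √((X ν).N k) * (X ν).ξ k := fun k =>
    le_ciSup (f := fun k => √((X ν).N k) * (X ν).ξ k) (finite_range _).bddAbove k
  have hst := Model.smallTuning_of_le hρ hC0 he heM he4 hs1 hs2 (h_cluster ν) (h_tuned ν) hζ hc₁ hn
    hpenν hradν fun k => (hξ' k).trans hξe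
  have hm1 : (1:ℝ) ≤ (X ν).m := by exact_mod_cast hm ν
  -- This lower bound for all the rates s(n_j) contains the factor m, so its square more than
  -- compensates the union over the tasks.
  have hS0 : 0 < (X ν).m * (X ν).a r₂ s := by positivity
  have hn' : (0:ℝ) < (X ν).nMin := by exact_mod_cast hn
  have hbk : ∀ k, (X ν).b s k ≤ ⨆ k, (X ν).b s k := fun k =>
    le_ciSup (f := fun k => (X ν).b s k) (finite_range _).bddAbove k
  have hB0 : 0 ≤ ⨆ k, (X ν).b s k := Real.iSup_nonneg fun k => Model.b_nonneg k
  have hgood := Model.measure_not_goodSample_le hM hρ hκ hr₁ hr₂ hσ₁ hσ₂ hσ₃ hσ₄ hσ₅ (h_sampling ν)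
    (h_loss ν) hL (h_nuis ν) hC0 he hS0 (Model.a_mul_le (hm ν)) hn'
    (fun k => by exact_mod_cast (h_cluster ν).nMin_le_N k) hbk
  have hpil := Model.measure_not_pilot_le (h_sampling ν) (h_pilot ν) ha
  have hsub : {ω | e' < ‖√((X ν).N ((X ν).cluster (j ν))) •
      ((X ν).θhat ω (j ν) - (X ν).θs (j ν)) - u ν ω‖} ⊆ {ω | ¬ (X ν).GoodSample M L C e ω}
      ∪ {ω | ¬ ∀ j, ((X ν).n j : ℝ) ^ α * ‖(X ν).pilot j ω - (X ν).θs j‖ < a} := by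
    intro ω hω
    by_contra hcon
    simp only [mem_union, mem_ofPred_eq, not_or, not_not] at hcon
    obtain ⟨g1, g2⟩ := hcon
    obtain ⟨q1, q2⟩ := Model.pen_spec hc_w hγ hδ hα hc₂ ha hn (h_cluster ν) (h_tuned ν)
      (fun k => Model.radius_le_of_sqrt_mul_le (h_cluster ν) hα' hn ha ((hξ' k).trans hξa)) ha4 hac g2
    have hmax : (0:ℝ) < (X ν).nMax := by
      have h1 : (X ν).n (j ν) ≤ (X ν).nMax := le_ciSup (finite_range (X ν).n).bddAbove (j ν)
      have h2 := (X ν).nMin_le (j ν)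
      exact_mod_cast hn.trans_le (h2.trans h1)
    have hΛ : 8 * C * (X ν).nMax < c_w * (4 * a) ^ (-γ) * (c₀ * (X ν).nMax) := by
      rw [← mul_assoc]
      exact mul_lt_mul_of_pos_right haΛ hmax
    have := hst.norm_estimator_sub_le hM (h_loss ν) hL g1 hρ (h_tuned ν).ε_nonneg hΛ q1 q2 (h_est ν)
      (j ν) (hu ν ω)
    exact absurd (lt_of_lt_of_le hω (this.trans hfin)) (lt_irrefl _)
  refine lt_of_le_of_lt ?_ hν
  refine (measureReal_mono hsub (measure_ne_top _ _)).trans ((measureReal_union_le _ _).trans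
    (add_le_add (hgood.trans (add_le_add (add_le_add le_rfl ?_) ?_)) hpil))
  · have h1 : (X ν).m * (σ₄ / (((X ν).m * (X ν).a r₂ s) ^ 2 * e ^ 2))
        = σ₄ / e ^ 2 / (X ν).a r₂ s ^ 2 / (X ν).m := by field_simp
    rw [h1]
    exact div_le_self (by positivity) hm1
  · have hh := Model.hessVar_nonneg d hσ₂
    have h1 : 4 / (e ^ 2 * ((X ν).m * (X ν).a r₂ s) ^ 2) ≤ 4 / e ^ 2 / (X ν).a r₂ s ^ 2 := by
      rw [div_div]
      have : (X ν).a r₂ s ≤ (X ν).m * (X ν).a r₂ s := le_mul_of_one_le_left haν.le hm1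
      gcongr
    have h2 : 2 * (⨆ k, (X ν).b s k) / e = 2 / e * ⨆ k, (X ν).b s k := by ring
    have h3 : ((X ν).K : ℝ) ≤ Km := by exact_mod_cast hKm ν
    have hmean : 0 ≤ Model.hessMean d κ σ₂ := by have := Model.hessVar_nonneg d hσ₂; unfold Model.hessMean; positivity
    rw [h2]
    gcongr

end Multitask

namespace Multitask

/-! ### The sandwich covariance and the leading term -/

open scoped Matrix

section Calculus

variable {d : ℕ}

theorem gradient_finset_sum {ι : Type*} (s : Finset ι) {g : ι → Param d → ℝ} {x : Param d}
    (h : ∀ i ∈ s, TwiceDiffAt (g i) x) :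
    gradient (fun y => ∑ i ∈ s, g i y) x = ∑ i ∈ s, gradient (g i) x := by
  refine HasGradientAt.gradient ?_
  rw [hasGradientAt_iff_hasFDerivAt, map_sum]
  exact HasFDerivAt.fun_sum fun i hi => (h i hi).hasGradientAt.hasFDerivAt

theorem hess_finset_sum {ι : Type*} (s : Finset ι) {g : ι → Param d → ℝ} {x : Param d}
    (h : ∀ᶠ y in 𝓝 x, ∀ i ∈ s, TwiceDiffAt (g i) y) :
    hess (fun y => ∑ i ∈ s, g i y) x = ∑ i ∈ s, hess (g i) x := by
  have e : gradient (fun y => ∑ i ∈ s, g i y) =ᶠ[𝓝 x] fun y => ∑ i ∈ s, gradient (g i) y := by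
    filter_upwards [h] with y hy using gradient_finset_sum s hy
  rw [hess, e.fderiv_eq]
  exact (HasFDerivAt.fun_sum fun i hi => (h.self_of_nhds i hi).hasFDerivAt).fderiv

end Calculus

section Matrices

variable {d : ℕ}

theorem toEuclideanCLM_single_apply (A : Matrix (Fin d) (Fin d) ℝ) (a b : Fin d) :
    Matrix.toEuclideanCLM (𝕜 := ℝ) A (EuclideanSpace.single b 1) a = A a b := by
  rw [Matrix.ofLp_toEuclideanCLM]
  simp

theorem clm_ext_single {A B : Param d →L[ℝ] Param d}
    (h : ∀ a b, A (EuclideanSpace.single b 1) a = B (EuclideanSpace.single b 1) a) : A = B := by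
  rw [clm_eq_sum_smulRight A, clm_eq_sum_smulRight B]
  refine Finset.sum_congr rfl fun b _ => ?_
  have : A (EuclideanSpace.single b 1) = B (EuclideanSpace.single b 1) := by
    ext a; exact h a b
  rw [this]

/-- Inversion of coercive matrices. -/
theorem coercive_inv {A : Matrix (Fin d) (Fin d) ℝ} {ρ : ℝ} (hρ : 0 < ρ)
    (h : ∀ v : Param d, ρ * ‖v‖ ^ 2 ≤ inner ℝ (Matrix.toEuclideanCLM (𝕜 := ℝ) A v) v) (v : Param d) :
    Matrix.toEuclideanCLM (𝕜 := ℝ) A (Matrix.toEuclideanCLM (𝕜 := ℝ) A⁻¹ v) = v ∧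
      ‖Matrix.toEuclideanCLM (𝕜 := ℝ) A⁻¹ v‖ ≤ ρ⁻¹ * ‖v‖ := by
  have hlow : ∀ v : Param d, ρ * ‖v‖ ≤ ‖Matrix.toEuclideanCLM (𝕜 := ℝ) A v‖ := fun v => by
    rcases (norm_nonneg v).eq_or_lt with h0 | h0
    · rw [← h0, mul_zero]; exact norm_nonneg _
    · refine le_of_mul_le_mul_right ?_ h0
      have := (h v).trans (real_inner_le_norm _ _)
      linarith
  -- In finite dimension the lower bound ρ‖v‖ ≤ ‖Av‖ makes the matrix injective and hence
  -- invertible; applied to A⁻¹v it also bounds the inverse.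
  have hinj : Function.Injective A.mulVec := fun x y hxy => by
    have h1 := hlow (WithLp.toLp 2 (x - y))
    rw [Matrix.toEuclideanCLM_toLp, Matrix.mulVec_sub, hxy, sub_self] at h1
    have h2 : ‖(WithLp.toLp 2 (x - y) : Param d)‖ ≤ 0 := by
      simp only [WithLp.toLp_zero, norm_zero] at h1
      exact nonpos_of_mul_nonpos_right h1 hρ
    have h3 := norm_le_zero_iff.1 h2
    have h4 := congrArg (WithLp.ofLp) h3
    exact sub_eq_zero.1 (by simpa using h4)
  have hdet : IsUnit A.det := (Matrix.isUnit_iff_isUnit_det A).1 (Matrix.mulVec_injective_iff_isUnit.1 hinj)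
  have e : Matrix.toEuclideanCLM (𝕜 := ℝ) A (Matrix.toEuclideanCLM (𝕜 := ℝ) A⁻¹ v) = v := by
    rw [← mul_apply_eq_comp, ← map_mul, Matrix.mul_nonsing_inv A hdet, map_one,
      one_apply_eq_self]
  refine ⟨e, ?_⟩
  have := hlow (Matrix.toEuclideanCLM (𝕜 := ℝ) A⁻¹ v)
  rw [e] at this
  rw [inv_mul_eq_div, le_div_iff₀ hρ]
  linarith

theorem inner_toEuclideanCLM_comm {A : Matrix (Fin d) (Fin d) ℝ} (hA : A.IsHermitian) (v w : Param d) :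
    (inner ℝ (Matrix.toEuclideanCLM (𝕜 := ℝ) A v) w : ℝ)
      = inner ℝ v (Matrix.toEuclideanCLM (𝕜 := ℝ) A w) := by
  have hA' : A.transpose = A := by simpa using hA.eq
  rw [real_inner_comm, Matrix.inner_toEuclideanCLM, Matrix.inner_toEuclideanCLM,
    Matrix.dotProduct_mulVec, ← Matrix.mulVec_transpose, hA', dotProduct_comm]

end Matrices

namespace Model

variable {d : ℕ} {X : Model d} {M ρ κ r₁ r₂ σ₁ σ₂ σ₃ σ₅ : ℝ}

theorem eventually_twiceDiffAt (hM : 0 < M) (hR : X.LossRegular M ρ κ r₁ r₂ σ₁ σ₂ σ₃ σ₅)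
    (j : Fin X.m) : ∀ᶠ y in 𝓝 (X.θs j), ∀ z, TwiceDiffAt (fun θ => X.loss j θ (X.ηs j) z) y := by
  filter_upwards [Metric.ball_mem_nhds (X.θs j) hM] with y hy z
  exact hR.smooth j y (X.ηs j) (by rw [mem_ball_iff_norm] at hy; exact hy.le) (by simp [hM.le]) z

theorem pooledScore_eq (hM : 0 < M) (hR : X.LossRegular M ρ κ r₁ r₂ σ₁ σ₂ σ₃ σ₅) (k : Fin X.K)
    (ω : X.Ω) : X.pooledScore k ω = X.scoreSum k ω := by
  rw [pooledScore, scoreSum, X.sum_obsIdx k fun j i => X.score j (X.θs j) (X.ηs j) (X.Z j i ω)]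
  refine Finset.sum_congr rfl fun j _ => ?_
  exact gradient_finset_sum _ fun i _ => (eventually_twiceDiffAt hM hR j).self_of_nhds _

theorem hessMatrix_f (hM : 0 < M) (hR : X.LossRegular M ρ κ r₁ r₂ σ₁ σ₂ σ₃ σ₅) (j : Fin X.m)
    (ω : X.Ω) (a b : Fin d) : hessMatrix (fun θ => X.f j ω θ (X.ηs j)) (X.θs j) a b
      = ∑ i, X.lossHess j (X.θs j) (X.ηs j) (X.Z j i ω) (EuclideanSpace.single b 1) a := by
  have h := hess_finset_sum Finset.univ (g := fun i θ => X.loss j θ (X.ηs j) (X.Z j i ω))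
    (x := X.θs j) ((eventually_twiceDiffAt hM hR j).mono fun y hy i _ => hy _)
  change hess (fun θ => ∑ i, X.loss j θ (X.ηs j) (X.Z j i ω)) (X.θs j) (EuclideanSpace.single b 1) a
    = _
  rw [h, sum_apply, WithLp.ofLp_sum, Finset.sum_apply]
  rfl

theorem toEuclideanCLM_Ψ (hM : 0 < M) (hr₂ : 2 < r₂) (hσ₂ : 0 < σ₂) (hS : X.Sampling)
    (hR : X.LossRegular M ρ κ r₁ r₂ σ₁ σ₂ σ₃ σ₅) (k : Fin X.K) :
    Matrix.toEuclideanCLM (𝕜 := ℝ) (X.Ψ k) = (X.N k : ℝ)⁻¹ • X.pooledHess k := by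
  refine clm_ext_single fun a b => ?_
  rw [toEuclideanCLM_single_apply]
  have hi := fun j => integrable_lossHess hM hr₂ hσ₂ hS hR j
  have hpr : ∀ j, Integrable (fun z => X.lossHess j (X.θs j) (X.ηs j) z (EuclideanSpace.single b 1) a)
      (X.P j) := fun j => (EuclideanSpace.proj (𝕜 := ℝ) a : Param d →L[ℝ] ℝ).integrable_comp
        ((hi j).apply_continuousLinearMap (EuclideanSpace.single b 1))
  have e1 : ∀ ω, (∑ j ∈ X.S k, hessMatrix (fun θ => X.f j ω θ (X.ηs j)) (X.θs j)) a b
      = ∑ p ∈ X.obsIdx k, X.lossHess p.1 (X.θs p.1) (X.ηs p.1) (X.Z p.1 p.2 ω)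
        (EuclideanSpace.single b 1) a := fun ω => by
    rw [Matrix.sum_apply, X.sum_obsIdx k fun j i =>
      X.lossHess j (X.θs j) (X.ηs j) (X.Z j i ω) (EuclideanSpace.single b 1) a]
    exact Finset.sum_congr rfl fun j _ => hessMatrix_f hM hR j ω a b
  have e2 : ∀ j, ∫ z, X.lossHess j (X.θs j) (X.ηs j) z (EuclideanSpace.single b 1) a ∂(X.P j)
      = X.riskHess j (X.θs j) (EuclideanSpace.single b 1) a := fun j => by
    rw [riskHess_eq_integral hM hr₂ hσ₂ hS hR j, ContinuousLinearMap.integral_apply (hi j)]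
    exact (EuclideanSpace.proj (𝕜 := ℝ) a : Param d →L[ℝ] ℝ).integral_comp_comm
      ((hi j).apply_continuousLinearMap (EuclideanSpace.single b 1))
  simp only [Ψ, Matrix.of_apply, e1, integral_const_mul]
  rw [integral_finsetSum _ fun p _ =>
    (hS.measurePreserving_Z p.1 p.2).integrable_comp_of_integrable (hpr p.1)]
  simp only [pooledHess, smul_apply, sum_apply, PiLp.smul_apply, WithLp.ofLp_sum, Finset.sum_apply,
    smul_eq_mul]
  congr 1
  refine Finset.sum_congr rfl fun p _ => ?_
  rw [hS.integral_comp_Z p.1 p.2 (hpr p.1).1, e2]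

theorem isHermitian_Ψ (hM : 0 < M) (hr₂ : 2 < r₂) (hσ₂ : 0 < σ₂) (hS : X.Sampling)
    (hR : X.LossRegular M ρ κ r₁ r₂ σ₁ σ₂ σ₃ σ₅) (k : Fin X.K) : (X.Ψ k).IsHermitian := by
  have hsymm : ∀ v w, (inner ℝ (X.pooledHess k v) w : ℝ) = inner ℝ (X.pooledHess k w) v :=
    fun v w => by
      simp only [pooledHess, sum_apply, sum_inner]
      exact Finset.sum_congr rfl fun p _ => riskHess_symm hM hr₂ hσ₂ hS hR p.1 v w
  refine Matrix.IsHermitian.ext fun a b => ?_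
  rw [star_trivial, ← toEuclideanCLM_single_apply (X.Ψ k) a b,
    ← toEuclideanCLM_single_apply (X.Ψ k) b a, toEuclideanCLM_Ψ hM hr₂ hσ₂ hS hR k]
  have h := hsymm (EuclideanSpace.single a 1) (EuclideanSpace.single b 1)
  simp only [EuclideanSpace.inner_single_right, one_mul] at h
  simp only [smul_apply, PiLp.smul_apply, smul_eq_mul]
  simp at h
  rw [h]

theorem Ψ_coercive (hM : 0 < M) (hr₂ : 2 < r₂) (hσ₂ : 0 < σ₂) (hS : X.Sampling)
    (hR : X.LossRegular M ρ κ r₁ r₂ σ₁ σ₂ σ₃ σ₅) (k : Fin X.K) (hN : 0 < X.N k) (v : Param d) :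
    ρ * ‖v‖ ^ 2 ≤ inner ℝ (Matrix.toEuclideanCLM (𝕜 := ℝ) (X.Ψ k) v) v := by
  have hN' : (0:ℝ) < X.N k := by exact_mod_cast hN
  rw [toEuclideanCLM_Ψ hM hr₂ hσ₂ hS hR k, smul_apply, inner_smul_left]
  simp only [conj_trivial]
  rw [inv_mul_eq_div, le_div_iff₀ hN']
  linarith [pooledHess_coercive hM hR k v]

/-- The leading term of the estimation error. -/
noncomputable def leading (X : Model d) (k : Fin X.K) (ω : X.Ω) : Param d :=
  -((√(X.N k))⁻¹ • Matrix.toEuclideanCLM (𝕜 := ℝ) (X.Ψ k)⁻¹ (X.scoreSum k ω))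

theorem pooledHess_leading (hM : 0 < M) (hρ : 0 < ρ) (hr₂ : 2 < r₂) (hσ₂ : 0 < σ₂) (hS : X.Sampling)
    (hR : X.LossRegular M ρ κ r₁ r₂ σ₁ σ₂ σ₃ σ₅) (k : Fin X.K) (ω : X.Ω) :
    X.pooledHess k (X.leading k ω) = -(√(X.N k) • X.scoreSum k ω) := by
  -- For an empty sample the square root and its conventional inverse are both zero, so both sides
  -- vanish.
  rcases Nat.eq_zero_or_pos (X.N k) with h0 | h0
  · simp [leading, h0]
  have hN' : (0:ℝ) < X.N k := by exact_mod_cast h0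
  have hw : 0 < √(X.N k : ℝ) := Real.sqrt_pos.2 hN'
  have e1 : X.pooledHess k = (X.N k : ℝ) • Matrix.toEuclideanCLM (𝕜 := ℝ) (X.Ψ k) := by
    rw [toEuclideanCLM_Ψ hM hr₂ hσ₂ hS hR k, smul_smul, mul_inv_cancel₀ hN'.ne', one_smul]
  rw [e1, leading, smul_apply, map_neg, map_smul,
    (coercive_inv hρ (Ψ_coercive hM hr₂ hσ₂ hS hR k h0) _).1, smul_neg, smul_smul]
  congr 2
  rw [← div_eq_mul_inv, Real.div_sqrt]

theorem memLp_scoreSum (hM : 0 < M) (hr₁ : 2 < r₁) (hσ₁ : 0 < σ₁) (hS : X.Sampling)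
    (hR : X.LossRegular M ρ κ r₁ r₂ σ₁ σ₂ σ₃ σ₅) (k : Fin X.K) :
    MemLp (X.scoreSum k) 2 X.μ :=
  memLp_finsetSum _ fun p _ => hS.memLp_comp_Z (memLp_score hM hr₁ hσ₁ hS hR p.1).1

theorem measurable_scoreSum (hM : 0 < M) (hS : X.Sampling)
    (hR : X.LossRegular M ρ κ r₁ r₂ σ₁ σ₂ σ₃ σ₅) (k : Fin X.K) : Measurable (X.scoreSum k) :=
  Finset.measurable_sum _ fun p _ =>
    (measurable_score_truth hM hS hR p.1).comp (hS.measurable_Z p.1 p.2)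

theorem integral_norm_sq_scoreSum_le (hM : 0 < M) (hr₁ : 2 < r₁) (hr₂ : 2 < r₂) (hσ₁ : 0 < σ₁)
    (hσ₂ : 0 < σ₂) (hS : X.Sampling) (hR : X.LossRegular M ρ κ r₁ r₂ σ₁ σ₂ σ₃ σ₅) (k : Fin X.K) :
    ∫ ω, ‖X.scoreSum k ω‖ ^ 2 ∂X.μ ≤ X.N k * (1 + σ₁) := by
  refine (hS.integral_norm_sq_sum_le k (g := fun j z => X.score j (X.θs j) (X.ηs j) z)
    (measurable_score_truth hM hS hR) (fun j => (memLp_score hM hr₁ hσ₁ hS hR j).1)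
    (integral_score hM hr₂ hσ₂ hS hR) (B := fun _ => 1 + σ₁)
    (fun j => (memLp_score hM hr₁ hσ₁ hS hR j).2)).trans (le_of_eq ?_)
  rw [← Finset.sum_mul, ← Nat.cast_sum, N]

theorem scoreCov_bilinear (hM : 0 < M) (hr₁ : 2 < r₁) (hσ₁ : 0 < σ₁) (hS : X.Sampling)
    (hR : X.LossRegular M ρ κ r₁ r₂ σ₁ σ₂ σ₃ σ₅) (k : Fin X.K) (v w : Param d) :
    v.ofLp ⬝ᵥ X.scoreCov k *ᵥ w.ofLp
      = (X.N k : ℝ)⁻¹ * ∫ ω, inner ℝ v (X.scoreSum k ω) * inner ℝ w (X.scoreSum k ω) ∂X.μ := by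
  have hG := memLp_scoreSum hM hr₁ hσ₁ hS hR k
  have hc : ∀ a : Fin d, MemLp (fun ω => X.scoreSum k ω a) 2 X.μ := fun a =>
    (EuclideanSpace.proj (𝕜 := ℝ) a : Param d →L[ℝ] ℝ).comp_memLp' hG
  have hp : ∀ a b : Fin d, Integrable (fun ω => X.scoreSum k ω a * X.scoreSum k ω b) X.μ :=
    fun a b => (hc a).integrable_mul (hc b)
  have e1 : ∀ ω, (inner ℝ v (X.scoreSum k ω) * inner ℝ w (X.scoreSum k ω) : ℝ)
      = ∑ a, ∑ b, v a * w b * (X.scoreSum k ω a * X.scoreSum k ω b) := fun ω => by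
    simp only [PiLp.inner_apply, RCLike.inner_apply, conj_trivial]
    rw [Finset.sum_mul_sum]
    refine Finset.sum_congr rfl fun a _ => Finset.sum_congr rfl fun b _ => by ring
  simp only [e1]
  rw [integral_finsetSum _ fun a _ => integrable_finsetSum _ fun b _ => (hp a b).const_mul _]
  simp only [dotProduct, Matrix.mulVec, Finset.mul_sum]
  refine Finset.sum_congr rfl fun a _ => ?_
  rw [integral_finsetSum _ fun b _ => (hp a b).const_mul _, Finset.mul_sum]
  refine Finset.sum_congr rfl fun b _ => ?_
  rw [integral_const_mul]
  simp only [scoreCov, Matrix.of_apply, integral_const_mul, pooledScore_eq hM hR]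
  ring

/-- Since Ψ is symmetric, the sandwich is the score covariance evaluated at Ψ⁻¹v and Ψ⁻¹w.
Positivity, boundedness and the variance of the leading term are all read off from this form. -/
theorem V_bilinear (hM : 0 < M) (hr₁ : 2 < r₁) (hr₂ : 2 < r₂) (hσ₁ : 0 < σ₁) (hσ₂ : 0 < σ₂)
    (hS : X.Sampling) (hR : X.LossRegular M ρ κ r₁ r₂ σ₁ σ₂ σ₃ σ₅) (k : Fin X.K) (v w : Param d) :
    v.ofLp ⬝ᵥ X.V k *ᵥ w.ofLp = (X.N k : ℝ)⁻¹ *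
      ∫ ω, inner ℝ (Matrix.toEuclideanCLM (𝕜 := ℝ) (X.Ψ k)⁻¹ v) (X.scoreSum k ω)
        * inner ℝ (Matrix.toEuclideanCLM (𝕜 := ℝ) (X.Ψ k)⁻¹ w) (X.scoreSum k ω) ∂X.μ := by
  have hinv : ((X.Ψ k)⁻¹).IsHermitian := (isHermitian_Ψ hM hr₂ hσ₂ hS hR k).inv
  have hinv' : ((X.Ψ k)⁻¹).transpose = (X.Ψ k)⁻¹ := by simpa using hinv.eq
  rw [← scoreCov_bilinear hM hr₁ hσ₁ hS hR k, V, Matrix.ofLp_toEuclideanCLM,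
    Matrix.ofLp_toEuclideanCLM, ← Matrix.mulVec_mulVec, ← Matrix.mulVec_mulVec,
    Matrix.dotProduct_mulVec, ← Matrix.mulVec_transpose, hinv']

theorem V_spec (hM : 0 < M) (hρ : 0 < ρ) (hr₁ : 2 < r₁) (hr₂ : 2 < r₂) (hσ₁ : 0 < σ₁) (hσ₂ : 0 < σ₂)
    (hS : X.Sampling) (hR : X.LossRegular M ρ κ r₁ r₂ σ₁ σ₂ σ₃ σ₅) (k : Fin X.K) (hN : 0 < X.N k) :
    (X.V k).PosSemidef ∧ ∀ a b, |X.V k a b| ≤ ρ⁻¹ ^ 2 * (1 + σ₁) := by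
  have hN' : (0:ℝ) < X.N k := by exact_mod_cast hN
  have hV := V_bilinear hM hr₁ hr₂ hσ₁ hσ₂ hS hR k
  have hent : ∀ a b, X.V k a b = (EuclideanSpace.single a (1:ℝ)).ofLp ⬝ᵥ X.V k *ᵥ
      (EuclideanSpace.single b (1:ℝ)).ofLp := fun a b => by simp
  constructor
  · refine Matrix.PosSemidef.of_dotProduct_mulVec_nonneg (Matrix.IsHermitian.ext fun a b => ?_)
      fun x => ?_
    · rw [star_trivial, hent a b, hent b a, hV, hV]
      simp only [mul_comm]
    · have := hV (WithLp.toLp 2 x) (WithLp.toLp 2 x)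
      simp only at this
      rw [star_trivial, this]
      exact mul_nonneg (by positivity) (integral_nonneg fun ω => mul_self_nonneg _)
  · intro a b
    rw [hent, hV]
    have hb := fun c : Fin d => (coercive_inv hρ (Ψ_coercive hM hr₂ hσ₂ hS hR k hN)
      (EuclideanSpace.single c (1:ℝ))).2
    simp only [PiLp.norm_single, norm_one, mul_one] at hb
    have hI := (memLp_scoreSum hM hr₁ hσ₁ hS hR k).integrable_norm_pow'
    have h1 : |∫ ω, (inner ℝ (Matrix.toEuclideanCLM (𝕜 := ℝ) (X.Ψ k)⁻¹ (EuclideanSpace.single a (1:ℝ)))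
        (X.scoreSum k ω) * inner ℝ (Matrix.toEuclideanCLM (𝕜 := ℝ) (X.Ψ k)⁻¹
        (EuclideanSpace.single b (1:ℝ))) (X.scoreSum k ω) : ℝ) ∂X.μ|
        ≤ ρ⁻¹ ^ 2 * (X.N k * (1 + σ₁)) := by
      refine (abs_integral_le_integral_abs).trans (le_trans (integral_mono_of_nonneg
        (g := fun ω => ρ⁻¹ ^ 2 * ‖X.scoreSum k ω‖ ^ 2)
        (Eventually.of_forall fun ω => abs_nonneg _) (hI.const_mul _)
        (Eventually.of_forall fun ω => ?_)) ?_)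
      · simp only [abs_mul]
        have q := fun c : Fin d => (abs_real_inner_le_norm (Matrix.toEuclideanCLM (𝕜 := ℝ) (X.Ψ k)⁻¹
          (EuclideanSpace.single c (1:ℝ))) (X.scoreSum k ω)).trans
          (mul_le_mul_of_nonneg_right (hb c) (norm_nonneg _))
        calc _ ≤ (ρ⁻¹ * ‖X.scoreSum k ω‖) * (ρ⁻¹ * ‖X.scoreSum k ω‖) :=
              mul_le_mul (q a) (q b) (abs_nonneg _) (by positivity)
          _ = _ := by ring
      · rw [integral_const_mul]
        exact mul_le_mul_of_nonneg_left
          (integral_norm_sq_scoreSum_le hM hr₁ hr₂ hσ₁ hσ₂ hS hR k) (by positivity)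
    rw [abs_mul, abs_of_pos (inv_pos.2 hN'), inv_mul_le_iff₀ hN']
    linarith

end Model

end Multitask

namespace Multitask

/-! ### Central limit theorem for the leading term -/

open scoped Matrix

namespace Model

variable {d : ℕ} {X : Model d} {M δ ρ κ r₁ r₂ σ₁ σ₂ σ₃ σ₅ : ℝ}

/-- The Taylor estimate works with exponents up to 3, so the moment of order r₁ is lowered to a
smaller one, uniformly over tasks. -/
theorem score_rpow (hM : 0 < M) (hσ₁ : 0 < σ₁) (hS : X.Sampling)
    (hR : X.LossRegular M ρ κ r₁ r₂ σ₁ σ₂ σ₃ σ₅) {r : ℝ} (hr : 0 < r) (hr' : r ≤ r₁) (j : Fin X.m) :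
    Integrable (fun z => ‖X.score j (X.θs j) (X.ηs j) z‖ ^ r) (X.P j) ∧
      ∫ z, ‖X.score j (X.θs j) (X.ηs j) z‖ ^ r ∂(X.P j) ≤ 1 + σ₁ := by
  have hm := measurable_score_truth hM hS hR j
  have hm₁ : AEStronglyMeasurable (fun z => ‖X.score j (X.θs j) (X.ηs j) z‖ ^ r₁) (X.P j) :=
    (hm.norm.pow_const r₁).aestronglyMeasurable
  have hm₂ : AEStronglyMeasurable (fun z => ‖X.score j (X.θs j) (X.ηs j) z‖ ^ r) (X.P j) :=
    (hm.norm.pow_const r).aestronglyMeasurable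
  have hl : ∫⁻ z, ENNReal.ofReal (‖X.score j (X.θs j) (X.ηs j) z‖ ^ r₁) ∂(X.P j)
      ≤ ENNReal.ofReal σ₁ := by
    refine le_trans (le_of_eq (lintegral_congr fun z => ?_)) (hR.score_moment j)
    rw [← ENNReal.ofReal_rpow_of_nonneg (norm_nonneg _) (hr.le.trans hr'), ofReal_norm]
  have h0 : ∀ᵐ z ∂(X.P j), 0 ≤ ‖X.score j (X.θs j) (X.ηs j) z‖ ^ r₁ :=
    Eventually.of_forall fun z => by positivity
  have hi₁ : Integrable (fun z => ‖X.score j (X.θs j) (X.ηs j) z‖ ^ r₁) (X.P j) :=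
    (lintegral_ofReal_ne_top_iff_integrable hm₁ h0).1 (hl.trans_lt ENNReal.ofReal_lt_top).ne
  have hb₁ : ∫ z, ‖X.score j (X.θs j) (X.ηs j) z‖ ^ r₁ ∂(X.P j) ≤ σ₁ := by
    rw [integral_eq_lintegral_of_nonneg_ae h0 hm₁]
    exact ENNReal.toReal_le_of_le_ofReal hσ₁.le hl
  have hle : ∀ x : ℝ, 0 ≤ x → x ^ r ≤ 1 + x ^ r₁ := fun x hx => by
    have hp : 0 ≤ x ^ r₁ := by positivity
    rcases le_total x 1 with h | h
    · linarith [Real.rpow_le_one hx h hr.le]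
    · linarith [Real.rpow_le_rpow_of_exponent_le h hr']
  have hi₂ : Integrable (fun z => 1 + ‖X.score j (X.θs j) (X.ηs j) z‖ ^ r₁) (X.P j) :=
    (integrable_const 1).add hi₁
  have hi := hi₂.mono' hm₂ (Eventually.of_forall fun z => by
    rw [Real.norm_eq_abs, abs_of_nonneg (by positivity)]
    exact hle _ (norm_nonneg _))
  refine ⟨hi, (integral_mono hi hi₂ fun z => hle _ (norm_nonneg _)).trans ?_⟩
  rw [integral_add (integrable_const 1) hi₁]
  simpa using hb₁

theorem inner_leading (hM : 0 < M) (hr₂ : 2 < r₂) (hσ₂ : 0 < σ₂) (hS : X.Sampling)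
    (hR : X.LossRegular M ρ κ r₁ r₂ σ₁ σ₂ σ₃ σ₅) (k : Fin X.K) (ω : X.Ω) (t : Param d) :
    (inner ℝ (X.leading k ω) t : ℝ)
      = -((√(X.N k))⁻¹ * inner ℝ (Matrix.toEuclideanCLM (𝕜 := ℝ) (X.Ψ k)⁻¹ t) (X.scoreSum k ω)) := by
  rw [leading, inner_neg_left, inner_smul_left,
    inner_toEuclideanCLM_comm (isHermitian_Ψ hM hr₂ hσ₂ hS hR k).inv, real_inner_comm]
  simp

theorem measurable_leading (hM : 0 < M) (hS : X.Sampling)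
    (hR : X.LossRegular M ρ κ r₁ r₂ σ₁ σ₂ σ₃ σ₅) (k : Fin X.K) : Measurable (X.leading k) := by
  have h : Measurable fun ω => Matrix.toEuclideanCLM (𝕜 := ℝ) (X.Ψ k)⁻¹ (X.scoreSum k ω) :=
    (Matrix.toEuclideanCLM (𝕜 := ℝ) (X.Ψ k)⁻¹).continuous.measurable.comp
      (measurable_scoreSum hM hS hR k)
  exact (h.const_smul (√(X.N k))⁻¹).neg

/-- Lyapunov's condition with r = min(r₁, 3): each of the N summands is of size N^(-1/2), so the
r-th moments sum to N · N^(-r/2) and the squared variances to N · N^(-2). Coercivity of Ψ bounds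
Ψ⁻¹t by ρ⁻¹‖t‖, which makes the bound uniform over clusters. -/
theorem norm_charFun_leading_sub_le (hM : 0 < M) (hρ : 0 < ρ) (hr₁ : 2 < r₁) (hr₂ : 2 < r₂)
    (hσ₁ : 0 < σ₁) (hσ₂ : 0 < σ₂) (hS : X.Sampling) (hR : X.LossRegular M ρ κ r₁ r₂ σ₁ σ₂ σ₃ σ₅)
    (k : Fin X.K) (hN : 0 < X.N k) (t : Param d) :
    ‖charFun (X.μ.map (X.leading k)) t - (Real.exp (-(t ⬝ᵥ X.V k *ᵥ t) / 2) : ℝ)‖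
      ≤ 4 * ((ρ⁻¹ * ‖t‖) ^ (min r₁ 3) * (1 + σ₁)) * (X.N k : ℝ) ^ (1 - min r₁ 3 / 2)
        + ((ρ⁻¹ * ‖t‖) ^ 2 * (1 + σ₁)) ^ 2 * (X.N k : ℝ)⁻¹ := by
  have hN' : (0:ℝ) < X.N k := by exact_mod_cast hN
  have hw0 : 0 < √(X.N k : ℝ) := Real.sqrt_pos.2 hN'
  set r := min r₁ 3 with hr
  have hr2 : 2 < r := lt_min hr₁ (by norm_num)
  have hr3 : r ≤ 3 := min_le_right _ _
  have hr1 : r ≤ r₁ := min_le_left _ _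
  set q := Matrix.toEuclideanCLM (𝕜 := ℝ) (X.Ψ k)⁻¹ t with hq
  have hqn : ‖q‖ ≤ ρ⁻¹ * ‖t‖ := (coercive_inv hρ (Ψ_coercive hM hr₂ hσ₂ hS hR k hN) t).2
  set B := ρ⁻¹ * ‖t‖ with hB
  have hB0 : 0 ≤ B := by positivity
  set g : ∀ j, X.Obs j → ℝ := fun j z =>
    -((√(X.N k))⁻¹ * inner ℝ q (X.score j (X.θs j) (X.ηs j) z)) with hg
  have hgm : ∀ j, Measurable (g j) := fun j =>
    (((innerSL ℝ q).continuous.measurable.comp (measurable_score_truth hM hS hR j)).const_mul _).neg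
  have hind := hS.iIndepFun_comp hgm
  have hmeas : ∀ p : Σ j, Fin (X.n j), Measurable fun ω => g p.1 (X.Z p.1 p.2 ω) := fun p =>
    (hgm p.1).comp (hS.measurable_Z p.1 p.2)
  have hgle : ∀ j z, |g j z| ≤ (√(X.N k))⁻¹ * (B * ‖X.score j (X.θs j) (X.ηs j) z‖) := fun j z => by
    simp only [hg]
    rw [abs_neg, abs_mul, abs_of_pos (inv_pos.2 hw0)]
    refine mul_le_mul_of_nonneg_left ((abs_real_inner_le_norm _ _).trans ?_) (inv_pos.2 hw0).le
    exact mul_le_mul_of_nonneg_right hqn (norm_nonneg _)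
  have hsc := memLp_score hM hr₁ hσ₁ hS hR
  have hL2 : ∀ j, MemLp (g j) 2 (X.P j) := fun j =>
    (((innerSL ℝ q).comp_memLp' (hsc j).1).const_mul _).neg
  have hr0 := fun j => score_rpow hM hσ₁ hS hR (by linarith : 0 < r) hr1 j
  have hgr : ∀ j z, |g j z| ^ r
      ≤ (√(X.N k))⁻¹ ^ r * B ^ r * ‖X.score j (X.θs j) (X.ηs j) z‖ ^ r := fun j z => by
    refine (Real.rpow_le_rpow (abs_nonneg _) (hgle j z) (by linarith)).trans (le_of_eq ?_)
    rw [Real.mul_rpow (by positivity) (by positivity), Real.mul_rpow hB0 (norm_nonneg _), mul_assoc]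
  have hgri : ∀ j, Integrable (fun z => |g j z| ^ r) (X.P j) := fun j =>
    ((hr0 j).1.const_mul _).mono' (((hgm j).abs.pow_const r).aestronglyMeasurable)
      (Eventually.of_forall fun z => by
        rw [Real.norm_eq_abs, abs_of_nonneg (by positivity)]
        exact hgr j z)
  have hgrb : ∀ j, ∫ z, |g j z| ^ r ∂(X.P j) ≤ (√(X.N k))⁻¹ ^ r * B ^ r * (1 + σ₁) := fun j => by
    refine (integral_mono (hgri j) ((hr0 j).1.const_mul _) (hgr j)).trans ?_
    rw [integral_const_mul]
    exact mul_le_mul_of_nonneg_left (hr0 j).2 (by positivity)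
  have hg2b : ∀ j, ∫ z, g j z ^ 2 ∂(X.P j) ≤ (X.N k : ℝ)⁻¹ * B ^ 2 * (1 + σ₁) := fun j => by
    have hi := (hsc j).1.integrable_norm_pow'
    refine (integral_mono (g := fun z => (X.N k : ℝ)⁻¹ * B ^ 2
      * ‖X.score j (X.θs j) (X.ηs j) z‖ ^ 2) (hL2 j).integrable_sq (hi.const_mul _)
      fun z => ?_).trans ?_
    · simp only
      rw [← sq_abs]
      refine (pow_le_pow_left₀ (abs_nonneg _) (hgle j z) 2).trans (le_of_eq ?_)
      rw [mul_pow, mul_pow, inv_pow, Real.sq_sqrt hN'.le]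
      ring
    · rw [integral_const_mul]
      exact mul_le_mul_of_nonneg_left (hsc j).2 (by positivity)
  have hg0 : ∀ j, ∫ z, g j z ∂(X.P j) = 0 := fun j => by
    simp only [hg]
    rw [integral_neg, integral_const_mul, integral_inner ((hsc j).1.integrable (by norm_num)),
      integral_score hM hr₂ hσ₂ hS hR j]
    simp
  have h0 : ∀ p ∈ X.obsIdx k, ∫ ω, g p.1 (X.Z p.1 p.2 ω) ∂X.μ = 0 := fun p _ => by
    rw [hS.integral_comp_Z p.1 p.2 (hgm p.1).aestronglyMeasurable, hg0]
  have key := norm_integral_exp_sum_sub_le (μ := X.μ) hr2 hr3 (X.obsIdx k) hmeas hind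
    (fun p _ => (hS.measurePreserving_Z p.1 p.2).integrable_comp_of_integrable (hgri p.1)) h0
  have hsum : ∀ ω, ∑ p ∈ X.obsIdx k, g p.1 (X.Z p.1 p.2 ω) = inner ℝ (X.leading k ω) t := fun ω => by
    rw [inner_leading hM hr₂ hσ₂ hS hR, scoreSum, inner_sum, Finset.mul_sum, ← Finset.sum_neg_distrib]
  -- The variances of the independent summands add up to that of the projected leading term, which
  -- is the quadratic form of `V` exactly, not only in the limit.
  have hvar : ∑ p ∈ X.obsIdx k, ∫ ω, g p.1 (X.Z p.1 p.2 ω) ^ 2 ∂X.μ = t ⬝ᵥ X.V k *ᵥ t := by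
    rw [← integral_sq_sum_eq (X.obsIdx k) hind (fun p _ => hS.memLp_comp_Z (hL2 p.1)) h0,
      V_bilinear hM hr₁ hr₂ hσ₁ hσ₂ hS hR, ← integral_const_mul]
    refine integral_congr_ae (Eventually.of_forall fun ω => ?_)
    simp only
    rw [hsum, inner_leading hM hr₂ hσ₂ hS hR, neg_sq, mul_pow, inv_pow, Real.sq_sqrt hN'.le, sq]
  rw [hvar] at key
  have hchar : charFun (X.μ.map (X.leading k)) t
      = ∫ ω, Complex.exp ((∑ p ∈ X.obsIdx k, g p.1 (X.Z p.1 p.2 ω) : ℝ) * Complex.I) ∂X.μ := by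
    rw [charFun_apply, integral_map (measurable_leading hM hS hR k).aemeasurable (by fun_prop)]
    simp_rw [hsum]
  rw [hchar]
  refine key.trans ((Finset.sum_le_card_nsmul _ _ (4 * ((√(X.N k))⁻¹ ^ r * B ^ r * (1 + σ₁))
    + ((X.N k : ℝ)⁻¹ * B ^ 2 * (1 + σ₁)) ^ 2) fun p _ => ?_).trans (le_of_eq ?_))
  · have e1 := hS.integral_comp_Z p.1 p.2 (g := fun z => |g p.1 z| ^ r) (hgri p.1).1
    have e2 := hS.integral_comp_Z p.1 p.2 (g := fun z => g p.1 z ^ 2) (hL2 p.1).integrable_sq.1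
    rw [e1, e2]
    exact add_le_add (mul_le_mul_of_nonneg_left (hgrb p.1) (by norm_num))
      (pow_le_pow_left₀ (integral_nonneg fun z => sq_nonneg _) (hg2b p.1) 2)
  · have e3 : (X.N k : ℝ) * (√(X.N k))⁻¹ ^ r = (X.N k : ℝ) ^ (1 - r / 2) := by
      rw [Real.inv_rpow hw0.le, Real.sqrt_eq_rpow, ← Real.rpow_mul hN'.le, Real.rpow_sub hN',
        Real.rpow_one, div_eq_mul_inv]
      ring_nf
    rw [card_obsIdx, nsmul_eq_mul, ← e3]
    field_simp

end Model

end Multitask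

/-! ### Conclusion -/

theorem theorem4 {d : ℕ}
    (Θ : Set (Multitask.Param d))
    -- model constants
    (M δ ρ κ r₁ r₂ σ₁ σ₂ σ₃ σ₄ σ₅ α : ℝ)
    (hM : 0 < M) (hδ : 0 < δ) (hρ : 0 < ρ) (hκ : 0 < κ) (hr₁ : 2 < r₁) (hr₂ : 2 < r₂)
    (hσ₁ : 0 < σ₁) (hσ₂ : 0 < σ₂) (hσ₃ : 0 < σ₃) (hσ₄ : 0 < σ₄) (hσ₅ : 0 < σ₅)
    (hα : 0 < α) (hα' : α ≤ 1 / 2)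
    -- tuning constants
    (c_w γ ζ c₀ c₁ c₂ c_ξ : ℝ)
    (hc_w : 0 < c_w) (hγ : 0 < γ) (hζ : ζ < 1 / 2) (hc₀ : 0 < c₀) (hc₁ : 0 < c₁)
    (hc₂ : c_w * (δ / 2) ^ (-γ) ≤ c₂) (hc_ξ : 0 < c_ξ)
    -- rate of the nuisance estimators
    (s : ℕ → ℝ) (hs_pos : ∀ n, 0 < s n)
    (hs_lower : (fun n : ℕ => (n : ℝ) ^ (1 / 4 : ℝ)) =o[atTop] s)
    (hs_upper : s =O[atTop] fun n : ℕ => (n : ℝ) ^ (1 / 2 : ℝ))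
    -- exceptional probabilities of the pilot estimators
    (p : ℝ → ℕ → ℝ) (hp_anti : ∀ e > 0, Antitone (p e))
    (hp : ∀ e > 0, Tendsto (p e) atTop (𝓝 0))
    -- a sequence of multitask problems
    (X : ℕ → Multitask.Model d)
    (h_sampling : ∀ ν, (X ν).Sampling)
    (h_cluster : ∀ ν, (X ν).NearHomogeneous δ)
    (h_target : ∀ ν, (X ν).IsTarget Θ)
    (h_loss : ∀ ν, (X ν).LossRegular M ρ κ r₁ r₂ σ₁ σ₂ σ₃ σ₅)
    (h_nuis : ∀ ν, (X ν).NuisanceRate s σ₄)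
    (h_real : Tendsto (fun ν => (X ν).μ {ω | ∀ j, (X ν).ηhat j ω ∈ (X ν).T j}) atTop (𝓝 1))
    (h_pilot : ∀ ν, (X ν).PilotRate α p)
    (h_tuned : ∀ ν, (X ν).Tuned c_w γ α ζ c₀ c₁ c₂ c_ξ)
    (h_est : ∀ ν, (X ν).IsFusionEstimator c_w γ)
    -- asymptotic regime
    (h_growth : Tendsto (fun ν => (X ν).a r₂ s) atTop atTop)
    (h_K : ∃ C : ℕ, ∀ ν, (X ν).K ≤ C)
    (h_b : Tendsto (fun ν => ⨆ k, (X ν).b s k) atTop (𝓝 0))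
    (h_ξ : Tendsto (fun ν => ⨆ k, Real.sqrt ((X ν).N k) * (X ν).ξ k) atTop (𝓝 0))
    -- a task in each problem
    (j : ∀ ν, Fin (X ν).m) :
    ∀ φ : Multitask.Param d →ᵇ ℝ,
      Tendsto (fun ν =>
          ∫ ω, φ (Real.sqrt ((X ν).N ((X ν).cluster (j ν))) •
            ((X ν).θhat ω (j ν) - (X ν).θs (j ν))) ∂(X ν).μ
          - ∫ x, φ x ∂(multivariateGaussian 0 ((X ν).V ((X ν).cluster (j ν)))))
        atTop (𝓝 0) := by
  intro φ
  have hm : ∀ ν, 0 < (X ν).m := fun ν => (j ν).pos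
  have hnMin := Multitask.tendsto_nMin hr₂ hm h_growth
  have hNtop : Tendsto (fun ν => ((X ν).N ((X ν).cluster (j ν)) : ℝ)) atTop atTop :=
    tendsto_natCast_atTop_atTop.comp
      (tendsto_atTop_mono (fun ν => (h_cluster ν).nMin_le_N _) hnMin)
  have hNpos : ∀ᶠ ν in atTop, 0 < (X ν).N ((X ν).cluster (j ν)) :=
    (hNtop.eventually_gt_atTop 0).mono fun ν hν => by exact_mod_cast hν
  set A : ∀ ν, (X ν).Ω → Multitask.Param d := fun ν ω =>
    √((X ν).N ((X ν).cluster (j ν))) • ((X ν).θhat ω (j ν) - (X ν).θs (j ν)) with hA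
  have hAm : ∀ ν, Measurable (A ν) := fun ν => by
    have h := ((h_sampling ν).measurable_θhat (j ν)).sub_const ((X ν).θs (j ν))
    exact h.const_smul (√((X ν).N ((X ν).cluster (j ν))))
  have hBm : ∀ ν, Measurable ((X ν).leading ((X ν).cluster (j ν))) := fun ν =>
    Multitask.Model.measurable_leading hM (h_sampling ν) (h_loss ν) _
  have hclose : ∀ e : ℝ, 0 < e → Tendsto (fun ν => (X ν).μ.real
      {ω | e < ‖A ν ω - (X ν).leading ((X ν).cluster (j ν)) ω‖}) atTop (𝓝 0) := fun e he =>
    Multitask.tendsto_measure_estimator_sub hM hδ hρ hκ hr₁ hr₂ hσ₁ hσ₂ hσ₃ hσ₄ hσ₅ hα hα' hc_w hγ hζ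
      hc₀ hc₁ hc₂ hp h_sampling h_cluster h_loss h_nuis h_real h_pilot h_tuned h_est h_growth h_K h_b
      h_ξ j (fun ν ω => Multitask.Model.pooledHess_leading hM hρ hr₂ hσ₂ (h_sampling ν) (h_loss ν) _ ω) he
  have hP : ∀ ν, IsProbabilityMeasure ((X ν).μ.map (A ν)) := fun ν =>
    Measure.isProbabilityMeasure_map (hAm ν).aemeasurable
  have hV := hNpos.mono fun ν hν => Multitask.Model.V_spec hM hρ hr₁ hr₂ hσ₁ hσ₂ (h_sampling ν)
    (h_loss ν) _ hν
  have key := Multitask.tendsto_integral_sub_multivariateGaussian (P := fun ν => (X ν).μ.map (A ν))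
    (hV.mono fun ν h => h.1) (hV.mono fun ν h => h.2) (fun t => ?_) φ
  · refine key.congr fun ν => ?_
    rw [integral_map (hAm ν).aemeasurable φ.continuous.aestronglyMeasurable]
  -- The estimator is replaced by its leading term: their distance tends to zero in probability, so
  -- their characteristic functions merge at each t. Adding 1 to ‖t‖ in the tolerance covers t = 0.
  have h1 : Tendsto (fun ν => charFun ((X ν).μ.map (A ν)) t
      - charFun ((X ν).μ.map ((X ν).leading ((X ν).cluster (j ν)))) t) atTop (𝓝 0) := by
    rw [tendsto_zero_iff_norm_tendsto_zero]
    refine tendsto_order.2 ⟨fun a ha => Eventually.of_forall fun ν => ha.trans_le (norm_nonneg _),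
      fun η hη => ?_⟩
    have he : 0 < η / (2 * (‖t‖ + 1)) := by positivity
    have h2 : η / (2 * (‖t‖ + 1)) * ‖t‖ < η := by
      rw [div_mul_eq_mul_div, div_lt_iff₀ (by positivity)]
      nlinarith [norm_nonneg t]
    have h3 := ((hclose _ he).const_mul 2).const_add (η / (2 * (‖t‖ + 1)) * ‖t‖)
    rw [mul_zero, add_zero] at h3
    filter_upwards [h3.eventually_lt_const h2] with ν hν
    exact (Multitask.norm_charFun_map_sub_le (hAm ν) (hBm ν) t he.le).trans_lt hν
  have h2 : Tendsto (fun ν => charFun ((X ν).μ.map ((X ν).leading ((X ν).cluster (j ν)))) t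
      - (Real.exp (-(dotProduct t.ofLp (((X ν).V ((X ν).cluster (j ν))).mulVec t.ofLp)) / 2) : ℝ)) atTop (𝓝 0) := by
    -- Here the strict inequality r₁ > 2 is what makes the Lyapunov error a negative power of N.
    have hr : 0 < min r₁ 3 / 2 - 1 := by
      have : 2 < min r₁ 3 := lt_min hr₁ (by norm_num)
      linarith
    have h3 := ((tendsto_rpow_neg_atTop hr).comp hNtop).const_mul
      (4 * ((ρ⁻¹ * ‖t‖) ^ (min r₁ 3) * (1 + σ₁)))
    have h4 := (tendsto_inv_atTop_zero.comp hNtop).const_mul (((ρ⁻¹ * ‖t‖) ^ 2 * (1 + σ₁)) ^ 2)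
    have h5 := h3.add h4
    rw [mul_zero, mul_zero, add_zero] at h5
    refine squeeze_zero_norm' (hNpos.mono fun ν hν => ?_) h5
    have := Multitask.Model.norm_charFun_leading_sub_le hM hρ hr₁ hr₂ hσ₁ hσ₂ (h_sampling ν)
      (h_loss ν) _ hν t
    simpa only [Function.comp, neg_sub] using this
  refine (h1.add h2).congr' (Eventually.of_forall fun ν => ?_) |>.trans (le_of_eq (by rw [add_zero]))
  ring
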